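/- Let $d\in\mathbf N$, let $s,\sigma>0$ satisfy $s+\sigma\ge 1$, and let $A$ be a real $d\times d$ matrix. For $h,r>0$ and $f\in C^\infty(\mathbf R^{2d})$, with variables $(x,\xi)\in\mathbf R^d\times\mathbf R^d$, put $$\|f\|_{(h,r)}=\sup_{\alpha,\beta\in\mathbf N^d}\ \sup_{x,\xi\in\mathbf R^d}\frac{|\partial_x^\alpha\partial_\xi^\beta f(x,\xi)|}{h^{|\alpha|+|\beta|}\,\alpha!^{\sigma}\,\beta!^{s}\,e^{r(|x|^{1/s}+|\xi|^{1/\sigma})}},$$ and let $\Gamma_{(h,r)}$ be the space of all $f\in C^\infty(\mathbf R^{2d})$ with $\|f\|_{(h,r)}<\infty$, with this norm. Let $$\Gamma^{\sigma,s}_{s,\sigma;0}=\bigcup_{h>0}\bigcap_{r>0}\Gamma_{(h,r)},\qquad \Gamma^{\sigma,s;0}_{s,\sigma}=\bigcup_{r>0}\bigcap_{h>0}\Gamma_{(h,r)},\qquad \Gamma^{\sigma,s;0}_{s,\sigma;0}=\bigcap_{h,r>0}\Gamma_{(h,r)},$$ with the corresponding topologies: intersections carry the projective limit topology and unions the locally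 convex inductive limit topology. Let $\mathcal S=\mathcal S^{\sigma,s}_{s,\sigma}(\mathbf R^{2d})$ (respectively $\Sigma=\Sigma^{\sigma,s}_{s,\sigma}(\mathbf R^{2d})$) be the Gelfand–Shilov space of all $\varphi\in C^\infty(\mathbf R^{2d})$ such that for some (respectively every) $h>0$ $$\|\varphi\|_{h}=\sup\frac{|x^{\alpha_1}\xi^{\alpha_2}\partial_x^{\beta_1}\partial_\xi^{\beta_2}\varphi(x,\xi)|}{h^{|\alpha_1|+|\alpha_2|+|\beta_1|+|\beta_2|}\,\alpha_1!^{s}\,\alpha_2!^{\sigma}\,\beta_1!^{\sigma}\,\beta_2!^{s}}<\infty ,$$ the supremum being taken over all $x,\xi\in\mathbf R^d$ and all multi-indices, and let $\mathcal S'$ (respectively $\Sigma'$) be the space of all linear forms on $\mathcal S$ (respectively $\Sigma$) that are bounded with respect to $\|\cdot\|_h$ for every (respectively some) $h>0$. A function $a$ on $\mathbf R^{2d}$ is identified with the form $\varphi\mapsto\int a\varphi$ whenever these integrals converge absolutely and the form belongs to $\mathcal S'$ (respectively $\Sigma'$). Let $e^{i\langle AD_\xi,D_x\rangle}$ be the operator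 on the Schwartz space $\mathscr S(\mathbf R^{2d})$ that multiplies the Fourier transform $\widehat f(\eta,y)$ ($\eta$, $y$ being dual to $x$, $\xi$) by $e^{i\langle Ay,\eta\rangle}$, where $\widehat f(\eta,y)=(2\pi)^{-d}\iint f(x,\xi)e^{-i(\langle x,\eta\rangle+\langle\xi,y\rangle)}\,dx\,d\xi$. Then the following is true. 1. $e^{i\langle AD_\xi,D_x\rangle}$ maps $\mathcal S$ into itself, its transpose $u\mapsto u\circ e^{i\langle AD_\xi,D_x\rangle}$ maps $\mathcal S'$ into itself and extends the operator on $\mathscr S(\mathbf R^{2d})$, and this extension restricts to a (linear) homeomorphism on $\Gamma^{\sigma,s}_{s,\sigma;0}(\mathbf R^{2d})\subseteq\mathcal S'$. 2. If in addition $(s,\sigma)\neq(\tfrac12,\tfrac12)$, then $e^{i\langle AD_\xi,D_x\rangle}$ is also a (linear) homeomorphism on $\Gamma^{\sigma,s;0}_{s,\sigma}(\mathbf R^{2d})$ and on $\Gamma^{\sigma,s;0}_{s,\sigma;0}(\mathbf R^{2d})$, in the following sense. When $s+\sigma>1$, $e^{i\langle AD_\xi,D_x\rangle}$ maps $\Sigma$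 into itself, its transpose maps $\Sigma'$ into itself and extends the operator on $\mathscr S(\mathbf R^{2d})$, both classes are contained in $\Sigma'$, and this extension restricts to a homeomorphism on each of them. When $s+\sigma=1$, both classes are contained in $\mathcal S'$, and the extension in 1 restricts to a homeomorphism on each of them. -/

import Mathlib

noncomputable section

open MeasureTheory
open scoped SchwartzMap ContDiff

/-! ## Suprema of families of seminorms, locally convex inductive limits -/

section Abstract

variable {ι E : Type*} [AddCommGroup E] [Module ℂ E]

/-- The space of all vectors `f` with `sup_i q_i(f) < ∞`. -/
def boundedSubspace (q : ι → Seminorm ℂ E) : Submodule ℂ E where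
  carrier := {f | BddAbove (Set.range fun i => q i f)}
  zero_mem' := ⟨0, by rintro _ ⟨i, rfl⟩; simp⟩
  add_mem' := by
    rintro f g ⟨a, ha⟩ ⟨b, hb⟩
    refine ⟨a + b, ?_⟩
    rintro _ ⟨i, rfl⟩
    exact (map_add_le_add (q i) f g).trans (add_le_add (ha ⟨i, rfl⟩) (hb ⟨i, rfl⟩))
  smul_mem' := by
    rintro c f ⟨a, ha⟩
    refine ⟨‖c‖ * a, ?_⟩
    rintro _ ⟨i, rfl⟩
    change q i (c • f) ≤ ‖c‖ * a
    rw [map_smul_eq_mul]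
    exact mul_le_mul_of_nonneg_left (ha ⟨i, rfl⟩) (norm_nonneg c)

/-- The (semi)norm `f ↦ sup_i q_i(f)` on the space of all `f` for which it is finite. -/
def supSeminorm (q : ι → Seminorm ℂ E) : Seminorm ℂ (boundedSubspace q) :=
  Seminorm.of (fun f => ⨆ i, q i (f : E))
    (fun f g => by
      refine Real.iSup_le (fun i => ?_)
        (add_nonneg (Real.iSup_nonneg fun i => apply_nonneg (q i) _)
          (Real.iSup_nonneg fun i => apply_nonneg (q i) _))
      exact (map_add_le_add (q i) (f : E) (g : E)).trans
        (add_le_add (le_ciSup f.2 i) (le_ciSup g.2 i)))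
    (fun c f => by
      change ⨆ i, q i (c • (f : E)) = _
      simp only [map_smul_eq_mul]
      exact (Real.mul_iSup_of_nonneg (norm_nonneg c) _).symm)

/-- The topology given by the norm `f ↦ sup_i q_i(f)`. -/
instance boundedSubspace.topology (q : ι → Seminorm ℂ E) :
    TopologicalSpace (boundedSubspace q) :=
  (supSeminorm q).toAddGroupSeminorm.toSeminormedAddCommGroup.toPseudoMetricSpace.toUniformSpace.toTopologicalSpace

/-- The locally convex inductive limit topology: the finest locally convex vector space topology
for which all the maps `j i : F i → E` are continuous. -/
@[reducible] def inductiveLimitTopology {F : ι → Type*} [∀ i, TopologicalSpace (F i)] (j : ∀ i, F i → E) :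
    TopologicalSpace E :=
  sInf {t | (∀ i, @Continuous _ _ _ t (j i)) ∧ @IsTopologicalAddGroup E t _ ∧
    @ContinuousSMul ℂ E _ _ t ∧ @LocallyConvexSpace ℝ E _ _ _ _ t}

/-- The projective limit topology: the coarsest topology for which all the maps `j i : E → F i`
are continuous. -/
@[reducible] def projectiveLimitTopology {F : ι → Type*} [∀ i, TopologicalSpace (F i)] (j : ∀ i, E → F i) :
    TopologicalSpace E :=
  ⨅ i, TopologicalSpace.induced (j i) inferInstance

end Abstract

/-! ## Smooth functions on `ℝ^{d₁} × ℝ^{d₂}` and their partial derivatives -/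

/-- The positive real numbers. -/
abbrev PosReal : Type := {t : ℝ // 0 < t}

/-- `ℝ^{d₁ + d₂}` with points `x = (x₁, x₂)`, written `x.fst`, `x.snd`, and the Euclidean norm and
Lebesgue measure. -/
abbrev PhaseSpace (d₁ d₂ : ℕ) : Type :=
  WithLp 2 (EuclideanSpace ℝ (Fin d₁) × EuclideanSpace ℝ (Fin d₂))

/-- The `i`-th unit vector in the first group of variables. -/
def unitFst (d₁ d₂ : ℕ) (i : Fin d₁) : PhaseSpace d₁ d₂ :=
  WithLp.toLp 2 (EuclideanSpace.single i 1, 0)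

/-- The `i`-th unit vector in the second group of variables. -/
def unitSnd (d₁ d₂ : ℕ) (i : Fin d₂) : PhaseSpace d₁ d₂ :=
  WithLp.toLp 2 (0, EuclideanSpace.single i 1)

/-- The complex-valued `C^∞` functions on `ℝ^{d₁ + d₂}`, as a subspace of all functions. -/
def smoothSubspace (d₁ d₂ : ℕ) : Submodule ℂ (PhaseSpace d₁ d₂ → ℂ) where
  carrier := {f | ContDiff ℝ ∞ f}
  zero_mem' := by
    change ContDiff ℝ ∞ fun _ : PhaseSpace d₁ d₂ => (0 : ℂ)
    exact contDiff_const
  add_mem' := by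
    intro f g hf hg
    have hf' : ContDiff ℝ ∞ f := hf
    have hg' : ContDiff ℝ ∞ g := hg
    exact hf'.add hg'
  smul_mem' := by
    intro c f hf
    have hf' : ContDiff ℝ ∞ f := hf
    exact hf'.const_smul c

/-- The vector space `C^∞(ℝ^{d₁ + d₂})` (deliberately without a topology). -/
def SmoothFun (d₁ d₂ : ℕ) : Type := smoothSubspace d₁ d₂

namespace SmoothFun

variable {d₁ d₂ : ℕ}

instance : AddCommGroup (SmoothFun d₁ d₂) := inferInstanceAs (AddCommGroup (smoothSubspace d₁ d₂))

instance : Module ℂ (SmoothFun d₁ d₂) := inferInstanceAs (Module ℂ (smoothSubspace d₁ d₂))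

instance : CoeFun (SmoothFun d₁ d₂) (fun _ => PhaseSpace d₁ d₂ → ℂ) := ⟨fun f => f.1⟩

/-- Evaluation at a point. -/
def eval (x : PhaseSpace d₁ d₂) : SmoothFun d₁ d₂ →ₗ[ℂ] ℂ where
  toFun f := f x
  map_add' _ _ := rfl
  map_smul' _ _ := rfl

/-- The directional derivative `∂_v`. -/
def pderiv (v : PhaseSpace d₁ d₂) : SmoothFun d₁ d₂ →ₗ[ℂ] SmoothFun d₁ d₂ where
  toFun f := ⟨fun x => fderiv ℝ (f : PhaseSpace d₁ d₂ → ℂ) x v,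
    ((contDiff_infty_iff_fderiv.1 f.2).2).clm_apply contDiff_const⟩
  map_add' f g := Subtype.ext <| funext fun x => by
    have hf : DifferentiableAt ℝ f.1 x := (contDiff_infty_iff_fderiv.1 f.2).1 x
    have hg : DifferentiableAt ℝ g.1 x := (contDiff_infty_iff_fderiv.1 g.2).1 x
    change fderiv ℝ (f.1 + g.1) x v = fderiv ℝ f.1 x v + fderiv ℝ g.1 x v
    rw [fderiv_add hf hg]
    rfl
  map_smul' c f := Subtype.ext <| funext fun x => by
    have hf : DifferentiableAt ℝ f.1 x := (contDiff_infty_iff_fderiv.1 f.2).1 x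
    change fderiv ℝ (c • f.1) x v = c • fderiv ℝ f.1 x v
    rw [fderiv_const_smul hf]
    rfl

/-- The mixed partial derivative `∂_{x₁}^α ∂_{x₂}^β` for multi-indices `α`, `β`. -/
def multiDeriv (α : Fin d₁ → ℕ) (β : Fin d₂ → ℕ) : Module.End ℂ (SmoothFun d₁ d₂) :=
  (List.ofFn fun i => (pderiv (unitFst d₁ d₂ i) : Module.End ℂ (SmoothFun d₁ d₂)) ^ α i).prod *
    (List.ofFn fun i => (pderiv (unitSnd d₁ d₂ i) : Module.End ℂ (SmoothFun d₁ d₂)) ^ β i).prod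

/-- Schwartz functions are smooth. -/
def ofSchwartz : 𝓢(PhaseSpace d₁ d₂, ℂ) →ₗ[ℂ] SmoothFun d₁ d₂ where
  toFun f := ⟨f, f.smooth ⊤⟩
  map_add' _ _ := rfl
  map_smul' _ _ := rfl

end SmoothFun

/-- The length `|α|` of a multi-index. -/
def multiLength {d : ℕ} (α : Fin d → ℕ) : ℕ := ∑ i, α i

/-- The factorial `α!` of a multi-index, as a real number. -/
def multiFactorial {d : ℕ} (α : Fin d → ℕ) : ℝ := ((∏ i, (α i).factorial : ℕ) : ℝ)

/-- The monomial `x^α`. -/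
def multiPow {d : ℕ} (x : EuclideanSpace ℝ (Fin d)) (α : Fin d → ℕ) : ℝ := ∏ i, x i ^ α i

lemma multiFactorial_pos {d : ℕ} (α : Fin d → ℕ) : 0 < multiFactorial α := by
  unfold multiFactorial
  exact_mod_cast Finset.prod_pos fun i _ => Nat.factorial_pos (α i)

/-- The seminorm `f ↦ |Λ f| / w` given by a linear form `Λ` and a number `w` (which is positive in
all uses below). -/
def scaledSeminorm {E : Type*} [AddCommGroup E] [Module ℂ E] (Λ : E →ₗ[ℂ] ℂ) (w : ℝ) :
    Seminorm ℂ E :=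
  Seminorm.of (fun f => ‖Λ f‖ / |w|)
    (fun f g => by
      rw [map_add, ← add_div]
      exact div_le_div_of_nonneg_right (norm_add_le _ _) (abs_nonneg w))
    (fun c f => by rw [map_smul, norm_smul, mul_div_assoc])

lemma scaledSeminorm_antitone {E : Type*} [AddCommGroup E] [Module ℂ E] (Λ : E →ₗ[ℂ] ℂ)
    {w w' : ℝ} (hw : 0 < w) (h : w ≤ w') (f : E) :
    scaledSeminorm Λ w' f ≤ scaledSeminorm Λ w f := by
  change ‖Λ f‖ / |w'| ≤ ‖Λ f‖ / |w|
  rw [abs_of_pos hw, abs_of_pos (hw.trans_le h)]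
  exact div_le_div_of_nonneg_left (norm_nonneg _) hw h

lemma boundedSubspace_mono {ι E : Type*} [AddCommGroup E] [Module ℂ E] {q q' : ι → Seminorm ℂ E}
    (h : ∀ i f, q' i f ≤ q i f) : boundedSubspace q ≤ boundedSubspace q' := by
  rintro f ⟨a, ha⟩
  refine ⟨a, ?_⟩
  rintro _ ⟨i, rfl⟩
  exact (h i f).trans (ha ⟨i, rfl⟩)

/-! ## Symbol classes -/

section Symbols

variable (d₁ d₂ : ℕ) (s₁ s₂ σ₁ σ₂ : ℝ)

/-- `h^{|α₁ + α₂|} α₁!^{σ₁} α₂!^{σ₂} exp (r (|x₁|^{1/s₁} + |x₂|^{1/s₂}))`. -/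
def symbolWeight (h r : ℝ) (α₁ : Fin d₁ → ℕ) (α₂ : Fin d₂ → ℕ) (x : PhaseSpace d₁ d₂) : ℝ :=
  h ^ (multiLength α₁ + multiLength α₂) * multiFactorial α₁ ^ σ₁ * multiFactorial α₂ ^ σ₂ *
    Real.exp (r * (‖x.fst‖ ^ (1 / s₁) + ‖x.snd‖ ^ (1 / s₂)))

/-- The quantities `|∂_{x₁}^{α₁} ∂_{x₂}^{α₂} f(x)| / symbolWeight`, of which the norm `‖f‖_{(h,r)}`
is the supremum. -/
def symbolSeminorms (h r : ℝ) (i : (Fin d₁ → ℕ) × (Fin d₂ → ℕ) × PhaseSpace d₁ d₂) :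
    Seminorm ℂ (SmoothFun d₁ d₂) :=
  scaledSeminorm (SmoothFun.eval i.2.2 ∘ₗ SmoothFun.multiDeriv i.1 i.2.1)
    (symbolWeight d₁ d₂ s₁ s₂ σ₁ σ₂ h r i.1 i.2.1 i.2.2)

/-- The space `(Γ_{s₁,s₂}^{σ₁,σ₂})_{(h,r)}` of all smooth `f` with `‖f‖_{(h,r)} < ∞`; its topology is
given by the norm `‖f‖_{(h,r)}`. -/
abbrev symbolStep (h r : ℝ) : Submodule ℂ (SmoothFun d₁ d₂) :=
  boundedSubspace (symbolSeminorms d₁ d₂ s₁ s₂ σ₁ σ₂ h r)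

lemma symbolStep_mono {h h' r r' : ℝ} (hh : 0 < h) (h1 : h ≤ h') (h2 : r ≤ r') :
    symbolStep d₁ d₂ s₁ s₂ σ₁ σ₂ h r ≤ symbolStep d₁ d₂ s₁ s₂ σ₁ σ₂ h' r' := by
  refine boundedSubspace_mono fun i f => scaledSeminorm_antitone _ ?_ ?_ f
  · unfold symbolWeight
    have := multiFactorial_pos i.1
    have := multiFactorial_pos i.2.1
    positivity
  · unfold symbolWeight
    have := multiFactorial_pos i.1
    have := multiFactorial_pos i.2.1
    have := hh.le.trans h1
    gcongr

/-- `⋂_{r > 0} (Γ_{s₁,s₂}^{σ₁,σ₂})_{(h,r)}`. -/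
def symbolAllGrowth (h : PosReal) : Submodule ℂ (SmoothFun d₁ d₂) :=
  ⨅ r : PosReal, symbolStep d₁ d₂ s₁ s₂ σ₁ σ₂ h r

/-- `⋂_{h > 0} (Γ_{s₁,s₂}^{σ₁,σ₂})_{(h,r)}`. -/
def symbolAllScale (r : PosReal) : Submodule ℂ (SmoothFun d₁ d₂) :=
  ⨅ h : PosReal, symbolStep d₁ d₂ s₁ s₂ σ₁ σ₂ h r

/-- The class `Γ_{s₁,s₂;0}^{σ₁,σ₂}`: for some `h > 0`, `‖f‖_{(h,r)} < ∞` for every `r > 0`. -/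
def GammaRoumieuZero : Submodule ℂ (SmoothFun d₁ d₂) where
  carrier := {f | ∃ h : PosReal, f ∈ symbolAllGrowth d₁ d₂ s₁ s₂ σ₁ σ₂ h}
  zero_mem' := ⟨⟨1, one_pos⟩, zero_mem _⟩
  add_mem' := by
    rintro f g ⟨h, hf⟩ ⟨k, hg⟩
    simp only [symbolAllGrowth, Submodule.mem_iInf] at hf hg
    refine ⟨h ⊔ k, ?_⟩
    simp only [symbolAllGrowth, Submodule.mem_iInf]
    exact fun r => add_mem
      (symbolStep_mono d₁ d₂ s₁ s₂ σ₁ σ₂ h.2 (le_sup_left : h ≤ h ⊔ k) le_rfl (hf r))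
      (symbolStep_mono d₁ d₂ s₁ s₂ σ₁ σ₂ k.2 (le_sup_right : k ≤ h ⊔ k) le_rfl (hg r))
  smul_mem' := fun c _ ⟨h, hf⟩ => ⟨h, Submodule.smul_mem _ c hf⟩

/-- The class `Γ_{s₁,s₂}^{σ₁,σ₂;0}`: for some `r > 0`, `‖f‖_{(h,r)} < ∞` for every `h > 0`. -/
def GammaBeurling : Submodule ℂ (SmoothFun d₁ d₂) where
  carrier := {f | ∃ r : PosReal, f ∈ symbolAllScale d₁ d₂ s₁ s₂ σ₁ σ₂ r}
  zero_mem' := ⟨⟨1, one_pos⟩, zero_mem _⟩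
  add_mem' := by
    rintro f g ⟨r, hf⟩ ⟨k, hg⟩
    simp only [symbolAllScale, Submodule.mem_iInf] at hf hg
    refine ⟨r ⊔ k, ?_⟩
    simp only [symbolAllScale, Submodule.mem_iInf]
    exact fun h => add_mem
      (symbolStep_mono d₁ d₂ s₁ s₂ σ₁ σ₂ h.2 le_rfl (le_sup_left : r ≤ r ⊔ k) (hf h))
      (symbolStep_mono d₁ d₂ s₁ s₂ σ₁ σ₂ h.2 le_rfl (le_sup_right : k ≤ r ⊔ k) (hg h))
  smul_mem' := fun c _ ⟨r, hf⟩ => ⟨r, Submodule.smul_mem _ c hf⟩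

/-- The class `Γ_{s₁,s₂;0}^{σ₁,σ₂;0}`: `‖f‖_{(h,r)} < ∞` for all `h, r > 0`. -/
def GammaBeurlingZero : Submodule ℂ (SmoothFun d₁ d₂) :=
  ⨅ p : PosReal × PosReal, symbolStep d₁ d₂ s₁ s₂ σ₁ σ₂ p.1 p.2

/-- Projective limit over `r > 0`. -/
instance symbolAllGrowth.topology (h : PosReal) :
    TopologicalSpace (symbolAllGrowth d₁ d₂ s₁ s₂ σ₁ σ₂ h) :=
  projectiveLimitTopology fun r : PosReal =>
    Submodule.inclusion (iInf_le (fun r : PosReal => symbolStep d₁ d₂ s₁ s₂ σ₁ σ₂ h r) r)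

/-- Projective limit over `h > 0`. -/
instance symbolAllScale.topology (r : PosReal) :
    TopologicalSpace (symbolAllScale d₁ d₂ s₁ s₂ σ₁ σ₂ r) :=
  projectiveLimitTopology fun h : PosReal =>
    Submodule.inclusion (iInf_le (fun h : PosReal => symbolStep d₁ d₂ s₁ s₂ σ₁ σ₂ h r) h)

/-- Inductive limit over `h > 0` of the projective limits over `r > 0`. -/
instance GammaRoumieuZero.topology : TopologicalSpace (GammaRoumieuZero d₁ d₂ s₁ s₂ σ₁ σ₂) :=
  inductiveLimitTopology
    fun (h : PosReal) (f : symbolAllGrowth d₁ d₂ s₁ s₂ σ₁ σ₂ h) => ⟨f.1, h, f.2⟩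

/-- Inductive limit over `r > 0` of the projective limits over `h > 0`. -/
instance GammaBeurling.topology : TopologicalSpace (GammaBeurling d₁ d₂ s₁ s₂ σ₁ σ₂) :=
  inductiveLimitTopology
    fun (r : PosReal) (f : symbolAllScale d₁ d₂ s₁ s₂ σ₁ σ₂ r) => ⟨f.1, r, f.2⟩

/-- Projective limit over `h, r > 0`. -/
instance GammaBeurlingZero.topology : TopologicalSpace (GammaBeurlingZero d₁ d₂ s₁ s₂ σ₁ σ₂) :=
  projectiveLimitTopology fun p : PosReal × PosReal =>
    Submodule.inclusion
      (iInf_le (fun p : PosReal × PosReal => symbolStep d₁ d₂ s₁ s₂ σ₁ σ₂ p.1 p.2) p)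

end Symbols

/-! ## Gelfand–Shilov spaces and Gelfand–Shilov distributions -/

section GelfandShilov

variable (d₁ d₂ : ℕ) (s₁ s₂ σ₁ σ₂ : ℝ)

/-- Indices `((α₁, α₂), (β₁, β₂), x)`. -/
abbrev GSIndex : Type :=
  ((Fin d₁ → ℕ) × (Fin d₂ → ℕ)) × ((Fin d₁ → ℕ) × (Fin d₂ → ℕ)) × PhaseSpace d₁ d₂

/-- `h^{|α₁|+|α₂|+|β₁|+|β₂|} α₁!^{s₁} α₂!^{s₂} β₁!^{σ₁} β₂!^{σ₂}`. -/
def gsWeight (h : ℝ) (i : GSIndex d₁ d₂) : ℝ :=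
  h ^ (multiLength i.1.1 + multiLength i.1.2 + multiLength i.2.1.1 + multiLength i.2.1.2) *
    multiFactorial i.1.1 ^ s₁ * multiFactorial i.1.2 ^ s₂ *
    multiFactorial i.2.1.1 ^ σ₁ * multiFactorial i.2.1.2 ^ σ₂

/-- The linear form `f ↦ x₁^{α₁} x₂^{α₂} ∂_{x₁}^{β₁} ∂_{x₂}^{β₂} f(x)`. -/
def gsForm (i : GSIndex d₁ d₂) : 𝓢(PhaseSpace d₁ d₂, ℂ) →ₗ[ℂ] ℂ :=
  ((multiPow i.2.2.fst i.1.1 * multiPow i.2.2.snd i.1.2 : ℝ) : ℂ) •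
    (SmoothFun.eval i.2.2 ∘ₗ SmoothFun.multiDeriv i.2.1.1 i.2.1.2 ∘ₗ SmoothFun.ofSchwartz)

/-- The quantities `|x₁^{α₁} x₂^{α₂} ∂_{x₁}^{β₁} ∂_{x₂}^{β₂} f(x)| / gsWeight`. -/
def gsSeminorms (h : ℝ) (i : GSIndex d₁ d₂) : Seminorm ℂ 𝓢(PhaseSpace d₁ d₂, ℂ) :=
  scaledSeminorm (gsForm d₁ d₂ i) (gsWeight d₁ d₂ s₁ s₂ σ₁ σ₂ h i)

/-- The space of functions with finite Gelfand–Shilov norm with parameter `h`. (A smooth function for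
which this norm is finite is automatically a Schwartz function.) -/
abbrev gsStep (h : ℝ) : Submodule ℂ 𝓢(PhaseSpace d₁ d₂, ℂ) :=
  boundedSubspace (gsSeminorms d₁ d₂ s₁ s₂ σ₁ σ₂ h)

lemma gsStep_mono {h h' : ℝ} (hh : 0 < h) (h1 : h ≤ h') :
    gsStep d₁ d₂ s₁ s₂ σ₁ σ₂ h ≤ gsStep d₁ d₂ s₁ s₂ σ₁ σ₂ h' := by
  refine boundedSubspace_mono fun i f => scaledSeminorm_antitone _ ?_ ?_ f
  · unfold gsWeight
    have := multiFactorial_pos i.1.1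
    have := multiFactorial_pos i.1.2
    have := multiFactorial_pos i.2.1.1
    have := multiFactorial_pos i.2.1.2
    positivity
  · unfold gsWeight
    have := multiFactorial_pos i.1.1
    have := multiFactorial_pos i.1.2
    have := multiFactorial_pos i.2.1.1
    have := multiFactorial_pos i.2.1.2
    gcongr

/-- The Gelfand–Shilov space `𝒮_{s₁,s₂}^{σ₁,σ₂}(ℝ^{d₁+d₂})` (of Roumieu type). -/
def GSRoumieu : Submodule ℂ 𝓢(PhaseSpace d₁ d₂, ℂ) where
  carrier := {f | ∃ h : PosReal, f ∈ gsStep d₁ d₂ s₁ s₂ σ₁ σ₂ h}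
  zero_mem' := ⟨⟨1, one_pos⟩, zero_mem _⟩
  add_mem' := by
    rintro f g ⟨h, hf⟩ ⟨k, hg⟩
    exact ⟨h ⊔ k, add_mem
      (gsStep_mono d₁ d₂ s₁ s₂ σ₁ σ₂ h.2 (le_sup_left : h ≤ h ⊔ k) hf)
      (gsStep_mono d₁ d₂ s₁ s₂ σ₁ σ₂ k.2 (le_sup_right : k ≤ h ⊔ k) hg)⟩
  smul_mem' := fun c _ ⟨h, hf⟩ => ⟨h, Submodule.smul_mem _ c hf⟩

/-- The Gelfand–Shilov space `Σ_{s₁,s₂}^{σ₁,σ₂}(ℝ^{d₁+d₂})` (of Beurling type). -/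
def GSBeurling : Submodule ℂ 𝓢(PhaseSpace d₁ d₂, ℂ) :=
  ⨅ h : PosReal, gsStep d₁ d₂ s₁ s₂ σ₁ σ₂ h

/-- The distribution space `(𝒮_{s₁,s₂}^{σ₁,σ₂})'(ℝ^{d₁+d₂})`: linear forms which, for every `h > 0`,
are bounded with respect to the Gelfand–Shilov norm with parameter `h`. -/
def GSRoumieuDual : Set (GSRoumieu d₁ d₂ s₁ s₂ σ₁ σ₂ →ₗ[ℂ] ℂ) :=
  {u | ∀ h : PosReal, ∃ C : ℝ, ∀ (φ : GSRoumieu d₁ d₂ s₁ s₂ σ₁ σ₂)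
    (hφ : (φ : 𝓢(PhaseSpace d₁ d₂, ℂ)) ∈ gsStep d₁ d₂ s₁ s₂ σ₁ σ₂ h),
      ‖u φ‖ ≤ C * supSeminorm (gsSeminorms d₁ d₂ s₁ s₂ σ₁ σ₂ h) ⟨φ, hφ⟩}

/-- The distribution space `(Σ_{s₁,s₂}^{σ₁,σ₂})'(ℝ^{d₁+d₂})`: linear forms which, for some `h > 0`,
are bounded with respect to the Gelfand–Shilov norm with parameter `h`. -/
def GSBeurlingDual : Set (GSBeurling d₁ d₂ s₁ s₂ σ₁ σ₂ →ₗ[ℂ] ℂ) :=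
  {u | ∃ h : PosReal, ∃ C : ℝ, ∀ (φ : GSBeurling d₁ d₂ s₁ s₂ σ₁ σ₂)
    (hφ : (φ : 𝓢(PhaseSpace d₁ d₂, ℂ)) ∈ gsStep d₁ d₂ s₁ s₂ σ₁ σ₂ h),
      ‖u φ‖ ≤ C * supSeminorm (gsSeminorms d₁ d₂ s₁ s₂ σ₁ σ₂ h) ⟨φ, hφ⟩}

/-- The linear form `u` on the test function space `S` is the one given by the function `a`, that is,
`u(φ) = ∫ a φ` for all `φ` in `S`, with absolutely convergent integrals. -/
def IsGivenBy {d₁ d₂ : ℕ} {S : Submodule ℂ 𝓢(PhaseSpace d₁ d₂, ℂ)} (u : S →ₗ[ℂ] ℂ)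
    (a : PhaseSpace d₁ d₂ → ℂ) : Prop :=
  ∀ φ : S, Integrable (fun x => a x * (φ : 𝓢(PhaseSpace d₁ d₂, ℂ)) x) ∧
    u φ = ∫ x, a x * (φ : 𝓢(PhaseSpace d₁ d₂, ℂ)) x

end GelfandShilov

/-! ## The operator `exp (i ⟨A D_ξ, D_x⟩)` -/

section Operator

variable {d : ℕ}

/-- The symbol of `exp (i ⟨A D_ξ, D_x⟩)`, `D = -i∂`, at the point `(η, y)` dual to `(x, ξ)`. Since the
Fourier transform of Mathlib is `∫ f(z) exp (-2πi ⟨z, ζ⟩) dz`, the operators `D_x` and `D_ξ`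
correspond to multiplication by `2πη` and `2πy`. -/
def expADMultiplier (A : Matrix (Fin d) (Fin d) ℝ) (ζ : PhaseSpace d d) : ℂ :=
  Complex.exp (Complex.I *
    (inner ℝ (Matrix.toEuclideanLin A ((2 * Real.pi) • ζ.snd)) ((2 * Real.pi) • ζ.fst) : ℝ))

lemma hasTemperateGrowth_cexp_I : Function.HasTemperateGrowth
    (fun t : ℝ => Complex.exp (Complex.I * (t : ℂ))) := by
  have hd : ∀ t : ℝ, HasDerivAt (fun t : ℝ => Complex.exp (Complex.I * (t : ℂ)))
      (Complex.I * Complex.exp (Complex.I * (t : ℂ))) t := fun t => by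
    have h := ((Complex.ofRealCLM.hasDerivAt (x := t)).const_mul Complex.I).cexp
    simpa [mul_comm] using h
  have hk : ∀ n : ℕ, iteratedDeriv n (fun t : ℝ => Complex.exp (Complex.I * (t : ℂ))) =
      fun t : ℝ => Complex.I ^ n * Complex.exp (Complex.I * (t : ℂ)) := by
    intro n
    induction n with
    | zero => simp
    | succ n ih =>
      rw [iteratedDeriv_succ, ih]
      funext t
      rw [((hd t).const_mul (Complex.I ^ n)).deriv]
      ring
  refine ⟨(contDiff_const.mul Complex.ofRealCLM.contDiff).cexp, fun n => ⟨0, 1, fun t => ?_⟩⟩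
  rw [norm_iteratedFDeriv_eq_norm_iteratedDeriv, hk n]
  simp [Complex.norm_exp]

/-- The multiplier is smooth with derivatives of at most polynomial growth. -/
lemma hasTemperateGrowth_expADMultiplier (A : Matrix (Fin d) (Fin d) ℝ) :
    (expADMultiplier A).HasTemperateGrowth := by
  let p : PhaseSpace d d →L[ℝ] EuclideanSpace ℝ (Fin d) := (2 * Real.pi) • WithLp.fstL 2 ℝ _ _
  let q : PhaseSpace d d →L[ℝ] EuclideanSpace ℝ (Fin d) :=
    (LinearMap.toContinuousLinearMap (Matrix.toEuclideanLin A)) ∘L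
      ((2 * Real.pi) • WithLp.sndL 2 ℝ _ _)
  have h := (innerSL ℝ (E := EuclideanSpace ℝ (Fin d))).bilinear_hasTemperateGrowth (𝕜 := ℝ)
    (f := q) (g := p) q.hasTemperateGrowth p.hasTemperateGrowth
  exact hasTemperateGrowth_cexp_I.comp h

/-- The operator `exp (i ⟨A D_ξ, D_x⟩)` on `𝓢(ℝ^{2d})`, as a Fourier multiplier. -/
def expAD (A : Matrix (Fin d) (Fin d) ℝ) :
    𝓢(PhaseSpace d d, ℂ) →L[ℂ] 𝓢(PhaseSpace d d, ℂ) :=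
  SchwartzMap.fourierMultiplierCLM ℂ (expADMultiplier A)

/-- `L` is the extension of `exp (i ⟨A D_ξ, D_x⟩)` to a space `D` of continuous linear forms on the
test function space `S`: the operator on `𝓢(ℝ^{2d})` leaves `S` invariant, `L` is the transpose of
its restriction to `S`, and `L` agrees with it on the linear forms given by Schwartz functions. -/
structure IsDistributionalExtension (A : Matrix (Fin d) (Fin d) ℝ)
    {S : Submodule ℂ 𝓢(PhaseSpace d d, ℂ)} {D : Set (S →ₗ[ℂ] ℂ)} (L : D → D) : Prop where
  maps_test : ∀ φ ∈ S, expAD A φ ∈ S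
  transpose : ∀ (u : D) (φ : S), (L u).1 φ = u.1 ⟨expAD A φ, maps_test φ φ.2⟩
  extends_schwartz : ∀ ψ : 𝓢(PhaseSpace d d, ℂ), ∃ u : D,
    IsGivenBy u.1 ψ ∧ IsGivenBy (L u).1 (expAD A ψ)

/-- The operator `L` on the distribution space `D` restricts to a homeomorphism on the space `Γ` of
smooth functions (viewed as distributions): there is a topological linear isomorphism `E` of `Γ`
onto itself whose graph consists of all `(a, b)` such that `b`, viewed as a distribution, is the image under
`L` of `a`. -/
def RestrictsToHomeomorphism {S : Submodule ℂ 𝓢(PhaseSpace d d, ℂ)} {D : Set (S →ₗ[ℂ] ℂ)}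
    (L : D → D) (Γ : Submodule ℂ (SmoothFun d d)) [TopologicalSpace Γ] : Prop :=
  ∃ E : Γ ≃L[ℂ] Γ, ∀ a b : Γ,
    E a = b ↔ ∃ u : D, IsGivenBy u.1 (a : SmoothFun d d) ∧ IsGivenBy (L u).1 (b : SmoothFun d d)

end Operator

end

noncomputable section

open MeasureTheory
open scoped SchwartzMap ContDiff Nat

/-! ## Coordinates and partial derivatives on phase space -/

section Coordinates

variable {d : ℕ}

/-! Both blocks of variables are treated at once. The coordinates z_i are indexed by `Fin d ⊕ Fin
d`, and each carries a regularity exponent τ_i (σ on x, s on ξ) and a growth exponent θ_i (s on x, σ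
on ξ), so that τ_i + θ_i = s + σ. Symbols and test functions obey the same kind of estimate
`SymbolBound`, with positive or negative growth parameter.

Test functions. The phase of the multiplier is bilinear across the two blocks. Hence z_i `expAD A` =
`expAD A` (z_i + i∂_v), where v depends on i and lies in the block opposite to z_i
(`coord_mul_expAD`). The two summands commute, so the n-th power expands by the binomial formula.
Powers of z_i cost factorials to the exponent θ_i, and so do derivatives along v, because τ in the
opposite block equals θ_i. With the continuity of `expAD A` on Schwartz functions this gives |z_i^n
`expAD A` u| ≤ C κ^n n!^θ_i, and the best choice of n turns this into decay exp(-c|z_i|^(1/θ_i)).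
Derivatives commute with the operator, so the full estimate follows (`exists_expAD_symbolBound`).
The constant κ is small when u has strong decay and a small scale h, which settles the Beurling
case.

Symbols. Choose a window w, itself of Gelfand–Shilov type, whose lattice translates sum to 1. Each
piece f w(·-k) is moved to the origin, transformed there with constants independent of k, and moved
back. Translating f costs exp(c r|k|^(1/θ)), while decay around k, traded for growth in z, gains
exp(-c'|k|^(1/θ)); if r is small enough against c' the series converges with the required bounds
(`exists_symbolOp_bound`). The sum F satisfies ∫ F u = ∫ f `expAD A` u (`isTransform_sum`), and
pairings determine a symbol, since conj(f w_k) w_k, with w_k = w(·-k), is a test function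
(`eq_zero_of_integral_detector`). Linearity, and inversion by -A, follow from this uniqueness
(`IsDistributionalExtension.restrictsToHomeomorphism`).

Windows are products of functions of one variable, each built from an entire function G of order p
with decay exp(-a|x|^p) on the real axis. Cauchy's estimates give the exponents τ = 1 - 1/p and θ =
1/p, and t ↦ ∫_(t-1)^t G, normalized, has integer translates summing to 1. For 1 < p < 2 the
function G is a product of powers of cos(z/2^k) (`isEntireWindow_cosProd`); p = 2 is the Gaussian,
and larger orders come from z ↦ z². A window of Roumieu type thus exists for s + σ ≥ 1, one of
Beurling type for s + σ > 1.

On the critical line s + σ = 1 no Beurling window is used. There a Taylor expansion shows that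
bounds at a small scale h force arbitrarily slow growth (`exists_symbolBound_of_scale`), so the two
Beurling classes coincide as sets. As the Roumieu operator commutes with derivatives, its sup bound
applied to ∂^γ f preserves every scale (`exists_symbolOp_entire`). -/

/-- The `i`-th coordinate on `ℝ^{2d}`. -/
def coord (i : Fin d ⊕ Fin d) : PhaseSpace d d →L[ℝ] ℝ :=
  Sum.elim (fun j => EuclideanSpace.proj j ∘L WithLp.fstL 2 ℝ _ _)
    (fun j => EuclideanSpace.proj j ∘L WithLp.sndL 2 ℝ _ _) i

/-- The `i`-th unit vector of `ℝ^{2d}`. -/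
def bvec (i : Fin d ⊕ Fin d) : PhaseSpace d d := Sum.elim (unitFst d d) (unitSnd d d) i

lemma coord_inl (j : Fin d) (z : PhaseSpace d d) : coord (Sum.inl j) z = z.fst j := rfl

lemma coord_inr (j : Fin d) (z : PhaseSpace d d) : coord (Sum.inr j) z = z.snd j := rfl

lemma coord_bvec (i j : Fin d ⊕ Fin d) : coord i (bvec j) = if i = j then 1 else 0 := by
  rcases i with i | i <;> rcases j with j | j <;>
    simp [bvec, unitFst, unitSnd, coord_inl, coord_inr]

lemma ext_coord {z w : PhaseSpace d d} (h : ∀ i, coord i z = coord i w) : z = w := by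
  have h1 : z.fst = w.fst := by ext j; exact h (Sum.inl j)
  have h2 : z.snd = w.snd := by ext j; exact h (Sum.inr j)
  exact (WithLp.ofLp_injective 2) (Prod.ext h1 h2)

lemma sum_coord_smul_bvec (z : PhaseSpace d d) : ∑ i, coord i z • bvec i = z := by
  refine ext_coord fun j => ?_
  simp [map_sum, coord_bvec, -Fintype.sum_sum_type]

lemma norm_bvec_le (i : Fin d ⊕ Fin d) : ‖(bvec i : PhaseSpace d d)‖ ≤ 1 := by
  rcases i with i | i <;> simp [bvec, unitFst, unitSnd]

lemma norm_le_sum_coord (z : PhaseSpace d d) : ‖z‖ ≤ ∑ i, |coord i z| := by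
  conv_lhs => rw [← sum_coord_smul_bvec z]
  refine (norm_sum_le _ _).trans (Finset.sum_le_sum fun i _ => ?_)
  rw [norm_smul, Real.norm_eq_abs]
  exact mul_le_of_le_one_right (abs_nonneg _) (norm_bvec_le i)

lemma norm_fst_le' (z : PhaseSpace d d) : ‖z.fst‖ ≤ ‖z‖ := by
  rw [WithLp.prod_norm_eq_of_L2]
  exact Real.le_sqrt_of_sq_le (by nlinarith [sq_nonneg ‖z.snd‖])

lemma norm_snd_le' (z : PhaseSpace d d) : ‖z.snd‖ ≤ ‖z‖ := by
  rw [WithLp.prod_norm_eq_of_L2]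
  exact Real.le_sqrt_of_sq_le (by nlinarith [sq_nonneg ‖z.fst‖])

lemma abs_coord_le (i : Fin d ⊕ Fin d) (z : PhaseSpace d d) : |coord i z| ≤ ‖z‖ := by
  rcases i with i | i
  · exact (PiLp.norm_apply_le z.fst i).trans (norm_fst_le' z)
  · exact (PiLp.norm_apply_le z.snd i).trans (norm_snd_le' z)

end Coordinates

namespace SmoothFun

variable {d : ℕ}

lemma contDiff (f : SmoothFun d d) : ContDiff ℝ ∞ f := f.2

lemma differentiable (f : SmoothFun d d) : Differentiable ℝ f :=
  (contDiff_infty_iff_fderiv.1 f.2).1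

lemma continuous (f : SmoothFun d d) : Continuous f := f.contDiff.continuous

@[ext] lemma ext {f g : SmoothFun d d} (h : ∀ z, f z = g z) : f = g := Subtype.ext (funext h)

@[simp] lemma add_apply (f g : SmoothFun d d) (z : PhaseSpace d d) : (f + g) z = f z + g z := rfl

@[simp] lemma smul_apply (c : ℂ) (f : SmoothFun d d) (z : PhaseSpace d d) :
    (c • f) z = c * f z := rfl

lemma sum_apply {ι : Type*} (s : Finset ι) (f : ι → SmoothFun d d) (z : PhaseSpace d d) :
    (∑ i ∈ s, f i) z = ∑ i ∈ s, f i z := map_sum (eval z) f s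

lemma pderiv_apply (v : PhaseSpace d d) (f : SmoothFun d d) (z : PhaseSpace d d) :
    pderiv v f z = fderiv ℝ f z v := rfl

lemma pderiv_eq_sum (v : PhaseSpace d d) :
    (pderiv v : SmoothFun d d →ₗ[ℂ] SmoothFun d d) =
      ∑ i, (coord i v : ℂ) • pderiv (bvec i) := by
  ext f z
  rw [LinearMap.sum_apply, sum_apply, pderiv_apply]
  conv_lhs => rw [← sum_coord_smul_bvec v]
  simp only [map_sum, map_smul]
  rfl

lemma pderiv_comm (v w : PhaseSpace d d) :
    Commute (pderiv v : Module.End ℂ (SmoothFun d d)) (pderiv w) := by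
  refine LinearMap.ext fun f => SmoothFun.ext fun z => ?_
  have hf : ContDiff ℝ ∞ (fderiv ℝ f) := (contDiff_infty_iff_fderiv.1 f.2).2
  have hd : DifferentiableAt ℝ (fderiv ℝ f) z := (contDiff_infty_iff_fderiv.1 hf).1 z
  have key : ∀ a b : PhaseSpace d d,
      pderiv a (pderiv b f) z = fderiv ℝ (fderiv ℝ f) z a b := by
    intro a b
    change fderiv ℝ (fun x => fderiv ℝ f x b) z a = _
    rw [fderiv_clm_apply hd (differentiableAt_const _)]
    simp
  change pderiv v (pderiv w f) z = pderiv w (pderiv v f) z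
  rw [key, key]
  exact (f.contDiff.contDiffAt.isSymmSndFDerivAt (by simpa using WithTop.coe_le_coe.2 (le_top : (2 : ℕ∞) ≤ ⊤))) v w

/-- The product of smooth functions. -/
def mulL : SmoothFun d d →ₗ[ℂ] SmoothFun d d →ₗ[ℂ] SmoothFun d d :=
  LinearMap.mk₂ ℂ (fun f g => ⟨fun z => f z * g z, f.contDiff.mul g.contDiff⟩)
    (fun _ _ _ => SmoothFun.ext fun _ => add_mul _ _ _)
    (fun _ _ _ => SmoothFun.ext fun _ => mul_assoc _ _ _)
    (fun _ _ _ => SmoothFun.ext fun _ => mul_add _ _ _)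
    (fun _ _ _ => SmoothFun.ext fun _ => mul_left_comm _ _ _)

@[simp] lemma mulL_apply (f g : SmoothFun d d) (z : PhaseSpace d d) :
    mulL f g z = f z * g z := rfl

lemma pderiv_mulL (v : PhaseSpace d d) (f g : SmoothFun d d) :
    pderiv v (mulL f g) = mulL (pderiv v f) g + mulL f (pderiv v g) := by
  ext z
  change fderiv ℝ (fun x => f x * g x) z v = _
  rw [fderiv_fun_mul (f.differentiable z) (g.differentiable z)]
  simp [pderiv_apply]
  ring

lemma pderiv_pow_mulL (v : PhaseSpace d d) (n : ℕ) (f g : SmoothFun d d) :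
    ((pderiv v : Module.End ℂ (SmoothFun d d)) ^ n) (mulL f g) =
      ∑ p ∈ Finset.HasAntidiagonal.antidiagonal n, n.choose p.1 •
        mulL (((pderiv v : Module.End ℂ (SmoothFun d d)) ^ p.1) f)
          (((pderiv v : Module.End ℂ (SmoothFun d d)) ^ p.2) g) := by
  induction n with
  | zero => simp
  | succ n ih =>
    have := Finset.sum_antidiagonal_choose_succ_nsmul (fun i j =>
        mulL (((pderiv v : Module.End ℂ (SmoothFun d d)) ^ i) f)
          (((pderiv v : Module.End ℂ (SmoothFun d d)) ^ j) g)) n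
    rw [pow_succ', Module.End.mul_apply, ih, map_sum, this, ← Finset.sum_add_distrib]
    refine Finset.sum_congr rfl fun p hp => ?_
    rw [map_nsmul]
    erw [pderiv_mulL]
    -- The Pascal-type identity puts `n.choose p.2` in its second sum; on the antidiagonal of n the
    -- two binomial coefficients agree, so the sums merge term by term.
    have h1 : n.choose p.2 = n.choose p.1 := by
      rw [Finset.HasAntidiagonal.mem_antidiagonal] at hp
      exact Nat.choose_symm_of_eq_add (by omega)
    rw [h1, ← nsmul_add, pow_succ', pow_succ', Module.End.mul_apply, Module.End.mul_apply, add_comm]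

/-- Translation. -/
def shift (k : PhaseSpace d d) : SmoothFun d d →ₗ[ℂ] SmoothFun d d where
  toFun f := ⟨fun z => f (z + k), f.contDiff.comp (contDiff_id.add contDiff_const)⟩
  map_add' _ _ := rfl
  map_smul' _ _ := rfl

@[simp] lemma shift_apply (k : PhaseSpace d d) (f : SmoothFun d d) (z : PhaseSpace d d) :
    shift k f z = f (z + k) := rfl

lemma pderiv_shift (v k : PhaseSpace d d) (f : SmoothFun d d) :
    pderiv v (shift k f) = shift k (pderiv v f) := by
  ext z
  change fderiv ℝ (fun x => f (x + k)) z v = fderiv ℝ f (z + k) v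
  rw [fderiv_comp_add_right]

/-- Complex conjugation. -/
def conj (f : SmoothFun d d) : SmoothFun d d :=
  ⟨fun z => star (f z), Complex.conjCLE.contDiff.comp f.contDiff⟩

@[simp] lemma conj_apply (f : SmoothFun d d) (z : PhaseSpace d d) : conj f z = star (f z) := rfl

lemma pderiv_conj (v : PhaseSpace d d) (f : SmoothFun d d) :
    pderiv v (conj f) = conj (pderiv v f) := by
  ext z
  change fderiv ℝ (fun x => Complex.conjCLE (f x)) z v = star (fderiv ℝ f z v)
  rw [show (fun x => Complex.conjCLE (f x)) = Complex.conjCLE ∘ (f : PhaseSpace d d → ℂ) from rfl,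
    ContinuousLinearEquiv.comp_fderiv]
  rfl

/-- The mixed partial derivative `∂^γ`. -/
def mder (γ : Fin d ⊕ Fin d → ℕ) : Module.End ℂ (SmoothFun d d) :=
  multiDeriv (fun i => γ (Sum.inl i)) (fun i => γ (Sum.inr i))

lemma commute_list_prod_ofFn {M : Type*} [Monoid M] {n : ℕ} (f : Fin n → M) (x : M)
    (h : ∀ i, Commute x (f i)) : Commute x (List.ofFn f).prod := by
  refine Commute.list_prod_right _ _ fun y hy => ?_
  obtain ⟨i, rfl⟩ := (List.mem_ofFn' f y).1 hy
  exact h i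

/-- `multiDeriv` is an ordered product in a noncommutative monoid of endomorphisms. This
rearrangement is what makes exponents of mixed derivatives additive in `mder_add`. -/
lemma list_prod_ofFn_mul {M : Type*} [Monoid M] : ∀ {n : ℕ} (f g : Fin n → M),
    (∀ i j, Commute (f i) (g j)) →
    (List.ofFn fun i => f i * g i).prod = (List.ofFn f).prod * (List.ofFn g).prod
  | 0, _, _, _ => by simp
  | n + 1, f, g, h => by
    have hc : Commute (g 0) (List.ofFn fun i : Fin n => f i.succ).prod :=
      commute_list_prod_ofFn _ _ fun i => (h _ _).symm
    simp only [List.ofFn_succ, List.prod_cons]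
    rw [list_prod_ofFn_mul (fun i => f i.succ) (fun i => g i.succ) fun i j => h _ _,
      mul_assoc, ← mul_assoc (g 0), hc.eq]
    simp only [mul_assoc]

lemma mder_zero : (mder 0 : Module.End ℂ (SmoothFun d d)) = 1 := by
  simp [mder, multiDeriv]

lemma mder_add (γ δ : Fin d ⊕ Fin d → ℕ) :
    (mder (γ + δ) : Module.End ℂ (SmoothFun d d)) = mder γ * mder δ := by
  have hc : ∀ (v w : PhaseSpace d d) (m n : ℕ),
      Commute ((pderiv v : Module.End ℂ (SmoothFun d d)) ^ m) (pderiv w ^ n) :=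
    fun v w m n => (pderiv_comm v w).pow_pow m n
  simp only [mder, multiDeriv, Pi.add_apply, pow_add]
  rw [list_prod_ofFn_mul _ _ fun i j => hc _ _ _ _, list_prod_ofFn_mul _ _ fun i j => hc _ _ _ _]
  have : Commute (List.ofFn fun i => (pderiv (unitFst d d i) : Module.End ℂ (SmoothFun d d)) ^
      δ (Sum.inl i)).prod (List.ofFn fun i => (pderiv (unitSnd d d i) :
        Module.End ℂ (SmoothFun d d)) ^ γ (Sum.inr i)).prod :=
    commute_list_prod_ofFn _ _ fun i =>
      (commute_list_prod_ofFn _ _ fun j => hc _ _ _ _).symm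
  exact this.mul_mul_mul_comm _ _

lemma list_prod_ofFn_single {M : Type*} [Monoid M] : ∀ {n : ℕ} (f : Fin n → M) (i : Fin n),
    (∀ j, j ≠ i → f j = 1) → (List.ofFn f).prod = f i
  | n + 1, f, i, h => by
    rw [List.ofFn_succ, List.prod_cons]
    refine Fin.cases ?_ (fun i => ?_) i h
    · intro h
      rw [List.prod_eq_one, mul_one]
      intro x hx
      obtain ⟨j, rfl⟩ := (List.mem_ofFn' _ _).1 hx
      exact h _ (Fin.succ_ne_zero j)
    · intro h
      rw [h 0 (Fin.succ_ne_zero i).symm, one_mul]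
      exact list_prod_ofFn_single (fun i => f i.succ) i fun j hj =>
        h _ fun e => hj (Fin.succ_injective _ e)

lemma mder_single (i : Fin d ⊕ Fin d) (n : ℕ) :
    (mder (Pi.single i n) : Module.End ℂ (SmoothFun d d)) = pderiv (bvec i) ^ n := by
  have hone : ∀ (L : List (Module.End ℂ (SmoothFun d d))), (∀ x ∈ L, x = 1) → L.prod = 1 :=
    fun L h => List.prod_eq_one h
  rcases i with i | i
  · simp only [mder, multiDeriv]
    rw [list_prod_ofFn_single _ i fun j hj => by simp [hj]]
    rw [hone (List.ofFn _)]
    · simp [bvec]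
    · intro x hx
      obtain ⟨j, rfl⟩ := (List.mem_ofFn' _ _).1 hx
      simp
  · simp only [mder, multiDeriv]
    rw [hone (List.ofFn _), one_mul, list_prod_ofFn_single _ i fun j hj => by simp [hj]]
    · simp [bvec]
    · intro x hx
      obtain ⟨j, rfl⟩ := (List.mem_ofFn' _ _).1 hx
      simp

lemma mder_add_single (γ : Fin d ⊕ Fin d → ℕ) (i : Fin d ⊕ Fin d) (f : SmoothFun d d) :
    mder (γ + Pi.single i 1) f = mder γ (pderiv (bvec i) f) := by
  rw [mder_add, mder_single, pow_one]; rfl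

lemma mder_add_single' (γ : Fin d ⊕ Fin d → ℕ) (i : Fin d ⊕ Fin d) (f : SmoothFun d d) :
    mder (γ + Pi.single i 1) f = pderiv (bvec i) (mder γ f) := by
  rw [add_comm, mder_add, mder_single, pow_one]; rfl

lemma mder_add_apply (γ δ : Fin d ⊕ Fin d → ℕ) (f : SmoothFun d d) :
    mder (γ + δ) f = mder γ (mder δ f) := by
  rw [mder_add]; rfl

@[simp] lemma mder_zero_apply (f : SmoothFun d d) : mder 0 f = f := by
  rw [mder_zero]; rfl

/-- Every multi-index arises from 0 by raising one entry at a time, so identities for `mder` reduce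
to single partial derivatives. -/
lemma multiindex_induction {ι : Type*} [Fintype ι] [DecidableEq ι] {P : (ι → ℕ) → Prop} (h0 : P 0)
    (hs : ∀ γ i, P γ → P (γ + Pi.single i 1)) (γ : ι → ℕ) : P γ := by
  induction hn : ∑ i, γ i generalizing γ with
  | zero =>
    have : γ = 0 := by
      funext i
      exact (Finset.sum_eq_zero_iff.1 hn) i (Finset.mem_univ i)
    exact this ▸ h0
  | succ n ih =>
    obtain ⟨i, hi⟩ : ∃ i, γ i ≠ 0 := by
      by_contra! h
      simp [h] at hn
    have hγ : γ = (γ - Pi.single i 1) + Pi.single i 1 := by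
      funext j
      by_cases hj : j = i
      · subst hj; simp; omega
      · simp [hj]
    rw [hγ]
    refine hs _ _ (ih _ ?_)
    have := congrArg (fun γ : ι → ℕ => ∑ j, γ j) hγ
    simp only [Pi.add_apply, Finset.sum_add_distrib] at this
    rw [hn, Finset.sum_pi_single' i 1 Finset.univ] at this
    simp at this
    simpa using this.symm

lemma mder_shift (γ : Fin d ⊕ Fin d → ℕ) (k : PhaseSpace d d) (f : SmoothFun d d) :
    mder γ (shift k f) = shift k (mder γ f) := by
  induction γ using multiindex_induction with
  | h0 => simp
  | hs γ i ih => rw [mder_add_single', mder_add_single', ih, pderiv_shift]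

lemma mder_conj (γ : Fin d ⊕ Fin d → ℕ) (f : SmoothFun d d) :
    mder γ (conj f) = conj (mder γ f) := by
  induction γ using multiindex_induction with
  | h0 => simp
  | hs γ i ih => rw [mder_add_single', mder_add_single', ih, pderiv_conj]

end SmoothFun

/-! ## Elementary inequalities -/

section Elementary

/-- This is u^n/n! ≤ e^u at u = (b/θ) t^(1/θ), raised to the power θ. It converts exponential decay
into factorial bounds for monomials. -/
lemma pow_le_exp_rpow {t b θ : ℝ} (ht : 0 ≤ t) (hb : 0 < b) (hθ : 0 < θ) (n : ℕ) :
    t ^ n ≤ ((θ / b) ^ θ) ^ n * (n ! : ℝ) ^ θ * Real.exp (b * t ^ (1 / θ)) := by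
  set u := b / θ * t ^ (1 / θ) with hu
  have hu0 : 0 ≤ u := by positivity
  have h1 : u ^ n ≤ n ! * Real.exp u := by
    have := Real.pow_div_factorial_le_exp u hu0 n
    rwa [div_le_iff₀' (by positivity)] at this
  have h2 := Real.rpow_le_rpow (by positivity) h1 hθ.le
  rw [Real.mul_rpow (by positivity) (by positivity), ← Real.exp_mul] at h2
  have h3 : (u ^ n) ^ θ = ((b / θ) ^ θ) ^ n * t ^ n := by
    rw [hu, mul_pow, Real.mul_rpow (by positivity) (by positivity)]
    congr 1
    · rw [← Real.rpow_natCast, ← Real.rpow_natCast, ← Real.rpow_mul (by positivity),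
        ← Real.rpow_mul (by positivity), mul_comm]
    · rw [← Real.rpow_natCast (t ^ (1 / θ)), ← Real.rpow_mul ht, ← Real.rpow_mul ht,
        ← Real.rpow_natCast]
      congr 1
      field_simp
  have h4 : u * θ = b * t ^ (1 / θ) := by rw [hu]; field_simp
  rw [h3, h4] at h2
  have h5 : (θ / b) ^ θ * (b / θ) ^ θ = 1 := by
    rw [← Real.mul_rpow (by positivity) (by positivity)]
    have : θ / b * (b / θ) = 1 := by field_simp
    rw [this, Real.one_rpow]
  calc t ^ n = ((θ / b) ^ θ * (b / θ) ^ θ) ^ n * t ^ n := by rw [h5]; simp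
    _ = ((θ / b) ^ θ) ^ n * (((b / θ) ^ θ) ^ n * t ^ n) := by rw [mul_pow]; ring
    _ ≤ ((θ / b) ^ θ) ^ n * ((n ! : ℝ) ^ θ * Real.exp (b * t ^ (1 / θ))) := by gcongr
    _ = _ := by ring

/-- The converse of `pow_le_exp_rpow`: by Stirling-type optimization, a factorial bound valid for
all n yields exponential decay. With u as below and n = ⌊u⌋ one has κ n^θ ≤ t/e, hence κ^n n!^θ ≤ (κ
n^θ)^n ≤ e^(-n) t^n; the factor e pays for rounding. -/
lemma exists_pow_factorial_le {t κ θ : ℝ} (ht : 0 ≤ t) (hκ : 0 < κ) (hθ : 0 < θ) :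
    ∃ n : ℕ, κ ^ n * (n ! : ℝ) ^ θ ≤
      Real.exp 1 * Real.exp (-((κ * Real.exp 1) ^ (-(1 / θ)) * t ^ (1 / θ))) * t ^ n := by
  set u := (κ * Real.exp 1) ^ (-(1 / θ)) * t ^ (1 / θ) with hu
  have hκe : 0 < κ * Real.exp 1 := by positivity
  have hu0 : 0 ≤ u := by positivity
  refine ⟨⌊u⌋₊, ?_⟩
  set n := ⌊u⌋₊ with hn
  have hnu : (n : ℝ) ≤ u := Nat.floor_le hu0
  have hun : u < n + 1 := Nat.lt_floor_add_one u
  have h1 : (n ! : ℝ) ^ θ ≤ ((n : ℝ) ^ θ) ^ n := by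
    have : (n ! : ℝ) ≤ (n : ℝ) ^ n := by exact_mod_cast Nat.factorial_le_pow n
    refine (Real.rpow_le_rpow (by positivity) this hθ.le).trans (le_of_eq ?_)
    rw [← Real.rpow_natCast, ← Real.rpow_natCast, ← Real.rpow_mul (by positivity),
      ← Real.rpow_mul (by positivity), mul_comm]
  have h2 : κ * (n : ℝ) ^ θ ≤ Real.exp (-1) * t := by
    have h3 : (n : ℝ) ^ θ ≤ u ^ θ := Real.rpow_le_rpow (by positivity) hnu hθ.le
    have h4 : u ^ θ = (κ * Real.exp 1)⁻¹ * t := by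
      rw [hu, Real.mul_rpow (by positivity) (by positivity), ← Real.rpow_mul hκe.le,
        ← Real.rpow_mul ht]
      have e1 : -(1 / θ) * θ = -1 := by field_simp
      have e2 : 1 / θ * θ = 1 := by field_simp
      rw [e1, e2, Real.rpow_one, Real.rpow_neg_one]
    calc κ * (n : ℝ) ^ θ ≤ κ * ((κ * Real.exp 1)⁻¹ * t) := by rw [← h4]; gcongr
      _ = Real.exp (-1) * t := by rw [Real.exp_neg]; field_simp
  calc κ ^ n * (n ! : ℝ) ^ θ ≤ κ ^ n * ((n : ℝ) ^ θ) ^ n := by gcongr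
    _ = (κ * (n : ℝ) ^ θ) ^ n := by rw [mul_pow]
    _ ≤ (Real.exp (-1) * t) ^ n := by gcongr
    _ = Real.exp (-n) * t ^ n := by rw [mul_pow, ← Real.exp_nat_mul]; simp
    _ ≤ Real.exp 1 * Real.exp (-u) * t ^ n := by
      rw [← Real.exp_add]
      gcongr
      linarith

/-- Since p! q! ≤ (p+q)!, the factorials come out and the binomial theorem remains. Thus scales add
under products, with no further constant. -/
lemma sum_antidiagonal_choose_mul_le {τ h h' : ℝ} (hτ : 0 ≤ τ) (hh : 0 ≤ h) (hh' : 0 ≤ h') (n : ℕ) :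
    ∑ p ∈ Finset.HasAntidiagonal.antidiagonal n, (n.choose p.1 : ℝ) *
      ((h ^ p.1 * (p.1 ! : ℝ) ^ τ) * (h' ^ p.2 * (p.2 ! : ℝ) ^ τ)) ≤
      (h + h') ^ n * (n ! : ℝ) ^ τ := by
  rw [(Commute.all h h').add_pow', Finset.sum_mul]
  refine Finset.sum_le_sum fun p hp => ?_
  rw [Finset.HasAntidiagonal.mem_antidiagonal] at hp
  have h1 : ((p.1 ! : ℝ) ^ τ * (p.2 ! : ℝ) ^ τ) ≤ (n ! : ℝ) ^ τ := by
    rw [← Real.mul_rpow (by positivity) (by positivity)]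
    refine Real.rpow_le_rpow (by positivity) ?_ hτ
    have := Nat.factorial_mul_factorial_dvd_factorial_add p.1 p.2
    rw [hp] at this
    exact_mod_cast Nat.le_of_dvd (Nat.factorial_pos n) this
  rw [nsmul_eq_mul]
  calc _ = (n.choose p.1 : ℝ) * (h ^ p.1 * h' ^ p.2) * ((p.1 ! : ℝ) ^ τ * (p.2 ! : ℝ) ^ τ) := by
        ring
    _ ≤ _ := by gcongr

/-- From (m+n)! ≤ 2^(m+n) m! n!. The bound T ≥ τ makes the loss 2^T uniform over all coordinates. -/
lemma factorial_add_rpow_le {τ T : ℝ} (hτ : 0 ≤ τ) (hT : τ ≤ T) (m n : ℕ) :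
    ((m + n)! : ℝ) ^ τ ≤ ((2 : ℝ) ^ T) ^ (m + n) * ((m ! : ℝ) ^ τ * (n ! : ℝ) ^ τ) := by
  have h1 : ((m + n)! : ℝ) ≤ 2 ^ (m + n) * (m ! * n !) := by
    rw [← Nat.add_choose_mul_factorial_mul_factorial m n]
    push_cast
    rw [mul_assoc]
    gcongr
    exact_mod_cast Nat.choose_le_two_pow (m + n) n
  refine (Real.rpow_le_rpow (by positivity) h1 hτ).trans ?_
  rw [Real.mul_rpow (by positivity) (by positivity), Real.mul_rpow (by positivity) (by positivity)]
  gcongr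
  rw [← Real.rpow_natCast, ← Real.rpow_natCast, ← Real.rpow_mul (by positivity),
    ← Real.rpow_mul (by positivity), mul_comm]
  exact Real.rpow_le_rpow_of_exponent_le (by norm_num) (by gcongr)

lemma abs_add_rpow_le {x y p : ℝ} (hp : 0 ≤ p) :
    |x + y| ^ p ≤ 2 ^ p * (|x| ^ p + |y| ^ p) := by
  have h1 : |x + y| ≤ 2 * max |x| |y| := by
    have := abs_add_le x y
    have := le_max_left |x| |y|
    have := le_max_right |x| |y|
    linarith
  refine (Real.rpow_le_rpow (abs_nonneg _) h1 hp).trans ?_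
  rw [Real.mul_rpow (by norm_num) (by positivity)]
  gcongr
  rcases max_choice |x| |y| with h | h <;> rw [h]
  · linarith [Real.rpow_nonneg (abs_nonneg y) p]
  · linarith [Real.rpow_nonneg (abs_nonneg x) p]

end Elementary

/-! ## Weights -/

section Weights

variable {d : ℕ} {τ θ : Fin d ⊕ Fin d → ℝ}

/-- `h^{|γ|} ∏ γ_i!^{τ_i}`. -/
def wt (τ : Fin d ⊕ Fin d → ℝ) (h : ℝ) (γ : Fin d ⊕ Fin d → ℕ) : ℝ :=
  ∏ i, (h ^ γ i * ((γ i)! : ℝ) ^ τ i)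

/-- `∑ |z_i|^{1/θ_i}`. -/
def grow (θ : Fin d ⊕ Fin d → ℝ) (z : PhaseSpace d d) : ℝ := ∑ i, |coord i z| ^ (1 / θ i)

lemma grow_nonneg (θ : Fin d ⊕ Fin d → ℝ) (z : PhaseSpace d d) : 0 ≤ grow θ z :=
  Finset.sum_nonneg fun _ _ => by positivity

lemma wt_nonneg {h : ℝ} (hh : 0 ≤ h) (γ : Fin d ⊕ Fin d → ℕ) : 0 ≤ wt τ h γ :=
  Finset.prod_nonneg fun _ _ => by positivity

lemma wt_pos {h : ℝ} (hh : 0 < h) (γ : Fin d ⊕ Fin d → ℕ) : 0 < wt τ h γ :=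
  Finset.prod_pos fun _ _ => by positivity

@[simp] lemma wt_zero (h : ℝ) : wt τ h 0 = 1 := by simp [wt]

lemma wt_mono {h h' : ℝ} (hh : 0 ≤ h) (hhh : h ≤ h') (γ : Fin d ⊕ Fin d → ℕ) :
    wt τ h γ ≤ wt τ h' γ :=
  Finset.prod_le_prod (fun _ _ => by positivity) fun _ _ => by gcongr

lemma wt_add_single (h : ℝ) {γ : Fin d ⊕ Fin d → ℕ} {i : Fin d ⊕ Fin d} (hi : γ i = 0) (n : ℕ) :
    wt τ h (γ + Pi.single i n) = wt τ h γ * (h ^ n * (n ! : ℝ) ^ τ i) := by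
  unfold wt
  rw [← Finset.mul_prod_erase _ _ (Finset.mem_univ i),
    ← Finset.mul_prod_erase Finset.univ (fun j => h ^ γ j * ((γ j)! : ℝ) ^ τ j) (Finset.mem_univ i),
    Finset.prod_congr rfl (g := fun j => h ^ γ j * ((γ j)! : ℝ) ^ τ j)]
  · simp [hi]
    ring
  · intro j hj
    simp [Finset.ne_of_mem_erase hj]

lemma wt_add_le {h T : ℝ} (hh : 0 ≤ h) (hτ : ∀ i, 0 ≤ τ i) (hT : ∀ i, τ i ≤ T)
    (γ δ : Fin d ⊕ Fin d → ℕ) :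
    wt τ h (γ + δ) ≤ wt τ (2 ^ T * h) γ * wt τ (2 ^ T * h) δ := by
  unfold wt
  rw [← Finset.prod_mul_distrib]
  refine Finset.prod_le_prod (fun _ _ => by positivity) fun i _ => ?_
  have := factorial_add_rpow_le (hτ i) (hT i) (γ i) (δ i)
  calc h ^ (γ + δ) i * (((γ + δ) i)! : ℝ) ^ τ i
      ≤ h ^ (γ i + δ i) * (((2 : ℝ) ^ T) ^ (γ i + δ i) *
        (((γ i)! : ℝ) ^ τ i * ((δ i)! : ℝ) ^ τ i)) := by
        simp only [Pi.add_apply]; gcongr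
    _ = _ := by simp only [mul_pow, pow_add]; ring

/-- A constant `c` with `grow θ (z + w) ≤ c * (grow θ z + grow θ w)`. -/
def growConst (θ : Fin d ⊕ Fin d → ℝ) : ℝ := 1 + ∑ i, (2 : ℝ) ^ (1 / θ i)

lemma one_le_growConst (θ : Fin d ⊕ Fin d → ℝ) : 1 ≤ growConst θ := by
  have : 0 ≤ ∑ i, (2 : ℝ) ^ (1 / θ i) := Finset.sum_nonneg fun _ _ => by positivity
  unfold growConst
  linarith

lemma grow_add_le (hθ : ∀ i, 0 < θ i) (z w : PhaseSpace d d) :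
    grow θ (z + w) ≤ growConst θ * (grow θ z + grow θ w) := by
  unfold grow
  rw [← Finset.sum_add_distrib, Finset.mul_sum]
  refine Finset.sum_le_sum fun i _ => ?_
  rw [map_add]
  refine (abs_add_rpow_le (by have := hθ i; positivity)).trans ?_
  gcongr
  unfold growConst
  have : (2 : ℝ) ^ (1 / θ i) ≤ ∑ i, (2 : ℝ) ^ (1 / θ i) :=
    Finset.single_le_sum (f := fun i => (2 : ℝ) ^ (1 / θ i)) (fun _ _ => by positivity)
      (Finset.mem_univ i)
  linarith

lemma grow_neg (z : PhaseSpace d d) : grow θ (-z) = grow θ z := by simp [grow, -Fintype.sum_sum_type]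

lemma grow_sub_le (hθ : ∀ i, 0 < θ i) (z w : PhaseSpace d d) :
    grow θ (z - w) ≤ growConst θ * (grow θ z + grow θ w) := by
  have := grow_add_le hθ z (-w)
  rwa [grow_neg, ← sub_eq_add_neg] at this

lemma continuous_grow (hθ : ∀ i, 0 < θ i) : Continuous (grow θ) := by
  refine continuous_finsetSum _ fun i _ => ?_
  exact ((coord i).continuous.abs).rpow_const fun _ => Or.inr (by have := hθ i; positivity)

lemma abs_coord_rpow_le_grow (i : Fin d ⊕ Fin d) (z : PhaseSpace d d) :
    |coord i z| ^ (1 / θ i) ≤ grow θ z :=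
  Finset.single_le_sum (f := fun i => |coord i z| ^ (1 / θ i)) (fun _ _ => by positivity)
    (Finset.mem_univ i)

lemma exists_norm_pow_le (hθ : ∀ i, 0 < θ i) {a : ℝ} (ha : 0 < a) (k : ℕ) :
    ∃ C : ℝ, 0 ≤ C ∧ ∀ z : PhaseSpace d d, ‖z‖ ^ k ≤ C * Real.exp (a * grow θ z) := by
  -- Raising to the power k multiplies the exponent by k, and k b ≤ a; the +1 keeps b defined for k
  -- = 0.
  set b := a / (k + 1) with hb
  have hb0 : 0 < b := by positivity
  refine ⟨(∑ i, (θ i / b) ^ θ i) ^ k, ?_, fun z => ?_⟩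
  · exact pow_nonneg (Finset.sum_nonneg fun i _ => by have := hθ i; positivity) _
  have h1 : ‖z‖ ≤ (∑ i, (θ i / b) ^ θ i) * Real.exp (b * grow θ z) := by
    refine (norm_le_sum_coord z).trans ?_
    rw [Finset.sum_mul]
    refine Finset.sum_le_sum fun i _ => ?_
    have := pow_le_exp_rpow (abs_nonneg (coord i z)) hb0 (hθ i) 1
    simp only [pow_one, Nat.factorial_one, Nat.cast_one, Real.one_rpow, mul_one] at this
    refine this.trans ?_
    have := hθ i
    gcongr
    exact abs_coord_rpow_le_grow i z
  calc ‖z‖ ^ k ≤ ((∑ i, (θ i / b) ^ θ i) * Real.exp (b * grow θ z)) ^ k := by gcongr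
    _ = (∑ i, (θ i / b) ^ θ i) ^ k * Real.exp (k * (b * grow θ z)) := by
      rw [mul_pow, ← Real.exp_nat_mul]
    _ ≤ _ := by
      have hθ' : 0 ≤ ∑ i, (θ i / b) ^ θ i :=
        Finset.sum_nonneg fun i _ => by have := hθ i; positivity
      refine mul_le_mul_of_nonneg_left (Real.exp_le_exp.2 ?_) (pow_nonneg hθ' _)
      rw [← mul_assoc]
      refine mul_le_mul_of_nonneg_right ?_ (grow_nonneg θ z)
      rw [hb, mul_div_assoc', div_le_iff₀ (by positivity)]
      nlinarith

end Weights

/-! ## Symbol-type bounds -/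

section Bounds

open SmoothFun

variable {d : ℕ} {τ θ : Fin d ⊕ Fin d → ℝ}

/-- `|∂^γ f(z)| ≤ M h^{|γ|} ∏ γ_i!^{τ_i} exp (r ∑ |z_i|^{1/θ_i})` for all `γ` and `z`; the growth
parameter `r` may be negative. -/
def SymbolBound (τ θ : Fin d ⊕ Fin d → ℝ) (h r M : ℝ) (f : SmoothFun d d) : Prop :=
  ∀ γ z, ‖mder γ f z‖ ≤ M * wt τ h γ * Real.exp (r * grow θ z)

lemma SymbolBound.nonneg {h r M : ℝ} {f : SmoothFun d d} (hf : SymbolBound τ θ h r M f) : 0 ≤ M := by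
  have := (norm_nonneg _).trans (hf 0 0)
  rw [wt_zero, mul_one] at this
  exact nonneg_of_mul_nonneg_left this (Real.exp_pos _)

lemma SymbolBound.mono {h r M h' r' M' : ℝ} {f : SmoothFun d d} (hf : SymbolBound τ θ h r M f)
    (hh : 0 ≤ h) (h1 : h ≤ h') (h2 : r ≤ r') (h3 : M ≤ M') : SymbolBound τ θ h' r' M' f := by
  intro γ z
  refine (hf γ z).trans ?_
  have := hf.nonneg
  have := wt_nonneg (τ := τ) hh γ
  have := wt_mono (τ := τ) hh h1 γ
  have := grow_nonneg θ z
  have h4 : 0 ≤ M' := hf.nonneg.trans h3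
  have h5 := mul_nonneg h4 (wt_nonneg (τ := τ) (hh.trans h1) γ)
  gcongr

lemma SymbolBound.norm_le {h r M : ℝ} {f : SmoothFun d d} (hf : SymbolBound τ θ h r M f)
    (z : PhaseSpace d d) : ‖f z‖ ≤ M * Real.exp (r * grow θ z) := by
  simpa using hf 0 z

lemma SymbolBound.smul {h r M : ℝ} {f : SmoothFun d d} (hf : SymbolBound τ θ h r M f) (c : ℂ) :
    SymbolBound τ θ h r (‖c‖ * M) (c • f) := by
  intro γ z
  rw [map_smul, smul_apply, norm_mul, mul_assoc, mul_assoc, ← mul_assoc M]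
  exact mul_le_mul_of_nonneg_left (hf γ z) (norm_nonneg c)

lemma SymbolBound.mder {h r M T : ℝ} {f : SmoothFun d d} (hf : SymbolBound τ θ h r M f)
    (hh : 0 ≤ h) (hτ : ∀ i, 0 ≤ τ i) (hT : ∀ i, τ i ≤ T) (δ : Fin d ⊕ Fin d → ℕ) :
    SymbolBound τ θ (2 ^ T * h) r (M * wt τ (2 ^ T * h) δ) (mder δ f) := by
  intro γ z
  rw [← mder_add_apply]
  refine (hf _ z).trans ?_
  have := hf.nonneg
  have h1 := wt_add_le hh hτ hT γ δ
  calc _ ≤ M * (wt τ (2 ^ T * h) γ * wt τ (2 ^ T * h) δ) * Real.exp (r * grow θ z) := by gcongr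
    _ = _ := by ring

/-- Induction on the set S of variables in which one differentiates, with the one-variable Leibniz
rule at each step, replaces a Leibniz formula for multi-indices. Working at a fixed point z lets M
and N absorb the growth factors. -/
lemma norm_mder_mulL_le {h h' : ℝ} (hτ : ∀ i, 0 ≤ τ i) (hh : 0 ≤ h) (hh' : 0 ≤ h')
    (z : PhaseSpace d d) (S : Finset (Fin d ⊕ Fin d)) : ∀ (f g : SmoothFun d d) (M N : ℝ),
    (∀ γ, (∀ i ∉ S, γ i = 0) → ‖mder γ f z‖ ≤ M * wt τ h γ) →
    (∀ γ, (∀ i ∉ S, γ i = 0) → ‖mder γ g z‖ ≤ N * wt τ h' γ) →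
    ∀ γ, (∀ i ∉ S, γ i = 0) → ‖mder γ (mulL f g) z‖ ≤ M * N * wt τ (h + h') γ := by
  classical
  induction S using Finset.induction_on with
  | empty =>
    intro f g M N hf hg γ hγ
    obtain rfl : γ = 0 := funext fun i => hγ i (by simp)
    have h1 := hf 0 (by simp)
    have h2 := hg 0 (by simp)
    simp only [mder_zero_apply, wt_zero, mul_one, mulL_apply, norm_mul] at h1 h2 ⊢
    exact mul_le_mul h1 h2 (norm_nonneg _) ((norm_nonneg _).trans h1)
  | insert i S hi ih =>
    intro f g M N hf hg γ hγ
    -- Clearing the i-th entry makes the weight factor exactly, so no factor 2^T is lost.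
    set γ' := Function.update γ i 0 with hγ'
    have hγ'i : γ' i = 0 := by simp [hγ']
    have hγ'S : ∀ j ∉ S, γ' j = 0 := by
      intro j hj
      by_cases hji : j = i
      · rw [hji, hγ'i]
      · rw [hγ', Function.update_of_ne hji]
        exact hγ j (by simp [hji, hj])
    have hγe : γ = γ' + Pi.single i (γ i) := by
      funext j
      by_cases hji : j = i
      · subst hji; simp [hγ'i]
      · simp [hγ', hji]
    have key : ∀ (k : ℝ) (F : SmoothFun d d) (K : ℝ),
        (∀ γ, (∀ j ∉ insert i S, γ j = 0) → ‖mder γ F z‖ ≤ K * wt τ k γ) → ∀ n : ℕ,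
        ∀ γ, (∀ j ∉ S, γ j = 0) →
        ‖mder γ (((pderiv (bvec i) : Module.End ℂ (SmoothFun d d)) ^ n) F) z‖ ≤
          K * (k ^ n * (n ! : ℝ) ^ τ i) * wt τ k γ := by
      intro k F K hF n γ hγ
      rw [← mder_single, ← mder_add_apply]
      refine (hF _ ?_).trans (le_of_eq ?_)
      · intro j hj
        simp only [Finset.mem_insert, not_or] at hj
        simp [hj.1, hγ j hj.2]
      · rw [wt_add_single _ (hγ i hi)]
        ring
    rw [hγe, mder_add_apply, mder_single, pderiv_pow_mulL, map_sum, SmoothFun.sum_apply,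
      wt_add_single _ hγ'i]
    refine (norm_sum_le _ _).trans ?_
    have hM : 0 ≤ M := by simpa using (norm_nonneg _).trans (hf 0 (by simp))
    have hN : 0 ≤ N := by simpa using (norm_nonneg _).trans (hg 0 (by simp))
    have hw := wt_nonneg (τ := τ) (add_nonneg hh hh') γ'
    calc _ ≤ ∑ p ∈ Finset.HasAntidiagonal.antidiagonal (γ i), ((γ i).choose p.1 : ℝ) *
          ((M * (h ^ p.1 * (p.1 ! : ℝ) ^ τ i)) * (N * (h' ^ p.2 * (p.2 ! : ℝ) ^ τ i)) *
            wt τ (h + h') γ') := by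
          refine Finset.sum_le_sum fun p _ => ?_
          rw [map_nsmul, ← Nat.cast_smul_eq_nsmul ℂ, smul_apply, norm_mul, Complex.norm_natCast]
          gcongr
          exact ih _ _ _ _ (key h f M hf p.1) (key h' g N hg p.2) γ' hγ'S
      _ = M * N * wt τ (h + h') γ' * ∑ p ∈ Finset.HasAntidiagonal.antidiagonal (γ i),
          ((γ i).choose p.1 : ℝ) *
          ((h ^ p.1 * (p.1 ! : ℝ) ^ τ i) * (h' ^ p.2 * (p.2 ! : ℝ) ^ τ i)) := by
          rw [Finset.mul_sum]
          refine Finset.sum_congr rfl fun p _ => by ring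
      _ ≤ M * N * wt τ (h + h') γ' * ((h + h') ^ γ i * ((γ i)! : ℝ) ^ τ i) := by
          gcongr
          exact sum_antidiagonal_choose_mul_le (hτ i) hh hh' _
      _ = _ := by ring

lemma SymbolBound.mul {h r M h' r' N : ℝ} {f g : SmoothFun d d} (hτ : ∀ i, 0 ≤ τ i)
    (hh : 0 ≤ h) (hh' : 0 ≤ h') (hf : SymbolBound τ θ h r M f) (hg : SymbolBound τ θ h' r' N g) :
    SymbolBound τ θ (h + h') (r + r') (M * N) (mulL f g) := by
  intro γ z
  have := norm_mder_mulL_le hτ hh hh' z Finset.univ f g (M * Real.exp (r * grow θ z))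
    (N * Real.exp (r' * grow θ z)) (fun γ _ => (hf γ z).trans (le_of_eq (by ring)))
    (fun γ _ => (hg γ z).trans (le_of_eq (by ring))) γ (by simp)
  refine this.trans (le_of_eq ?_)
  rw [add_mul, Real.exp_add]
  ring

lemma SymbolBound.conj {h r M : ℝ} {f : SmoothFun d d} (hf : SymbolBound τ θ h r M f) :
    SymbolBound τ θ h r M (conj f) := by
  intro γ z
  rw [mder_conj, conj_apply, norm_star]
  exact hf γ z

lemma SymbolBound.shift {h r M : ℝ} {f : SmoothFun d d} (hf : SymbolBound τ θ h r M f)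
    (hθ : ∀ i, 0 < θ i) (hh : 0 ≤ h) (hr : 0 ≤ r) (k : PhaseSpace d d) :
    SymbolBound τ θ h (growConst θ * r) (M * Real.exp (growConst θ * r * grow θ k))
      (shift k f) := by
  intro γ z
  rw [mder_shift, shift_apply]
  refine (hf γ _).trans ?_
  have h1 := grow_add_le hθ z k
  have hM := hf.nonneg
  have hw := wt_nonneg (τ := τ) hh γ
  calc M * wt τ h γ * Real.exp (r * grow θ (z + k))
      ≤ M * wt τ h γ * Real.exp (r * (growConst θ * (grow θ z + grow θ k))) := by gcongr
    _ = M * wt τ h γ * (Real.exp (growConst θ * r * grow θ z) *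
        Real.exp (growConst θ * r * grow θ k)) := by rw [← Real.exp_add]; ring_nf
    _ = _ := by ring

/-- Iterated directional derivatives. -/
lemma norm_mder_pderiv_pow_le (v z : PhaseSpace d d) (k : ℕ) : ∀ (f : SmoothFun d d)
    (γ : Fin d ⊕ Fin d → ℕ) (Q : ℝ),
    (∀ δ : Fin d ⊕ Fin d → ℕ, ∑ i, δ i = k → (∀ i, coord i v = 0 → δ i = 0) →
      ‖mder (γ + δ) f z‖ ≤ Q) →
    ‖mder γ (((pderiv v : Module.End ℂ (SmoothFun d d)) ^ k) f) z‖ ≤ (∑ i, |coord i v|) ^ k * Q := by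
  induction k with
  | zero =>
    intro f γ Q h
    simpa using h 0 (by simp) (by simp)
  | succ k ih =>
    intro f γ Q h
    rw [pow_succ, Module.End.mul_apply, pderiv_eq_sum, LinearMap.sum_apply, map_sum, map_sum,
      SmoothFun.sum_apply, ← pderiv_eq_sum, pow_succ _ k, mul_assoc, Finset.sum_mul, Finset.mul_sum]
    refine (norm_sum_le _ _).trans (Finset.sum_le_sum fun i _ => ?_)
    rw [LinearMap.smul_apply, map_smul, map_smul, smul_apply, norm_mul, Complex.norm_real,
      Real.norm_eq_abs, mul_left_comm]
    -- Directions with coefficient zero drop out. Hence δ stays supported where v is, which later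
    -- confines the derivatives to one block.
    by_cases hi : coord i v = 0
    · simp [hi, -Fintype.sum_sum_type]
    gcongr
    refine ih _ γ Q fun δ hδ hδv => ?_
    rw [← mder_add_single, add_assoc]
    refine h _ ?_ ?_
    · simp only [Pi.add_apply, Finset.sum_add_distrib, hδ]
      rw [Finset.sum_pi_single' i 1 Finset.univ]
      simp
    · intro j hj
      have : j ≠ i := fun e => hi (e ▸ hj)
      simp [hδv j hj, this]

/-- The product of the δ_i! divides |δ|!, and only entries with exponent t contribute. -/
lemma wt_le_of_support {h t : ℝ} (hh : 0 ≤ h) (ht : 0 ≤ t) (δ : Fin d ⊕ Fin d → ℕ)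
    (hδ : ∀ i, δ i = 0 ∨ τ i = t) : wt τ h δ ≤ h ^ (∑ i, δ i) * ((∑ i, δ i)! : ℝ) ^ t := by
  unfold wt
  rw [Finset.prod_mul_distrib, Finset.prod_pow_eq_pow_sum]
  gcongr
  calc ∏ i, ((δ i)! : ℝ) ^ τ i = ∏ i, ((δ i)! : ℝ) ^ t := by
        refine Finset.prod_congr rfl fun i _ => ?_
        rcases hδ i with h | h
        · simp [h]
        · rw [h]
    _ = (∏ i, ((δ i)! : ℝ)) ^ t := (Real.finsetProd_rpow _ _ (fun _ _ => by positivity) t)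
    _ ≤ _ := by
      refine Real.rpow_le_rpow (Finset.prod_nonneg fun _ _ => by positivity) ?_ ht
      exact_mod_cast Nat.le_of_dvd (Nat.factorial_pos _) (Nat.prod_factorial_dvd_factorial_sum _ _)

/-- The order enters as k!^t, with t the exponent of the block containing v, and not as k!^T; T
affects only the scale. This sharpness is needed for the derivatives along `twistVec`. -/
lemma SymbolBound.pderiv_pow {h r M T t : ℝ} {f : SmoothFun d d} (hf : SymbolBound τ θ h r M f)
    (hh : 0 ≤ h) (hτ : ∀ i, 0 ≤ τ i) (hT : ∀ i, τ i ≤ T) (ht : 0 ≤ t) (v : PhaseSpace d d)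
    (hv : ∀ i, coord i v = 0 ∨ τ i = t) (k : ℕ) :
    SymbolBound τ θ (2 ^ T * h) r (M * (((∑ i, |coord i v|) * (2 ^ T * h)) ^ k * (k ! : ℝ) ^ t))
      (((pderiv v : Module.End ℂ (SmoothFun d d)) ^ k) f) := by
  intro γ z
  refine (norm_mder_pderiv_pow_le v z k f γ (M * (wt τ (2 ^ T * h) γ *
    ((2 ^ T * h) ^ k * (k ! : ℝ) ^ t)) * Real.exp (r * grow θ z)) fun δ hδ hδv => ?_).trans
    (le_of_eq (by rw [mul_pow]; ring))
  refine (hf _ z).trans ?_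
  have := hf.nonneg
  have h1 := wt_add_le hh hτ hT γ δ
  have h2 : wt τ (2 ^ T * h) δ ≤ (2 ^ T * h) ^ k * (k ! : ℝ) ^ t := by
    rw [← hδ]
    exact wt_le_of_support (by positivity) ht δ fun i => (hv i).imp (hδv i) id
  have h3 := wt_nonneg (τ := τ) (h := 2 ^ T * h) (by positivity) γ
  gcongr
  exact h1.trans (by gcongr)

end Bounds

/-! ### Fréchet derivatives and the passage to Schwartz functions. -/

section Frechet

open SmoothFun

variable {d : ℕ} {τ θ : Fin d ⊕ Fin d → ℝ}

/-- The map `c ↦ c dz_i`. -/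
def dualC (i : Fin d ⊕ Fin d) : ℂ →L[ℝ] (PhaseSpace d d →L[ℝ] ℂ) :=
  ContinuousLinearMap.smulRightL ℝ (PhaseSpace d d) ℂ (coord i)

@[simp] lemma dualC_apply (i : Fin d ⊕ Fin d) (c : ℂ) (v : PhaseSpace d d) :
    dualC i c v = coord i v * c := by
  simp [dualC]

lemma norm_dualC_le (i : Fin d ⊕ Fin d) : ‖(dualC i : ℂ →L[ℝ] (PhaseSpace d d →L[ℝ] ℂ))‖ ≤ 1 := by
  refine ContinuousLinearMap.opNorm_le_bound _ zero_le_one fun c =>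
    ContinuousLinearMap.opNorm_le_bound _ (by positivity) fun v => ?_
  rw [dualC_apply, norm_mul, Complex.norm_real, Real.norm_eq_abs, one_mul, mul_comm]
  exact mul_le_mul_of_nonneg_left (abs_coord_le i v) (norm_nonneg c)

lemma fderiv_eq_sum_dualC (f : SmoothFun d d) (z : PhaseSpace d d) :
    fderiv ℝ f z = ∑ i, dualC i (pderiv (bvec i) f z) := by
  refine ContinuousLinearMap.ext fun v => ?_
  rw [← pderiv_apply v f z, pderiv_eq_sum, LinearMap.sum_apply, SmoothFun.sum_apply,
    _root_.sum_apply]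
  refine Finset.sum_congr rfl fun i _ => ?_
  rw [dualC_apply]
  rfl

/-- Each Fréchet derivative is a sum of 2d partial derivatives composed with maps of norm at most 1,
whence the factor (2d)^n. -/
lemma norm_iteratedFDeriv_le_mder (n : ℕ) : ∀ (f : SmoothFun d d) (z : PhaseSpace d d) (Q : ℝ),
    (∀ γ : Fin d ⊕ Fin d → ℕ, ∑ i, γ i = n → ‖mder γ f z‖ ≤ Q) →
    ‖iteratedFDeriv ℝ n f z‖ ≤ (Fintype.card (Fin d ⊕ Fin d) : ℝ) ^ n * Q := by
  induction n with
  | zero =>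
    intro f z Q h
    simpa using h 0 (by simp)
  | succ n ih =>
    intro f z Q h
    have hf : fderiv ℝ f = fun z => ∑ i, dualC i (pderiv (bvec i) f z) :=
      funext (fderiv_eq_sum_dualC f)
    have hc : ∀ i : Fin d ⊕ Fin d, ContDiff ℝ n (pderiv (bvec i) f : PhaseSpace d d → ℂ) :=
      fun i => (pderiv (bvec i) f).contDiff.of_le (by exact_mod_cast le_top)
    have hs : iteratedFDeriv ℝ n (fderiv ℝ f) z =
        ∑ i, iteratedFDeriv ℝ n (dualC i ∘ (pderiv (bvec i) f : PhaseSpace d d → ℂ)) z := by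
      rw [hf]
      exact iteratedFDeriv_fun_sum_apply fun i _ => ((dualC i).contDiff.comp (hc i)).contDiffAt
    rw [← norm_iteratedFDeriv_fderiv, hs]
    refine (norm_sum_le _ _).trans ?_
    rw [pow_succ, mul_comm (_ ^ n), mul_assoc, ← nsmul_eq_mul, ← Finset.card_univ]
    refine Finset.sum_le_card_nsmul _ _ _ fun i _ => ?_
    refine ((dualC i).norm_iteratedFDeriv_comp_left (hc i).contDiffAt le_rfl).trans ?_
    refine (mul_le_of_le_one_left (norm_nonneg _) (norm_dualC_le i)).trans ?_
    refine ih _ z Q fun γ hγ => ?_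
    rw [← mder_add_single]
    refine h _ ?_
    simp only [Pi.add_apply, Finset.sum_add_distrib, hγ]
    rw [Finset.sum_pi_single' i 1 Finset.univ]
    simp

lemma wt_le_pow {h T : ℝ} (hh : 0 ≤ h) (hT0 : 0 ≤ T) (hT : ∀ i, τ i ≤ T)
    (γ : Fin d ⊕ Fin d → ℕ) : wt τ h γ ≤ h ^ (∑ i, γ i) * ((∑ i, γ i)! : ℝ) ^ T := by
  refine le_trans ?_ (wt_le_of_support (τ := fun _ => T) hh hT0 γ fun i => Or.inr rfl)
  refine Finset.prod_le_prod (fun _ _ => by positivity) fun i _ => ?_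
  gcongr
  · exact_mod_cast Nat.one_le_iff_ne_zero.2 (Nat.factorial_ne_zero _)
  · exact hT i

/-- The Schwartz function given by a rapidly decreasing smooth function (`0` for others). -/
def schwartzOf (f : SmoothFun d d) : 𝓢(PhaseSpace d d, ℂ) := by
  classical exact
    if h : ∀ k n : ℕ, ∃ C : ℝ, ∀ z, ‖z‖ ^ k * ‖iteratedFDeriv ℝ n f z‖ ≤ C then
      ⟨f, f.contDiff, h⟩ else 0

/-- The constant depends on h, a, k, n but not on f, so it controls Schwartz seminorms uniformly
over the functions with a given bound. -/
lemma exists_decay_bound {h a : ℝ} (hθ : ∀ i, 0 < θ i) (hh : 0 ≤ h) (ha : 0 < a) (k n : ℕ) :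
    ∃ C : ℝ, 0 ≤ C ∧ ∀ (f : SmoothFun d d) (M : ℝ), SymbolBound τ θ h (-a) M f →
      ∀ z, ‖z‖ ^ k * ‖iteratedFDeriv ℝ n f z‖ ≤ C * M := by
  obtain ⟨C, hC0, hC⟩ := exists_norm_pow_le hθ ha k
  -- Any common upper bound of the exponents will do, since only finiteness for each n matters here.
  set T := ∑ i, |τ i| with hTdef
  have hT0 : 0 ≤ T := Finset.sum_nonneg fun _ _ => abs_nonneg _
  have hT : ∀ i, τ i ≤ T := fun i => (le_abs_self _).trans
    (Finset.single_le_sum (f := fun i => |τ i|) (fun _ _ => abs_nonneg _) (Finset.mem_univ i))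
  refine ⟨C * ((Fintype.card (Fin d ⊕ Fin d) : ℝ) ^ n * (h ^ n * (n ! : ℝ) ^ T)), by positivity,
    fun f M hf z => ?_⟩
  have hM := hf.nonneg
  have h1 := norm_iteratedFDeriv_le_mder n f z (M * (h ^ n * (n ! : ℝ) ^ T) *
    Real.exp (-a * grow θ z)) fun γ hγ => (hf γ z).trans (by
      have := wt_le_pow hh hT0 hT γ
      rw [hγ] at this
      gcongr)
  calc ‖z‖ ^ k * ‖iteratedFDeriv ℝ n f z‖
      ≤ (C * Real.exp (a * grow θ z)) * ((Fintype.card (Fin d ⊕ Fin d) : ℝ) ^ n *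
        (M * (h ^ n * (n ! : ℝ) ^ T) * Real.exp (-a * grow θ z))) := by
        gcongr
        exact hC z
    _ = C * ((Fintype.card (Fin d ⊕ Fin d) : ℝ) ^ n * (h ^ n * (n ! : ℝ) ^ T)) * M *
        (Real.exp (a * grow θ z) * Real.exp (-a * grow θ z)) := by ring
    _ = _ := by rw [← Real.exp_add]; simp

lemma SymbolBound.schwartzOf_apply {h a M : ℝ} {f : SmoothFun d d} (hθ : ∀ i, 0 < θ i)
    (hh : 0 ≤ h) (ha : 0 < a) (hf : SymbolBound τ θ h (-a) M f) (z : PhaseSpace d d) :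
    schwartzOf f z = f z := by
  have : ∀ k n : ℕ, ∃ C : ℝ, ∀ z, ‖z‖ ^ k * ‖iteratedFDeriv ℝ n f z‖ ≤ C := fun k n => by
    obtain ⟨C, -, hC⟩ := exists_decay_bound (τ := τ) hθ hh ha k n
    exact ⟨C * M, hC f M hf⟩
  rw [schwartzOf, dif_pos this]
  rfl

lemma SymbolBound.ofSchwartz_schwartzOf {h a M : ℝ} {f : SmoothFun d d} (hθ : ∀ i, 0 < θ i)
    (hh : 0 ≤ h) (ha : 0 < a) (hf : SymbolBound τ θ h (-a) M f) :
    ofSchwartz (schwartzOf f) = f :=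
  SmoothFun.ext (hf.schwartzOf_apply hθ hh ha)

lemma exists_seminorm_le {h a : ℝ} (hθ : ∀ i, 0 < θ i) (hh : 0 ≤ h) (ha : 0 < a) (k n : ℕ) :
    ∃ C : ℝ, 0 ≤ C ∧ ∀ (u : 𝓢(PhaseSpace d d, ℂ)) (M : ℝ),
      SymbolBound τ θ h (-a) M (ofSchwartz u) → SchwartzMap.seminorm ℂ k n u ≤ C * M := by
  obtain ⟨C, hC0, hC⟩ := exists_decay_bound (τ := τ) hθ hh ha k n
  exact ⟨C, hC0, fun u M hu => SchwartzMap.seminorm_le_bound ℂ k n u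
    (mul_nonneg hC0 hu.nonneg) fun z => hC _ M hu z⟩

end Frechet

/-! ## Series of smooth functions -/

section Series

open SmoothFun Filter Topology

variable {d : ℕ} {τ θ : Fin d ⊕ Fin d → ℝ} {K : Type*}

/-- Locally uniform summability of a family of smooth functions with all derivatives. -/
def LocSummable (f : K → SmoothFun d d) : Prop :=
  ∃ m : K → ℝ, Summable m ∧ (∀ k, 0 ≤ m k) ∧ ∃ Q : (Fin d ⊕ Fin d → ℕ) → PhaseSpace d d → ℝ,
    (∀ γ, Continuous (Q γ)) ∧ ∀ k γ z, ‖mder γ (f k) z‖ ≤ m k * Q γ z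

lemma LocSummable.pderiv {f : K → SmoothFun d d} (hf : LocSummable f) (i : Fin d ⊕ Fin d) :
    LocSummable fun k => pderiv (bvec i) (f k) := by
  obtain ⟨m, hm, hm0, Q, hQ, h⟩ := hf
  refine ⟨m, hm, hm0, fun γ => Q (γ + Pi.single i 1), fun γ => hQ _, fun k γ z => ?_⟩
  rw [← mder_add_single]
  exact h _ _ _

lemma LocSummable.summable {f : K → SmoothFun d d} (hf : LocSummable f) (z : PhaseSpace d d) :
    Summable fun k => f k z := by
  obtain ⟨m, hm, hm0, Q, hQ, h⟩ := hf
  refine Summable.of_norm_bounded (hm.mul_right (Q 0 z)) fun k => ?_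
  simpa using h k 0 z

/-- Termwise differentiation needs bounds only near the point. The majorants of a locally summable
family are continuous, hence bounded on a unit ball but not globally. -/
lemma hasFDerivAt_tsum_of_ball {E ι : Type*} [Fintype ι] [NormedAddCommGroup E] [NormedSpace ℝ E]
    {L : ι → ℂ →L[ℝ] (E →L[ℝ] ℂ)} (hL : ∀ i, ‖L i‖ ≤ 1) {g : K → E → ℂ} {p : ι → K → E → ℂ}
    {m : K → ℝ} {C : ι → ℝ} (hm : Summable m) (z : E)
    (hg : ∀ k y, HasFDerivAt (g k) (∑ i, L i (p i k y)) y)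
    (hb : ∀ i k, ∀ y ∈ Metric.ball z 1, ‖p i k y‖ ≤ m k * C i)
    (hs : Summable fun k => g k z) (hsp : ∀ i, Summable fun k => p i k z) :
    HasFDerivAt (fun y => ∑' k, g k y) (∑ i, L i (∑' k, p i k z)) z := by
  have e : ∑ i, L i (∑' k, p i k z) = ∑' k, ∑ i, L i (p i k z) := by
    rw [Summable.tsum_finsetSum fun i _ => (L i).summable (hsp i)]
    exact Finset.sum_congr rfl fun i _ => (L i).map_tsum (hsp i)
  rw [e]
  refine hasFDerivAt_tsum_of_isPreconnected (hm.mul_right (∑ i, C i)) Metric.isOpen_ball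
    (convex_ball z 1).isPreconnected (fun k y _ => hg k y) (fun k y hy => ?_)
    (Metric.mem_ball_self one_pos) hs (Metric.mem_ball_self one_pos)
  rw [Finset.mul_sum]
  refine (norm_sum_le _ _).trans (Finset.sum_le_sum fun i _ => ?_)
  exact ((L i).le_opNorm _).trans
    ((mul_le_of_le_one_left (norm_nonneg _) (hL i)).trans (hb i k y hy))

lemma contDiff_succ_of_hasFDerivAt_sum {E ι : Type*} [Fintype ι] [NormedAddCommGroup E]
    [NormedSpace ℝ E] {L : ι → ℂ →L[ℝ] (E →L[ℝ] ℂ)} {F : E → ℂ} {q : ι → E → ℂ} {n : ℕ}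
    (hF : ∀ z, HasFDerivAt F (∑ i, L i (q i z)) z) (hq : ∀ i, ContDiff ℝ n (q i)) :
    ContDiff ℝ (n + 1 : ℕ) F :=
  contDiff_succ_iff_hasFDerivAt.2 ⟨_, ContDiff.sum fun i _ => (L i).contDiff.comp (hq i), hF⟩

lemma continuous_of_hasFDerivAt {E : Type*} [NormedAddCommGroup E]
    [NormedSpace ℝ E] {F : E → ℂ} {F' : E → E →L[ℝ] ℂ} (hF : ∀ z, HasFDerivAt F (F' z) z) :
    Continuous F :=
  continuous_iff_continuousAt.2 fun z => (hF z).continuousAt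

lemma fderiv_apply_of_hasFDerivAt_sum {E ι : Type*} [Fintype ι] [NormedAddCommGroup E]
    [NormedSpace ℝ E] {L : ι → ℂ →L[ℝ] (E →L[ℝ] ℂ)} {F : E → ℂ} {q : ι → ℂ} {z : E}
    (hF : HasFDerivAt F (∑ i, L i (q i)) z) (v : E) :
    fderiv ℝ F z v = ∑ i, L i (q i) v := by
  rw [hF.fderiv, _root_.sum_apply]

lemma fderiv_ofReal_clm_pow {E : Type*} [NormedAddCommGroup E] [NormedSpace ℝ E] (l : E →L[ℝ] ℝ)
    (m : ℕ) (z v : E) :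
    fderiv ℝ (fun z => ((l z : ℝ) : ℂ) ^ m) z v = m * ((l z : ℝ) : ℂ) ^ (m - 1) * l v := by
  have h1 : HasFDerivAt (fun z : E => ((l z : ℝ) : ℂ)) (Complex.ofRealCLM ∘L l) z :=
    (Complex.ofRealCLM ∘L l).hasFDerivAt
  rw [(h1.pow m).fderiv]
  simp

lemma LocSummable.hasFDerivAt {f : K → SmoothFun d d} (hf : LocSummable f) (z : PhaseSpace d d) :
    HasFDerivAt (fun z => ∑' k, f k z)
      (∑ i, dualC i (∑' k, SmoothFun.pderiv (bvec i) (f k) z)) z := by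
  have hs := hf.summable
  have hsd := fun i => (hf.pderiv i).summable
  obtain ⟨m, hm, hm0, Q, hQ, h⟩ := hf
  have hb : ∀ i : Fin d ⊕ Fin d, ∃ C, ∀ y ∈ Metric.closedBall z 1, Q (Pi.single i 1) y ≤ C := fun i => by
    obtain ⟨C, hC⟩ := (isCompact_closedBall z 1).bddAbove_image (hQ (Pi.single i 1)).continuousOn
    exact ⟨C, fun y hy => hC ⟨y, hy, rfl⟩⟩
  choose C hC using hb
  refine hasFDerivAt_tsum_of_ball (p := fun i k => (SmoothFun.pderiv (bvec i) (f k)).1)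
    (C := C) norm_dualC_le hm z (fun k y => ?_) (fun i k y hy => ?_) (hs z) (fun i => hsd i z)
  · rw [← fderiv_eq_sum_dualC]
    exact ((f k).differentiable y).hasFDerivAt
  · have := h k (Pi.single i 1) y
    rw [mder_single, pow_one] at this
    exact this.trans (mul_le_mul_of_nonneg_left (hC i y (Metric.ball_subset_closedBall hy)) (hm0 k))

/-- The partial derivatives of a locally summable family form such a family again, so smoothness
follows by induction on the order. -/
lemma LocSummable.contDiff_nat (n : ℕ) : ∀ {f : K → SmoothFun d d}, LocSummable f →
    ContDiff ℝ n fun z => ∑' k, f k z := by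
  induction n with
  | zero =>
    intro f hf
    exact contDiff_zero.2 (continuous_of_hasFDerivAt hf.hasFDerivAt)
  | succ n ih =>
    intro f hf
    exact contDiff_succ_of_hasFDerivAt_sum hf.hasFDerivAt fun i => ih (hf.pderiv i)

/-- The sum of a locally summable family. -/
def LocSummable.sum {f : K → SmoothFun d d} (hf : LocSummable f) : SmoothFun d d :=
  ⟨fun z => ∑' k, f k z, contDiff_infty.2 fun n => hf.contDiff_nat n⟩

lemma LocSummable.pderiv_sum {f : K → SmoothFun d d} (hf : LocSummable f) (i : Fin d ⊕ Fin d) :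
    SmoothFun.pderiv (bvec i) hf.sum = (hf.pderiv i).sum := by
  ext z
  refine (fderiv_apply_of_hasFDerivAt_sum (hf.hasFDerivAt z) (bvec i)).trans ?_
  rw [Finset.sum_eq_single i]
  · rw [dualC_apply, coord_bvec, if_pos rfl, Complex.ofReal_one, one_mul]
    rfl
  · intro j _ hj
    rw [dualC_apply, coord_bvec, if_neg hj, Complex.ofReal_zero, zero_mul]
  · simp

lemma LocSummable.hasSum_mder {f : K → SmoothFun d d} (hf : LocSummable f)
    (γ : Fin d ⊕ Fin d → ℕ) (z : PhaseSpace d d) :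
    HasSum (fun k => mder γ (f k) z) (mder γ hf.sum z) := by
  induction γ using multiindex_induction generalizing f with
  | h0 =>
    simp only [mder_zero_apply]
    exact (hf.summable z).hasSum
  | hs γ i ih =>
    simp only [mder_add_single]
    rw [hf.pderiv_sum]
    exact ih (hf.pderiv i)

lemma locSummable_of_symbolBound {h r : ℝ} (hθ : ∀ i, 0 < θ i) {m : K → ℝ} (hm : Summable m)
    {f : K → SmoothFun d d} (hf : ∀ k, SymbolBound τ θ h r (m k) (f k)) : LocSummable f :=
  ⟨m, hm, fun k => (hf k).nonneg, fun γ z => wt τ h γ * Real.exp (r * grow θ z), fun γ => by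
    have := continuous_grow hθ
    fun_prop, fun k γ z => (hf k γ z).trans (le_of_eq (by ring))⟩

lemma LocSummable.symbolBound_sum {h r : ℝ} {m : K → ℝ} (hm : Summable m)
    {f : K → SmoothFun d d} (hf : ∀ k, SymbolBound τ θ h r (m k) (f k)) (hs : LocSummable f) :
    SymbolBound τ θ h r (∑' k, m k) hs.sum := by
  intro γ z
  have h1 : Summable fun k => m k * wt τ h γ * Real.exp (r * grow θ z) :=
    (hm.mul_right _).mul_right _
  rw [← (hs.hasSum_mder γ z).tsum_eq, ← tsum_mul_right, ← tsum_mul_right]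
  have h2 : Summable fun k => ‖SmoothFun.mder γ (f k) z‖ :=
    Summable.of_nonneg_of_le (fun _ => norm_nonneg _) (fun k => hf k γ z) h1
  exact (norm_tsum_le_tsum_norm h2).trans (h2.tsum_le_tsum (fun k => hf k γ z) h1)

end Series

/-! ## Powers of coordinates -/

section CoordPow

open SmoothFun

variable {d : ℕ} {τ θ : Fin d ⊕ Fin d → ℝ}

/-- The function `z ↦ z_j^m`. -/
def coordPow (j : Fin d ⊕ Fin d) (m : ℕ) : SmoothFun d d :=
  ⟨fun z => ((coord j z : ℝ) : ℂ) ^ m, by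
    have : ContDiff ℝ ∞ fun z : PhaseSpace d d => Complex.ofRealCLM (coord j z) :=
      Complex.ofRealCLM.contDiff.comp (coord j).contDiff
    exact this.pow m⟩

@[simp] lemma coordPow_apply (j : Fin d ⊕ Fin d) (m : ℕ) (z : PhaseSpace d d) :
    coordPow j m z = ((coord j z : ℝ) : ℂ) ^ m := rfl

lemma pderiv_coordPow (i j : Fin d ⊕ Fin d) (m : ℕ) :
    SmoothFun.pderiv (bvec i) (coordPow j m) =
      (if j = i then (m : ℂ) else 0) • coordPow j (m - 1) := by
  ext z
  refine (fderiv_ofReal_clm_pow (coord j) m z (bvec i)).trans ?_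
  rw [coord_bvec, smul_apply, coordPow_apply]
  split_ifs <;> simp

lemma mder_coordPow (j : Fin d ⊕ Fin d) (γ : Fin d ⊕ Fin d → ℕ) : ∀ (m : ℕ) (z : PhaseSpace d d),
    mder γ (coordPow j m) z = if ∀ i, i ≠ j → γ i = 0 then
      (m.descFactorial (γ j) : ℂ) * ((coord j z : ℝ) : ℂ) ^ (m - γ j) else 0 := by
  classical
  induction γ using multiindex_induction with
  | h0 => simp
  | hs γ i ih =>
    intro m z
    rw [mder_add_single, pderiv_coordPow, map_smul, smul_apply, ih]
    by_cases hij : j = i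
    · subst hij
      have : (∀ i, i ≠ j → (γ + (Pi.single j 1 : Fin d ⊕ Fin d → ℕ)) i = 0) ↔
          ∀ i, i ≠ j → γ i = 0 := forall₂_congr fun i hi => by simp [hi]
      rw [if_pos rfl]
      simp only [this]
      split_ifs with h
      · cases m with
        | zero => simp
        | succ m =>
          rw [Pi.add_apply, Pi.single_eq_same, Nat.succ_descFactorial_succ, Nat.add_sub_add_right]
          push_cast
          simp [mul_assoc]
      · simp
    · rw [if_neg hij, zero_mul, if_neg]
      intro h
      simpa using h i (Ne.symm hij)

/-- Differentiating z_j^m l times produces a factor of size l!, which the weights absorb as l!^(τ+θ)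
because τ + θ ≥ 1. The growth r fixes both the scale and the rate of the factorial bound. -/
lemma symbolBound_coordPow {r : ℝ} (hr : 0 < r) (hθ : ∀ i, 0 < θ i) (j : Fin d ⊕ Fin d)
    (hτθ : 1 ≤ τ j + θ j) (m : ℕ) :
    SymbolBound τ θ (((θ j / r) ^ θ j)⁻¹) r
      ((2 * (θ j / r) ^ θ j) ^ m * (m ! : ℝ) ^ θ j) (coordPow j m) := by
  intro γ z
  have hθj := hθ j
  set ρ := (θ j / r) ^ θ j with hρ
  have hρ0 : 0 < ρ := by positivity
  rw [mder_coordPow]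
  split_ifs with hγ
  swap
  · have := wt_nonneg (τ := τ) (inv_nonneg.2 hρ0.le) γ
    rw [norm_zero]
    positivity
  set l := γ j with hl
  have hγe : γ = Pi.single j l := by
    funext i
    by_cases hi : i = j
    · subst hi; simp [hl]
    · simp [hi, hγ i hi]
  have hwt : wt τ ρ⁻¹ γ = ρ⁻¹ ^ l * (l ! : ℝ) ^ τ j := by
    have := wt_add_single (τ := τ) ρ⁻¹ (γ := 0) (i := j) rfl l
    rw [zero_add, wt_zero, one_mul] at this
    rw [hγe, this]
  rw [hwt, norm_mul, norm_pow, Complex.norm_natCast, Complex.norm_real, Real.norm_eq_abs]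
  rcases lt_or_ge m l with hml | hlm
  · rw [Nat.descFactorial_eq_zero_iff_lt.2 hml]
    simp only [CharP.cast_eq_zero, zero_mul]
    positivity
  obtain ⟨n, rfl⟩ := Nat.exists_eq_add_of_le hlm
  have h1 : ((l + n).descFactorial l : ℝ) ≤ 2 ^ (l + n) * l ! := by
    rw [Nat.descFactorial_eq_factorial_mul_choose, Nat.cast_mul, mul_comm]
    gcongr
    exact_mod_cast Nat.choose_le_two_pow (l + n) l
  have h2 : |coord j z| ^ n ≤ ρ ^ n * (n ! : ℝ) ^ θ j * Real.exp (r * grow θ z) := by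
    refine (pow_le_exp_rpow (abs_nonneg (coord j z)) hr hθj n).trans ?_
    gcongr
    exact abs_coord_rpow_le_grow j z
  -- The only use of τ_j + θ_j ≥ 1: split l! into l!^τ l!^θ and merge the second factor with n!^θ
  -- into (l+n)!^θ.
  have h3 : (l ! : ℝ) * (n ! : ℝ) ^ θ j ≤ (l ! : ℝ) ^ τ j * ((l + n)! : ℝ) ^ θ j := by
    have hl1 : (1 : ℝ) ≤ l ! := by exact_mod_cast Nat.one_le_iff_ne_zero.2 (Nat.factorial_ne_zero _)
    have e1 : (l ! : ℝ) ≤ (l ! : ℝ) ^ τ j * (l ! : ℝ) ^ θ j := by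
      rw [← Real.rpow_add (by positivity)]
      calc (l ! : ℝ) = (l ! : ℝ) ^ (1 : ℝ) := (Real.rpow_one _).symm
        _ ≤ _ := Real.rpow_le_rpow_of_exponent_le hl1 hτθ
    have e2 : (l ! : ℝ) ^ θ j * (n ! : ℝ) ^ θ j ≤ ((l + n)! : ℝ) ^ θ j := by
      rw [← Real.mul_rpow (by positivity) (by positivity)]
      refine Real.rpow_le_rpow (by positivity) ?_ hθj.le
      exact_mod_cast Nat.le_of_dvd (Nat.factorial_pos _)
        (Nat.factorial_mul_factorial_dvd_factorial_add l n)
    calc _ ≤ (l ! : ℝ) ^ τ j * (l ! : ℝ) ^ θ j * (n ! : ℝ) ^ θ j := by gcongr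
      _ = (l ! : ℝ) ^ τ j * ((l ! : ℝ) ^ θ j * (n ! : ℝ) ^ θ j) := by ring
      _ ≤ _ := by gcongr
  rw [Nat.add_sub_cancel_left]
  calc ((l + n).descFactorial l : ℝ) * |coord j z| ^ n
      ≤ (2 ^ (l + n) * l !) * (ρ ^ n * (n ! : ℝ) ^ θ j * Real.exp (r * grow θ z)) := by gcongr
    _ = 2 ^ (l + n) * ρ ^ n * Real.exp (r * grow θ z) * (l ! * (n ! : ℝ) ^ θ j) := by ring
    _ ≤ 2 ^ (l + n) * ρ ^ n * Real.exp (r * grow θ z) *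
        ((l ! : ℝ) ^ τ j * ((l + n)! : ℝ) ^ θ j) := by gcongr
    _ = _ := by
      rw [mul_pow, pow_add ρ l n, inv_pow]
      field_simp

end CoordPow

/-! ## Fourier multipliers -/

section Multipliers

open FourierTransform LineDeriv SchwartzMap Real

variable {E : Type*} [NormedAddCommGroup E] [InnerProductSpace ℝ E]

/-- The function `ζ ↦ exp (2πi ⟨ζ, k⟩)`. -/
def charMultiplier (k ζ : E) : ℂ := Complex.exp (Complex.I * (2 * π * inner ℝ ζ k : ℝ))

lemma hasTemperateGrowth_charMultiplier (k : E) :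
    (charMultiplier k : E → ℂ).HasTemperateGrowth := by
  have h : (fun ζ : E => 2 * π * inner ℝ ζ k).HasTemperateGrowth := by fun_prop
  exact hasTemperateGrowth_cexp_I.comp h

variable [FiniteDimensional ℝ E] [MeasurableSpace E] [BorelSpace E]

lemma lineDeriv_fourierMultiplierCLM {g : E → ℂ} (hg : g.HasTemperateGrowth) (v : E)
    (u : 𝓢(E, ℂ)) :
    ∂_{v} (fourierMultiplierCLM ℂ g u) = fourierMultiplierCLM ℂ g (∂_{v} u) := by
  have hv : (fun x : E => ((inner ℝ x v : ℝ) : ℂ)).HasTemperateGrowth := by fun_prop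
  have hv' : (fun x : E => (inner ℝ x v : ℝ)).HasTemperateGrowth := by fun_prop
  have e : ∀ w : 𝓢(E, ℂ), fourierMultiplierCLM ℂ (fun x : E => (inner ℝ x v : ℝ)) w =
      fourierMultiplierCLM ℂ (fun x : E => ((inner ℝ x v : ℝ) : ℂ)) w :=
    fun w => (fourierMultiplierCLM_ofReal ℂ hv' w).symm
  rw [lineDeriv_eq_fourierMultiplierCLM, lineDeriv_eq_fourierMultiplierCLM, map_smul, e, e,
    fourierMultiplierCLM_fourierMultiplierCLM_apply hv hg,
    fourierMultiplierCLM_fourierMultiplierCLM_apply hg hv, mul_comm g]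

/-- Multiplier operators with even symbol are symmetric for the bilinear pairing. The inverse
transform moves across the integral, and x ↦ -x exchanges it with the direct transform while leaving
g unchanged. -/
lemma integral_fourierMultiplierCLM_mul {g : E → ℂ} (hg : g.HasTemperateGrowth)
    (heven : ∀ x, g (-x) = g x) (u v : 𝓢(E, ℂ)) :
    ∫ x, fourierMultiplierCLM ℂ g u x * v x = ∫ x, u x * fourierMultiplierCLM ℂ g v x := by
  have hinv : ∀ (w : 𝓢(E, ℂ)) x, 𝓕⁻ w x = 𝓕 w (-x) := fun w x => by
    rw [fourierInv_apply_eq]; rfl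
  rw [fourierMultiplierCLM_apply, fourierMultiplierCLM_apply, integral_fourierInv_mul_eq]
  have h2 : ∫ x, u x * 𝓕⁻ (smulLeftCLM ℂ g (𝓕 v)) x =
      ∫ x, 𝓕⁻ u x * smulLeftCLM ℂ g (𝓕 v) x := (integral_fourierInv_mul_eq _ _).symm
  rw [h2, ← integral_neg_eq_self]
  refine integral_congr_ae (Filter.Eventually.of_forall fun x => ?_)
  simp only [smulLeftCLM_apply_apply hg, hinv, heven, neg_neg, smul_eq_mul]
  ring

lemma fourierMultiplierCLM_charMultiplier (k : E) (u : 𝓢(E, ℂ)) (x : E) :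
    fourierMultiplierCLM ℂ (charMultiplier k) u x = u (x + k) := by
  rw [fourierMultiplierCLM_apply, ← show 𝓕⁻ (𝓕 u) = u from fourierInv_fourier_eq u,
    fourierInv_coe, fourierInv_coe, Real.fourierInv_eq', Real.fourierInv_eq']
  refine integral_congr_ae (Filter.Eventually.of_forall fun ζ => ?_)
  simp only [smulLeftCLM_apply_apply (hasTemperateGrowth_charMultiplier k), charMultiplier,
    fourierInv_fourier_eq, smul_eq_mul, inner_add_right]
  rw [← mul_assoc, ← Complex.exp_add]
  congr 2
  push_cast
  ring

/-- Translation is itself the multiplier `charMultiplier k`, and multipliers commute. -/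
lemma fourierMultiplierCLM_translate {g : E → ℂ} (hg : g.HasTemperateGrowth) (k : E)
    {u w : 𝓢(E, ℂ)} (h : ∀ x, w x = u (x + k)) (x : E) :
    fourierMultiplierCLM ℂ g w x = fourierMultiplierCLM ℂ g u (x + k) := by
  have hk := hasTemperateGrowth_charMultiplier k
  have hw : w = fourierMultiplierCLM ℂ (charMultiplier k) u := by
    ext x; rw [h, fourierMultiplierCLM_charMultiplier]
  rw [← fourierMultiplierCLM_charMultiplier k, hw,
    fourierMultiplierCLM_fourierMultiplierCLM_apply hg hk,
    fourierMultiplierCLM_fourierMultiplierCLM_apply hk hg, mul_comm]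

/-- On the Fourier side multiplication by ⟨x, b⟩ is, up to a constant, ∂_b. The product rule adds
the derivative of g, which by `hd` is ⟨ζ, v⟩ g up to a constant, that is, a derivative of u along v.
-/
lemma inner_smul_fourierMultiplierCLM {g : E → ℂ} (hg : g.HasTemperateGrowth) {b v : E}
    (hd : ∀ ζ, fderiv ℝ g ζ b = Complex.I * (2 * π) ^ 2 * (inner ℝ ζ v : ℝ) * g ζ)
    (u : 𝓢(E, ℂ)) :
    smulLeftCLM ℂ (fun x : E => (inner ℝ x b : ℝ)) (fourierMultiplierCLM ℂ g u) =
      fourierMultiplierCLM ℂ g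
        (smulLeftCLM ℂ (fun x : E => (inner ℝ x b : ℝ)) u + Complex.I • ∂_{v} u) := by
  have hb : (fun x : E => (inner ℝ x b : ℝ)).HasTemperateGrowth := by fun_prop
  have hv : (fun x : E => (inner ℝ x v : ℝ)).HasTemperateGrowth := by fun_prop
  have hpi : (2 * π * Complex.I) ≠ 0 := Complex.two_pi_I_ne_zero
  have h1 : ∂_{b} (smulLeftCLM ℂ g (𝓕 u)) = smulLeftCLM ℂ g (𝓕
      ((2 * π : ℂ) • ∂_{v} u - (2 * π * Complex.I) •
        smulLeftCLM ℂ (fun x : E => (inner ℝ x b : ℝ)) u)) := by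
    have e1 : 𝓕 ((2 * π : ℂ) • ∂_{v} u - (2 * π * Complex.I) •
        smulLeftCLM ℂ (fun x : E => (inner ℝ x b : ℝ)) u) =
        (Complex.I * (2 * π) ^ 2) • smulLeftCLM ℂ (fun x : E => (inner ℝ x v : ℝ)) (𝓕 u) +
          ∂_{b} (𝓕 u) := by
      rw [lineDerivOp_fourier_eq, sub_eq_add_neg, FourierTransform.fourier_add,
        FourierTransform.fourier_smul, fourier_lineDerivOp_eq, smul_smul, ← neg_smul]
      congr 2
      ring
    rw [e1]
    ext ζ
    rw [smulLeftCLM_apply_apply hg, lineDerivOp_apply_eq_fderiv]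
    have e2 : (smulLeftCLM ℂ g (𝓕 u) : E → ℂ) = fun x => g x * 𝓕 u x := by
      ext x; rw [smulLeftCLM_apply_apply hg, smul_eq_mul]
    rw [e2, fderiv_fun_mul (hg.1.differentiable (by simp) ζ) ((𝓕 u).differentiable ζ)]
    simp only [_root_.add_apply, _root_.smul_apply, hd, smulLeftCLM_apply_apply hv,
      lineDerivOp_apply_eq_fderiv, smul_eq_mul, Complex.real_smul]
    ring
  have h2 := fourierInv_lineDerivOp_eq (smulLeftCLM ℂ g (𝓕 u)) b
  rw [h1, ← fourierMultiplierCLM_apply, ← fourierMultiplierCLM_apply] at h2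
  have h3 := congrArg (fun w => -(2 * π * Complex.I)⁻¹ • w) h2
  simp only [smul_smul, neg_mul_neg, inv_mul_cancel₀ hpi, one_smul] at h3
  rw [← h3, ← map_smul]
  congr 1
  rw [smul_sub, smul_smul, smul_smul, neg_mul, neg_mul, inv_mul_cancel₀ hpi, neg_smul, neg_smul,
    one_smul, sub_neg_eq_add, add_comm, ← neg_smul]
  congr 2
  have hpi' : (π : ℂ) ≠ 0 := by exact_mod_cast Real.pi_ne_zero
  field_simp
  rw [Complex.I_sq]

end Multipliers

/-! ## The operator on Schwartz functions -/

section Operator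

open FourierTransform LineDeriv SchwartzMap Real SmoothFun

variable {d : ℕ} {τ θ : Fin d ⊕ Fin d → ℝ} (A : Matrix (Fin d) (Fin d) ℝ)

/-- The direction `v` such that `z_i e^{i⟨AD_ξ,D_x⟩} = e^{i⟨AD_ξ,D_x⟩} (z_i + i ∂_v)`. -/
def twistVec (i : Fin d ⊕ Fin d) : PhaseSpace d d :=
  Sum.elim (fun j => WithLp.toLp 2 (0, WithLp.toLp 2 (A j)))
    (fun k => WithLp.toLp 2 (WithLp.toLp 2 (fun j => A j k), 0)) i

lemma inner_eq_sum_coord (z w : PhaseSpace d d) : inner ℝ z w = ∑ i, coord i z * coord i w := by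
  simp [WithLp.prod_inner_apply, PiLp.inner_apply, coord_inl, coord_inr, mul_comm]

lemma inner_bvec (i : Fin d ⊕ Fin d) (z : PhaseSpace d d) : inner ℝ z (bvec i) = coord i z := by
  rw [inner_eq_sum_coord]
  simp [coord_bvec, -Fintype.sum_sum_type]

/-- The direction lies in the opposite block; therefore multiplication by z_i commutes with the
derivative along it. -/
lemma coord_twistVec_self (i : Fin d ⊕ Fin d) : coord i (twistVec A i) = 0 := by
  cases i <;> rfl

lemma expADMultiplier_eq (ζ : PhaseSpace d d) : expADMultiplier A ζ =
    Complex.exp (Complex.I * ((2 * π) ^ 2 *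
      ∑ j, ∑ k, A j k * coord (Sum.inl j) ζ * coord (Sum.inr k) ζ : ℝ)) := by
  unfold expADMultiplier
  congr 3
  simp only [inner_smul_right, map_smul, inner_smul_left]
  rw [← mul_assoc, sq]
  simp only [RCLike.conj_to_real]
  congr 1
  simp only [PiLp.inner_apply, coord_inl, coord_inr, Matrix.toLpLin_apply, Matrix.mulVec,
    dotProduct]
  refine Finset.sum_congr rfl fun j _ => ?_
  simp [Finset.mul_sum]
  refine Finset.sum_congr rfl fun k _ => ?_
  ring

lemma expADMultiplier_neg (ζ : PhaseSpace d d) : expADMultiplier A (-ζ) = expADMultiplier A ζ := by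
  simp [expADMultiplier_eq]

lemma expADMultiplier_neg_mul : expADMultiplier (-A) * expADMultiplier A = fun _ => 1 := by
  ext ζ
  rw [Pi.mul_apply, expADMultiplier_eq, expADMultiplier_eq, ← Complex.exp_add, ← mul_add]
  simp

lemma fderiv_expADMultiplier (i : Fin d ⊕ Fin d) (ζ : PhaseSpace d d) :
    fderiv ℝ (expADMultiplier A) ζ (bvec i) =
      Complex.I * (2 * π) ^ 2 * (inner ℝ ζ (twistVec A i) : ℝ) * expADMultiplier A ζ := by
  have hdiff : DifferentiableAt ℝ (expADMultiplier A) ζ :=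
    (hasTemperateGrowth_expADMultiplier A).1.differentiable (by simp) ζ
  rw [← hdiff.lineDeriv_eq_fderiv]
  refine HasLineDerivAt.lineDeriv ?_
  -- The phase is bilinear in the two blocks and `bvec i` lies in one of them, so along this line
  -- the phase is affine in t, without a quadratic term.
  have h1 : ∀ t : ℝ, expADMultiplier A (ζ + t • bvec i) =
      expADMultiplier A ζ * Complex.exp ((Complex.I * (2 * π) ^ 2 *
        (inner ℝ ζ (twistVec A i) : ℝ)) * t) := by
    intro t
    rw [expADMultiplier_eq, expADMultiplier_eq, ← Complex.exp_add]
    congr 1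
    have : ∑ j, ∑ k, A j k * coord (Sum.inl j) (ζ + t • bvec i) *
        coord (Sum.inr k) (ζ + t • bvec i) = ∑ j, ∑ k, A j k * coord (Sum.inl j) ζ *
        coord (Sum.inr k) ζ + t * inner ℝ ζ (twistVec A i) := by
      rw [inner_eq_sum_coord]
      cases i with
      | inl l =>
        simp only [map_add, map_smul, coord_bvec, Sum.inl.injEq, reduceCtorEq, if_false,
          add_zero, mul_add, add_mul, Finset.sum_add_distrib, Fintype.sum_sum_type, smul_eq_mul,
          mul_ite, mul_one, mul_zero, ite_mul, zero_mul]
        congr 1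
        rw [Finset.sum_comm]
        simp only [Finset.sum_ite_eq', Finset.mem_univ, if_true, Finset.mul_sum]
        have h0 : ∀ k, coord (Sum.inl k) (twistVec A (Sum.inl l)) = 0 := fun k => rfl
        have h1 : ∀ k, coord (Sum.inr k) (twistVec A (Sum.inl l)) = A l k := fun k => rfl
        simp only [h0, h1, mul_zero, Finset.sum_const_zero, zero_add]
        exact Finset.sum_congr rfl fun k _ => by ring
      | inr l =>
        simp only [map_add, map_smul, coord_bvec, Sum.inr.injEq, reduceCtorEq, if_false,
          add_zero, mul_add, Finset.sum_add_distrib, Fintype.sum_sum_type, smul_eq_mul,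
          mul_ite, mul_one, mul_zero]
        congr 1
        simp only [Finset.sum_ite_eq', Finset.mem_univ, if_true, Finset.mul_sum]
        have h0 : ∀ k, coord (Sum.inr k) (twistVec A (Sum.inr l)) = 0 := fun k => rfl
        have h1 : ∀ k, coord (Sum.inl k) (twistVec A (Sum.inr l)) = A k l := fun k => rfl
        simp only [h0, h1, mul_zero, Finset.sum_const_zero, add_zero]
        exact Finset.sum_congr rfl fun k _ => by ring
    rw [this]
    push_cast
    ring
  have h2 : HasDerivAt (fun t : ℝ => expADMultiplier A ζ * Complex.exp ((Complex.I * (2 * π) ^ 2 *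
        (inner ℝ ζ (twistVec A i) : ℝ)) * t)) (expADMultiplier A ζ * (Complex.exp ((Complex.I *
        (2 * π) ^ 2 * (inner ℝ ζ (twistVec A i) : ℝ)) * (0 : ℝ)) * ((Complex.I * (2 * π) ^ 2 *
        (inner ℝ ζ (twistVec A i) : ℝ)) * 1))) 0 := by
    refine HasDerivAt.const_mul _ (HasDerivAt.cexp ?_)
    exact (Complex.ofRealCLM.hasDerivAt (x := (0 : ℝ))).const_mul _
  refine (h2.congr_deriv ?_).congr_of_eventuallyEq (Filter.Eventually.of_forall fun t => h1 t)
  simp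
  ring

lemma expAD_neg_expAD (u : 𝓢(PhaseSpace d d, ℂ)) : expAD (-A) (expAD A u) = u := by
  unfold expAD
  rw [fourierMultiplierCLM_fourierMultiplierCLM_apply (hasTemperateGrowth_expADMultiplier _)
    (hasTemperateGrowth_expADMultiplier _), expADMultiplier_neg_mul, fourierMultiplierCLM_const]
  simp

lemma expAD_expAD_neg (u : 𝓢(PhaseSpace d d, ℂ)) : expAD A (expAD (-A) u) = u := by
  simpa using expAD_neg_expAD (-A) u

lemma integral_expAD_mul (u v : 𝓢(PhaseSpace d d, ℂ)) :
    ∫ x, expAD A u x * v x = ∫ x, u x * expAD A v x :=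
  integral_fourierMultiplierCLM_mul (hasTemperateGrowth_expADMultiplier A)
    (expADMultiplier_neg A) u v

lemma expAD_translate (k : PhaseSpace d d) {u w : 𝓢(PhaseSpace d d, ℂ)}
    (h : ∀ x, w x = u (x + k)) (x : PhaseSpace d d) : expAD A w x = expAD A u (x + k) :=
  fourierMultiplierCLM_translate (hasTemperateGrowth_expADMultiplier A) k h x

lemma ofSchwartz_lineDeriv (v : PhaseSpace d d) (u : 𝓢(PhaseSpace d d, ℂ)) :
    ofSchwartz (∂_{v} u) = pderiv v (ofSchwartz u) := rfl

lemma lineDeriv_expAD (v : PhaseSpace d d) (u : 𝓢(PhaseSpace d d, ℂ)) :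
    ∂_{v} (expAD A u) = expAD A (∂_{v} u) :=
  lineDeriv_fourierMultiplierCLM (hasTemperateGrowth_expADMultiplier A) v u

/-- The witness is the Schwartz function ∂^γ u, so estimates for all derivatives of the image reduce
to sup estimates for images of other Schwartz functions. -/
lemma exists_mder_expAD (γ : Fin d ⊕ Fin d → ℕ) (u : 𝓢(PhaseSpace d d, ℂ)) :
    ∃ w : 𝓢(PhaseSpace d d, ℂ), ofSchwartz w = mder γ (ofSchwartz u) ∧
      ofSchwartz (expAD A w) = mder γ (ofSchwartz (expAD A u)) := by
  induction γ using multiindex_induction with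
  | h0 => exact ⟨u, by simp [mder_zero], by simp [mder_zero]⟩
  | hs γ i ih =>
    obtain ⟨w, h1, h2⟩ := ih
    refine ⟨∂_{bvec i} w, ?_, ?_⟩
    · rw [mder_add_single', ← h1, ofSchwartz_lineDeriv]
    · rw [mder_add_single', ← h2, ← lineDeriv_expAD, ofSchwartz_lineDeriv]

/-- The operator `z_i + i ∂_v` on Schwartz functions, with `v = twistVec A i`. -/
def twistOp (i : Fin d ⊕ Fin d) (u : 𝓢(PhaseSpace d d, ℂ)) : 𝓢(PhaseSpace d d, ℂ) :=
  smulLeftCLM ℂ (fun x : PhaseSpace d d => (inner ℝ x (bvec i) : ℝ)) u +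
    Complex.I • ∂_{twistVec A i} u

lemma coord_mul_expAD (i : Fin d ⊕ Fin d) (u : 𝓢(PhaseSpace d d, ℂ)) (z : PhaseSpace d d) :
    (coord i z : ℂ) * expAD A u z = expAD A (twistOp A i u) z := by
  have h := inner_smul_fourierMultiplierCLM (hasTemperateGrowth_expADMultiplier A)
    (fderiv_expADMultiplier A i) u
  have hb : (fun x : PhaseSpace d d => (inner ℝ x (bvec i) : ℝ)).HasTemperateGrowth := by fun_prop
  have h2 := congrArg (fun f : 𝓢(PhaseSpace d d, ℂ) => f z) h
  have h3 := smulLeftCLM_apply_apply hb (expAD A u) z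
  rw [inner_bvec, Complex.real_smul] at h3
  exact h3.symm.trans h2

lemma coord_pow_mul_expAD (i : Fin d ⊕ Fin d) (n : ℕ) (u : 𝓢(PhaseSpace d d, ℂ))
    (z : PhaseSpace d d) :
    (coord i z : ℂ) ^ n * expAD A u z = expAD A ((twistOp A i)^[n] u) z := by
  induction n generalizing u with
  | zero => simp
  | succ n ih => rw [pow_succ, mul_assoc, coord_mul_expAD, ih, Function.iterate_succ_apply]

lemma ofSchwartz_twistOp (i : Fin d ⊕ Fin d) (u : 𝓢(PhaseSpace d d, ℂ)) :
    ofSchwartz (twistOp A i u) =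
      ((mulL (coordPow i 1) : Module.End ℂ (SmoothFun d d)) +
        Complex.I • pderiv (twistVec A i)) (ofSchwartz u) := by
  unfold twistOp
  have hb : (fun x : PhaseSpace d d => (inner ℝ x (bvec i) : ℝ)).HasTemperateGrowth := by fun_prop
  rw [map_add, map_smul, ofSchwartz_lineDeriv, LinearMap.add_apply, LinearMap.smul_apply]
  congr 1
  refine SmoothFun.ext fun z => ?_
  rw [mulL_apply, coordPow_apply]
  change smulLeftCLM ℂ (fun x : PhaseSpace d d => (inner ℝ x (bvec i) : ℝ)) u z = _
  rw [smulLeftCLM_apply_apply hb, inner_bvec, pow_one]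
  rfl

/-- Multiplication by z_i and ∂_v commute because z_i is constant along v, so the binomial theorem
for commuting operators applies. -/
lemma ofSchwartz_twistOp_iterate (i : Fin d ⊕ Fin d) (n : ℕ) (u : 𝓢(PhaseSpace d d, ℂ)) :
    ofSchwartz ((twistOp A i)^[n] u) = ∑ p ∈ Finset.HasAntidiagonal.antidiagonal n,
      (n.choose p.1 * Complex.I ^ p.2 : ℂ) • mulL (coordPow i p.1)
        (((pderiv (twistVec A i) : Module.End ℂ (SmoothFun d d)) ^ p.2) (ofSchwartz u)) := by
  set X : Module.End ℂ (SmoothFun d d) := mulL (coordPow i 1) with hX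
  set D : Module.End ℂ (SmoothFun d d) := Complex.I • pderiv (twistVec A i) with hD
  have hXp : ∀ m f, (X ^ m) f = mulL (coordPow i m) f := by
    intro m
    induction m with
    | zero => intro f; refine SmoothFun.ext fun z => ?_; simp [mulL_apply, coordPow_apply]
    | succ m ih =>
      intro f
      rw [pow_succ, Module.End.mul_apply, ih]
      refine SmoothFun.ext fun z => ?_
      simp only [hX, mulL_apply, coordPow_apply]
      ring
  have hcomm : Commute X D := by
    refine LinearMap.ext fun f => ?_
    simp only [Module.End.mul_apply, hX, hD, LinearMap.smul_apply, map_smul]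
    rw [pderiv_mulL]
    have : pderiv (twistVec A i) (coordPow i 1) = 0 := by
      rw [pderiv_eq_sum, LinearMap.sum_apply]
      refine Finset.sum_eq_zero fun j _ => ?_
      rw [LinearMap.smul_apply, pderiv_coordPow]
      by_cases h : i = j
      · subst h; simp [coord_twistVec_self]
      · simp [h]
    rw [this]
    simp
  have h1 : ∀ n, ofSchwartz ((twistOp A i)^[n] u) = ((X + D) ^ n) (ofSchwartz u) := by
    intro n
    induction n with
    | zero => simp
    | succ n ih =>
      rw [Function.iterate_succ_apply', ofSchwartz_twistOp, ih, pow_succ', Module.End.mul_apply]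
  rw [h1, hcomm.add_pow', LinearMap.sum_apply]
  refine Finset.sum_congr rfl fun p _ => ?_
  rw [LinearMap.smul_apply, Module.End.mul_apply, hXp, hD, smul_pow, LinearMap.smul_apply, map_smul,
    ← Nat.cast_smul_eq_nsmul ℂ, smul_smul]

/-- The factor `κ` in the bound `|z_i^n e^{i⟨AD_ξ,D_x⟩} u(z)| ≤ C κ^n n!^θ`. -/
def twistScale (θ : Fin d ⊕ Fin d → ℝ) (b h : ℝ) (i : Fin d ⊕ Fin d) : ℝ :=
  2 * (θ i / b) ^ θ i + (∑ l, |coord l (twistVec A i)|) * h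

lemma twistScale_pos {b h : ℝ} (hθ : ∀ i, 0 < θ i) (hb : 0 < b) (hh : 0 ≤ h) (i : Fin d ⊕ Fin d) :
    0 < twistScale A θ b h i := by
  have := hθ i
  have h2 : 0 ≤ ∑ l, |coord l (twistVec A i)| := Finset.sum_nonneg fun l _ => abs_nonneg _
  unfold twistScale
  positivity

variable {A}

lemma symbolBound_sum {h r : ℝ} {K : Type*} (S : Finset K) {f : K → SmoothFun d d} {m : K → ℝ}
    (hf : ∀ k ∈ S, SymbolBound τ θ h r (m k) (f k)) :
    SymbolBound τ θ h r (∑ k ∈ S, m k) (∑ k ∈ S, f k) := by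
  intro γ z
  rw [map_sum, SmoothFun.sum_apply, Finset.sum_mul, Finset.sum_mul]
  exact (norm_sum_le _ _).trans (Finset.sum_le_sum fun k hk => hf k hk γ z)

/-- In each binomial term the power z_i^p costs p!^θ_i and the derivative of order q costs q!^τ_l
with τ_l = θ_i by `hA`; together this is n!^θ_i. The powers of z_i are paid for by giving up b of
the decay a. -/
lemma symbolBound_twistOp_iterate {h a b M T : ℝ} (hτ : ∀ i, 0 ≤ τ i) (hT : ∀ i, τ i ≤ T)
    (hθ : ∀ i, 0 < θ i) (hτθ : ∀ i, 1 ≤ τ i + θ i)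
    (hA : ∀ i l, coord l (twistVec A i) = 0 ∨ τ l = θ i) (hh : 0 ≤ h) (hb : 0 < b)
    {u : 𝓢(PhaseSpace d d, ℂ)} (hu : SymbolBound τ θ h (-a) M (ofSchwartz u))
    (i : Fin d ⊕ Fin d) (n : ℕ) :
    SymbolBound τ θ (((θ i / b) ^ θ i)⁻¹ + 2 ^ T * h) (b + -a)
      (M * (twistScale A θ b (2 ^ T * h) i ^ n * (n ! : ℝ) ^ θ i))
      (ofSchwartz ((twistOp A i)^[n] u)) := by
  have hθi := hθ i
  have hH : 0 ≤ 2 ^ T * h := by positivity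
  have hv : 0 ≤ ∑ l, |coord l (twistVec A i)| := Finset.sum_nonneg fun l _ => abs_nonneg _
  rw [ofSchwartz_twistOp_iterate]
  have h1 := symbolBound_sum (τ := τ) (θ := θ) (h := ((θ i / b) ^ θ i)⁻¹ + 2 ^ T * h) (r := b + -a)
    (Finset.HasAntidiagonal.antidiagonal n)
    (f := fun p => (n.choose p.1 * Complex.I ^ p.2 : ℂ) • mulL (coordPow i p.1)
        (((pderiv (twistVec A i) : Module.End ℂ (SmoothFun d d)) ^ p.2) (ofSchwartz u)))
    (fun p _ => ((symbolBound_coordPow hb hθ i (hτθ i) p.1).mul hτ (by positivity) hH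
      (hu.pderiv_pow hh hτ hT hθi.le (twistVec A i) (hA i) p.2)).smul _)
  refine h1.mono (by positivity) le_rfl le_rfl ?_
  have h2 := sum_antidiagonal_choose_mul_le hθi.le
    (show 0 ≤ 2 * (θ i / b) ^ θ i by positivity)
    (show 0 ≤ (∑ l, |coord l (twistVec A i)|) * (2 ^ T * h) by positivity) n
  refine le_trans (le_of_eq ?_) (mul_le_mul_of_nonneg_left h2 hu.nonneg)
  rw [Finset.mul_sum]
  refine Finset.sum_congr rfl fun p _ => ?_
  simp only [norm_mul, norm_pow, Complex.norm_I, one_pow, mul_one, Complex.norm_natCast]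
  ring

/-- Continuity of the operator on Schwartz space bounds the sup of the image by finitely many
seminorms of u, each controlled uniformly by M. -/
lemma exists_norm_expAD_le {h a : ℝ} (A : Matrix (Fin d) (Fin d) ℝ) (hθ : ∀ i, 0 < θ i)
    (hh : 0 ≤ h) (ha : 0 < a) :
    ∃ C : ℝ, 0 ≤ C ∧ ∀ (u : 𝓢(PhaseSpace d d, ℂ)) (M : ℝ),
      SymbolBound τ θ h (-a) M (ofSchwartz u) → ∀ z, ‖expAD A u z‖ ≤ C * M := by
  have hc : Continuous ((SchwartzMap.seminorm ℂ 0 0).comp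
      (expAD A : 𝓢(PhaseSpace d d, ℂ) →ₗ[ℂ] 𝓢(PhaseSpace d d, ℂ))) :=
    ((schwartz_withSeminorms ℂ (PhaseSpace d d) ℂ).continuous_seminorm (0, 0)).comp
      (expAD A).continuous
  obtain ⟨S, C, -, hS⟩ := Seminorm.bound_of_continuous
    (schwartz_withSeminorms ℂ (PhaseSpace d d) ℂ) _ hc
  choose c hc0 hc1 using fun p : ℕ × ℕ => exists_seminorm_le (τ := τ) hθ hh ha p.1 p.2
  refine ⟨C * ∑ p ∈ S, c p, mul_nonneg C.2 (Finset.sum_nonneg fun p _ => hc0 p),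
    fun u M hu z => ?_⟩
  have h1 : ‖expAD A u z‖ ≤ SchwartzMap.seminorm ℂ 0 0 (expAD A u) := by
    simpa using SchwartzMap.norm_le_seminorm ℂ (expAD A u) z
  refine h1.trans ((hS u).trans ?_)
  rw [_root_.smul_apply, mul_assoc, Finset.sum_mul]
  refine mul_le_mul_of_nonneg_left ?_ C.2
  refine Seminorm.finset_sup_apply_le
    (Finset.sum_nonneg fun p _ => mul_nonneg (hc0 p) hu.nonneg) fun p hp => ?_
  exact (hc1 p u M hu).trans
    (Finset.single_le_sum (f := fun p => c p * M) (fun p _ => mul_nonneg (hc0 p) hu.nonneg) hp)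

/-- The central estimate. The sup bound applied to (z_i + i∂_v)^n u bounds |z_i^n| times the image
by C κ^n n!^θ_i, and `exists_pow_factorial_le` selects the best n. The condition `ha` says that the
rate so obtained suffices for decay a'. One factor 2^T in the scale comes from replacing u by ∂^γ u,
the other from the derivatives along v. -/
lemma exists_expAD_symbolBound {h a b a' T : ℝ} (hτ : ∀ i, 0 ≤ τ i) (hT : ∀ i, τ i ≤ T)
    (hθ : ∀ i, 0 < θ i) (hτθ : ∀ i, 1 ≤ τ i + θ i)
    (hA : ∀ i l, coord l (twistVec A i) = 0 ∨ τ l = θ i) (hh : 0 ≤ h) (hb : 0 < b) (hba : b < a)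
    (ha' : 0 ≤ a')
    (ha : ∀ i, a' * Fintype.card (Fin d ⊕ Fin d) ≤
      (twistScale A θ b (2 ^ T * (2 ^ T * h)) i * Real.exp 1) ^ (-(1 / θ i))) :
    ∃ C : ℝ, 0 ≤ C ∧ ∀ (u : 𝓢(PhaseSpace d d, ℂ)) (M : ℝ),
      SymbolBound τ θ h (-a) M (ofSchwartz u) →
      SymbolBound τ θ (2 ^ T * h) (-a') (C * M) (ofSchwartz (expAD A u)) := by
  have hH : 0 ≤ 2 ^ T * h := by positivity
  have hH2 : 0 ≤ 2 ^ T * (2 ^ T * h) := by positivity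
  have hρ : ∀ i, 0 ≤ ((θ i / b) ^ θ i)⁻¹ := fun i => by have := hθ i; positivity
  have hS : 0 ≤ ∑ i, ((θ i / b) ^ θ i)⁻¹ := Finset.sum_nonneg fun i _ => hρ i
  -- One scale for all coordinates i at once; the last summand covers the case without coordinates.
  set H : ℝ := ∑ i, ((θ i / b) ^ θ i)⁻¹ + 2 ^ T * (2 ^ T * h) + 2 ^ T * h with hHdef
  have hH0 : 0 ≤ H := by positivity
  obtain ⟨C, hC0, hC⟩ := exists_norm_expAD_le (τ := τ) A hθ hH0 (sub_pos.2 hba)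
  have hdecay : ∀ (u : 𝓢(PhaseSpace d d, ℂ)) (M : ℝ),
      SymbolBound τ θ (2 ^ T * h) (-a) M (ofSchwartz u) → ∀ z,
      ‖expAD A u z‖ ≤ Real.exp 1 * C * M * Real.exp (-a' * grow θ z) := by
    intro u M hu z
    have hM := hu.nonneg
    rcases isEmpty_or_nonempty (Fin d ⊕ Fin d) with he | hne
    · have h1 := hC u M (hu.mono hH (by linarith) (by linarith) le_rfl) z
      have h2 : grow θ z = 0 := by unfold grow; exact Finset.sum_of_isEmpty _
      rw [h2, mul_zero, Real.exp_zero, mul_one, mul_assoc]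
      exact h1.trans (le_mul_of_one_le_left (by positivity) (by simp))
    -- It is enough to have decay in the dominant coordinate, whose contribution is at least `grow`
    -- divided by the number of coordinates.
    obtain ⟨i, -, hi⟩ := Finset.exists_max_image Finset.univ (fun i => |coord i z| ^ (1 / θ i))
      Finset.univ_nonempty
    set t := |coord i z| with ht
    set κ := twistScale A θ b (2 ^ T * (2 ^ T * h)) i with hκ
    have hκ0 : 0 < κ := twistScale_pos A hθ hb hH2 i
    obtain ⟨n, hn⟩ := exists_pow_factorial_le (abs_nonneg (coord i z)) hκ0 (hθ i)
    have hpos : 0 < κ ^ n * (n ! : ℝ) ^ θ i := by positivity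
    -- If t vanishes, the inequality for the chosen n would make a positive number at most 0, unless
    -- n = 0; so dividing by t^n is legitimate.
    have htn : 0 < t ^ n := by
      by_contra hneg
      have h0 : t ^ n = 0 := le_antisymm (not_lt.1 hneg) (by positivity)
      rw [← ht, h0, mul_zero] at hn
      linarith
    have h1 := hC _ _ ((symbolBound_twistOp_iterate hτ hT hθ hτθ hA hH hb hu i n).mono
      (add_nonneg (hρ i) hH2) (by
        have := Finset.single_le_sum (f := fun i => ((θ i / b) ^ θ i)⁻¹) (fun i _ => hρ i)
          (Finset.mem_univ i)
        linarith) (by linarith : b + -a ≤ -(a - b)) le_rfl) z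
    rw [← coord_pow_mul_expAD, norm_mul, norm_pow, Complex.norm_real, Real.norm_eq_abs, ← ht,
      ← hκ] at h1
    have h2 : ‖expAD A u z‖ ≤ C * M * (Real.exp 1 *
        Real.exp (-((κ * Real.exp 1) ^ (-(1 / θ i)) * t ^ (1 / θ i)))) := by
      refine le_of_mul_le_mul_left ?_ htn
      calc t ^ n * ‖expAD A u z‖ ≤ C * (M * (κ ^ n * (n ! : ℝ) ^ θ i)) := h1
        _ ≤ C * (M * (Real.exp 1 *
          Real.exp (-((κ * Real.exp 1) ^ (-(1 / θ i)) * t ^ (1 / θ i))) * t ^ n)) := by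
            gcongr
        _ = _ := by ring
    refine h2.trans ?_
    have h3 : a' * grow θ z ≤ (κ * Real.exp 1) ^ (-(1 / θ i)) * t ^ (1 / θ i) := by
      have h4 : grow θ z ≤ Fintype.card (Fin d ⊕ Fin d) * t ^ (1 / θ i) := by
        unfold grow
        refine (Finset.sum_le_card_nsmul _ _ _ fun l hl => hi l hl).trans ?_
        rw [nsmul_eq_mul]; rfl
      calc a' * grow θ z ≤ a' * (Fintype.card (Fin d ⊕ Fin d) * t ^ (1 / θ i)) := by gcongr
        _ = a' * Fintype.card (Fin d ⊕ Fin d) * t ^ (1 / θ i) := by ring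
        _ ≤ _ := by gcongr; exact ha i
    have h5 : Real.exp (-((κ * Real.exp 1) ^ (-(1 / θ i)) * t ^ (1 / θ i))) ≤
        Real.exp (-a' * grow θ z) := Real.exp_le_exp.2 (by linarith)
    calc C * M * (Real.exp 1 *
        Real.exp (-((κ * Real.exp 1) ^ (-(1 / θ i)) * t ^ (1 / θ i))))
        ≤ C * M * (Real.exp 1 * Real.exp (-a' * grow θ z)) := by gcongr
      _ = _ := by ring
  refine ⟨Real.exp 1 * C, by positivity, fun u M hu γ z => ?_⟩
  obtain ⟨w, hw1, hw2⟩ := exists_mder_expAD A γ u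
  have h1 := hdecay w _ (hw1 ▸ hu.mder hh hτ hT γ) z
  rw [← hw2]
  refine h1.trans (le_of_eq ?_)
  ring

/-- `e^{i⟨AD_ξ,D_x⟩}` preserves decay of Roumieu type. -/
lemma exists_expAD_symbolBound_roumieu {h a T : ℝ} (hτ : ∀ i, 0 ≤ τ i) (hT : ∀ i, τ i ≤ T)
    (hθ : ∀ i, 0 < θ i) (hτθ : ∀ i, 1 ≤ τ i + θ i)
    (hA : ∀ i l, coord l (twistVec A i) = 0 ∨ τ l = θ i) (hh : 0 ≤ h) (ha : 0 < a) :
    ∃ a' : ℝ, 0 < a' ∧ ∃ C : ℝ, 0 ≤ C ∧ ∀ (u : 𝓢(PhaseSpace d d, ℂ)) (M : ℝ),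
      SymbolBound τ θ h (-a) M (ofSchwartz u) →
      SymbolBound τ θ (2 ^ T * h) (-a') (C * M) (ofSchwartz (expAD A u)) := by
  have hpos : ∀ i, 0 < (twistScale A θ (a / 2) (2 ^ T * (2 ^ T * h)) i * Real.exp 1) ^
      (-(1 / θ i)) := fun i => by
    have := twistScale_pos A hθ (half_pos ha) (show 0 ≤ 2 ^ T * (2 ^ T * h) by positivity) i
    positivity
  have hev : ∀ᶠ a' : ℝ in nhdsWithin 0 (Set.Ioi 0), ∀ i, a' * Fintype.card (Fin d ⊕ Fin d) ≤
      (twistScale A θ (a / 2) (2 ^ T * (2 ^ T * h)) i * Real.exp 1) ^ (-(1 / θ i)) := by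
    refine Filter.eventually_all.2 fun i => Filter.Eventually.filter_mono nhdsWithin_le_nhds ?_
    have hc : Filter.Tendsto (fun a' : ℝ => a' * Fintype.card (Fin d ⊕ Fin d)) (nhds 0)
        (nhds (0 * Fintype.card (Fin d ⊕ Fin d))) := Filter.Tendsto.mul_const _ Filter.tendsto_id
    rw [zero_mul] at hc
    exact (hc.eventually (gt_mem_nhds (hpos i))).mono fun x hx => le_of_lt hx
  obtain ⟨a', h1, h2⟩ := (hev.and self_mem_nhdsWithin).exists
  exact ⟨a', h2, exists_expAD_symbolBound hτ hT hθ hτθ hA hh (half_pos ha) (half_lt_self ha)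
    (le_of_lt h2) h1⟩

/-- `e^{i⟨AD_ξ,D_x⟩}` preserves decay of Beurling type. -/
lemma exists_expAD_symbolBound_beurling {a' T : ℝ} (hτ : ∀ i, 0 ≤ τ i) (hT : ∀ i, τ i ≤ T)
    (hθ : ∀ i, 0 < θ i) (hτθ : ∀ i, 1 ≤ τ i + θ i)
    (hA : ∀ i l, coord l (twistVec A i) = 0 ∨ τ l = θ i) (ha' : 0 < a') :
    ∃ η : ℝ, 0 < η ∧ ∃ a : ℝ, 0 < a ∧ ∀ h : ℝ, 0 ≤ h → h ≤ η →
      ∃ C : ℝ, 0 ≤ C ∧ ∀ (u : 𝓢(PhaseSpace d d, ℂ)) (M : ℝ),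
      SymbolBound τ θ h (-a) M (ofSchwartz u) →
      SymbolBound τ θ (2 ^ T * h) (-a') (C * M) (ofSchwartz (expAD A u)) := by
  -- N is the rate to be reached; κ e ≤ N^(-θ_i) suffices. Each of the two summands of κ gets half
  -- of this: the first by taking b large, the second by taking h ≤ η small. The +1 keeps N positive
  -- when there are no coordinates.
  set N : ℝ := a' * Fintype.card (Fin d ⊕ Fin d) + 1 with hN
  have hN0 : 0 < N := by positivity
  have hc : ∀ i, 0 < N ^ (-θ i) / Real.exp 1 / 2 := fun i => by positivity
  have hev : ∀ᶠ b : ℝ in Filter.atTop, ∀ i, 2 * (θ i / b) ^ θ i ≤ N ^ (-θ i) / Real.exp 1 / 2 := by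
    refine Filter.eventually_all.2 fun i => ?_
    have h1 : Filter.Tendsto (fun b : ℝ => 2 * (θ i / b) ^ θ i) Filter.atTop
        (nhds (2 * 0 ^ θ i)) :=
      ((tendsto_const_nhds.div_atTop Filter.tendsto_id).rpow_const
        (Or.inr (hθ i).le)).const_mul 2
    rw [Real.zero_rpow (hθ i).ne', mul_zero] at h1
    exact (h1.eventually (gt_mem_nhds (hc i))).mono fun x hx => le_of_lt hx
  obtain ⟨b, hb, hb0⟩ := (hev.and (Filter.eventually_gt_atTop 0)).exists
  have hev2 : ∀ᶠ h : ℝ in nhdsWithin 0 (Set.Ioi 0), ∀ i, (∑ l, |coord l (twistVec A i)|) *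
      (2 ^ T * (2 ^ T * h)) ≤ N ^ (-θ i) / Real.exp 1 / 2 := by
    refine Filter.eventually_all.2 fun i => Filter.Eventually.filter_mono nhdsWithin_le_nhds ?_
    have h1 : Filter.Tendsto (fun h : ℝ => (∑ l, |coord l (twistVec A i)|) *
      (2 ^ T * (2 ^ T * h))) (nhds 0)
        (nhds ((∑ l, |coord l (twistVec A i)|) * (2 ^ T * (2 ^ T * 0)))) :=
      ((Filter.tendsto_id.const_mul _).const_mul _).const_mul _
    rw [mul_zero, mul_zero, mul_zero] at h1
    exact (h1.eventually (gt_mem_nhds (hc i))).mono fun x hx => le_of_lt hx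
  obtain ⟨η, hη, hη0⟩ := (hev2.and self_mem_nhdsWithin).exists
  refine ⟨η, hη0, b + 1, by linarith, fun h hh hhη => ?_⟩
  refine exists_expAD_symbolBound hτ hT hθ hτθ hA hh hb0 (by linarith) ha'.le fun i => ?_
  have hθi := hθ i
  have hv : 0 ≤ ∑ l, |coord l (twistVec A i)| := Finset.sum_nonneg fun l _ => abs_nonneg _
  have hκ := twistScale_pos A hθ hb0 (show 0 ≤ 2 ^ T * (2 ^ T * h) by positivity) i
  have h1 : twistScale A θ b (2 ^ T * (2 ^ T * h)) i * Real.exp 1 ≤ N ^ (-θ i) := by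
    have h2 : twistScale A θ b (2 ^ T * (2 ^ T * h)) i ≤ N ^ (-θ i) / Real.exp 1 := by
      unfold twistScale
      have h3 : (∑ l, |coord l (twistVec A i)|) * (2 ^ T * (2 ^ T * h)) ≤
          (∑ l, |coord l (twistVec A i)|) * (2 ^ T * (2 ^ T * η)) := by gcongr
      linarith [hb i, hη i]
    rwa [le_div_iff₀ (Real.exp_pos 1)] at h2
  have h4 : N ≤ (twistScale A θ b (2 ^ T * (2 ^ T * h)) i * Real.exp 1) ^ (-(1 / θ i)) := by
    have h5 := Real.rpow_le_rpow_of_nonpos (by positivity) h1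
      (show -(1 / θ i) ≤ 0 by simp only [one_div, Left.neg_nonpos_iff, inv_nonneg]; exact hθi.le)
    rw [← Real.rpow_mul hN0.le] at h5
    have h6 : -θ i * -(1 / θ i) = 1 := by field_simp
    rwa [h6, Real.rpow_one] at h5
  linarith

end Operator

/-! ## Comparison with the norms of the symbol classes and of the Gelfand–Shilov spaces -/

section Comparison

open SmoothFun

variable {d : ℕ}

/-- The exponents with value `s` on the first and `σ` on the second block of coordinates. -/
def blockExp (d : ℕ) (s σ : ℝ) : Fin d ⊕ Fin d → ℝ := Sum.elim (fun _ => s) fun _ => σ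

lemma blockExp_pos {s σ : ℝ} (hs : 0 < s) (hσ : 0 < σ) (i : Fin d ⊕ Fin d) :
    0 < blockExp d s σ i := by
  cases i <;> assumption

lemma blockExp_le_add {s σ : ℝ} (hs : 0 < s) (hσ : 0 < σ) (i : Fin d ⊕ Fin d) :
    blockExp d s σ i ≤ s + σ := by
  cases i <;> simp [blockExp] <;> linarith

lemma blockExp_add (s σ : ℝ) (i : Fin d ⊕ Fin d) :
    blockExp d σ s i + blockExp d s σ i = s + σ := by
  cases i <;> simp [blockExp, add_comm]

/-- Here the pairing of exponents is used: the regularity exponent of one block is the growth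
exponent of the other, and `twistVec` always points into the other block. -/
lemma twistVec_blockExp (A : Matrix (Fin d) (Fin d) ℝ) (s σ : ℝ) (i l : Fin d ⊕ Fin d) :
    coord l (twistVec A i) = 0 ∨ blockExp d σ s l = blockExp d s σ i := by
  cases i <;> cases l <;> first | exact Or.inl rfl | exact Or.inr rfl

lemma wt_blockExp (s σ h : ℝ) (γ : Fin d ⊕ Fin d → ℕ) :
    wt (blockExp d σ s) h γ = h ^ (multiLength (fun i => γ (Sum.inl i)) +
      multiLength (fun i => γ (Sum.inr i))) * multiFactorial (fun i => γ (Sum.inl i)) ^ σ *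
        multiFactorial (fun i => γ (Sum.inr i)) ^ s := by
  unfold wt
  rw [Fintype.prod_sum_type, Finset.prod_mul_distrib, Finset.prod_mul_distrib, pow_add]
  simp only [multiLength, multiFactorial, blockExp, Sum.elim_inl, Sum.elim_inr, Nat.cast_prod]
  rw [Real.finsetProd_rpow _ _ (fun i _ => Nat.cast_nonneg _),
    Real.finsetProd_rpow _ _ (fun i _ => Nat.cast_nonneg _), Finset.prod_pow_eq_pow_sum,
    Finset.prod_pow_eq_pow_sum]
  ring

lemma scaledSeminorm_le_iff {E : Type*} [AddCommGroup E] [Module ℂ E] (Λ : E →ₗ[ℂ] ℂ) {w : ℝ}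
    (hw : 0 < w) (f : E) (N : ℝ) : scaledSeminorm Λ w f ≤ N ↔ ‖Λ f‖ ≤ N * w := by
  change ‖Λ f‖ / |w| ≤ N ↔ _
  rw [abs_of_pos hw, div_le_iff₀ hw]

section Abstract

variable {ι E : Type*} [AddCommGroup E] [Module ℂ E] (q : ι → Seminorm ℂ E)

lemma mem_boundedSubspace_of_le {f : E} {M : ℝ} (h : ∀ i, q i f ≤ M) : f ∈ boundedSubspace q :=
  ⟨M, by rintro _ ⟨i, rfl⟩; exact h i⟩

lemma supSeminorm_le {f : boundedSubspace q} {M : ℝ} (hM : 0 ≤ M) (h : ∀ i, q i f ≤ M) :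
    supSeminorm q f ≤ M := Real.iSup_le h hM

lemma le_supSeminorm (f : boundedSubspace q) (i : ι) : q i f ≤ supSeminorm q f :=
  le_ciSup f.2 i

end Abstract

/-- A constant comparing `∑ |z_i|^{1/θ_i}` with `|x|^{1/s} + |ξ|^{1/σ}`. -/
def radialConst (d : ℕ) (s σ : ℝ) : ℝ := 1 + d + (d : ℝ) ^ (1 / s) + (d : ℝ) ^ (1 / σ)

lemma radialConst_pos (d : ℕ) (s σ : ℝ) : 0 < radialConst d s σ := by
  unfold radialConst; positivity

lemma sum_abs_rpow_le {s : ℝ} (hs : 0 < s) (x : EuclideanSpace ℝ (Fin d)) :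
    ∑ i, |x i| ^ (1 / s) ≤ d * ‖x‖ ^ (1 / s) := by
  refine (Finset.sum_le_card_nsmul _ _ (‖x‖ ^ (1 / s)) fun i _ => ?_).trans (by simp)
  exact Real.rpow_le_rpow (abs_nonneg _) (by simpa using PiLp.norm_apply_le x i) (by positivity)

lemma norm_rpow_le_sum {s : ℝ} (hs : 0 < s) (x : EuclideanSpace ℝ (Fin d)) :
    ‖x‖ ^ (1 / s) ≤ (d : ℝ) ^ (1 / s) * ∑ i, |x i| ^ (1 / s) := by
  rcases isEmpty_or_nonempty (Fin d) with he | hne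
  · have : x = 0 := Subsingleton.elim _ _
    rw [this, norm_zero, Real.zero_rpow (by positivity)]
    exact mul_nonneg (by positivity) (Finset.sum_nonneg fun i _ => by positivity)
  obtain ⟨i, -, hi⟩ := Finset.exists_max_image Finset.univ (fun i => |x i|) Finset.univ_nonempty
  have h1 : ‖x‖ ≤ d * |x i| := by
    have h2 : ‖x‖ ≤ ∑ i, |x i| := by
      have h3 : x = ∑ i, EuclideanSpace.single i (x i) := by
        ext j; simp [Pi.single_apply]
      calc ‖x‖ = ‖∑ i, EuclideanSpace.single i (x i)‖ := by rw [← h3]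
        _ ≤ ∑ i, ‖EuclideanSpace.single i (x i)‖ := norm_sum_le _ _
        _ = _ := by simp
    refine h2.trans ((Finset.sum_le_card_nsmul _ _ _ fun l hl => hi l hl).trans (by simp))
  calc ‖x‖ ^ (1 / s) ≤ (d * |x i|) ^ (1 / s) := Real.rpow_le_rpow (norm_nonneg _) h1 (by positivity)
    _ = (d : ℝ) ^ (1 / s) * |x i| ^ (1 / s) := Real.mul_rpow (by positivity) (abs_nonneg _)
    _ ≤ _ := by
      gcongr
      exact Finset.single_le_sum (f := fun i => |x i| ^ (1 / s)) (fun i _ => by positivity)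
        (Finset.mem_univ i)

lemma grow_blockExp (s σ : ℝ) (z : PhaseSpace d d) : grow (blockExp d s σ) z =
    ∑ i, |z.fst i| ^ (1 / s) + ∑ i, |z.snd i| ^ (1 / σ) := by
  simp [grow, blockExp, coord_inl, coord_inr]

lemma grow_le_radial {s σ : ℝ} (hs : 0 < s) (hσ : 0 < σ) (z : PhaseSpace d d) :
    grow (blockExp d s σ) z ≤
      radialConst d s σ * (‖z.fst‖ ^ (1 / s) + ‖z.snd‖ ^ (1 / σ)) := by
  rw [grow_blockExp]
  have h1 : (d : ℝ) ≤ radialConst d s σ := by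
    unfold radialConst
    have : 0 ≤ (d : ℝ) ^ (1 / s) + (d : ℝ) ^ (1 / σ) := by positivity
    linarith
  calc _ ≤ d * ‖z.fst‖ ^ (1 / s) + d * ‖z.snd‖ ^ (1 / σ) :=
        add_le_add (sum_abs_rpow_le hs _) (sum_abs_rpow_le hσ _)
    _ = d * (‖z.fst‖ ^ (1 / s) + ‖z.snd‖ ^ (1 / σ)) := by ring
    _ ≤ _ := by gcongr

lemma radial_le_grow {s σ : ℝ} (hs : 0 < s) (hσ : 0 < σ) (z : PhaseSpace d d) :
    ‖z.fst‖ ^ (1 / s) + ‖z.snd‖ ^ (1 / σ) ≤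
      radialConst d s σ * grow (blockExp d s σ) z := by
  rw [grow_blockExp, mul_add]
  have h0 : 0 ≤ (d : ℝ) ^ (1 / s) := by positivity
  have h0' : 0 ≤ (d : ℝ) ^ (1 / σ) := by positivity
  have h0'' : (0 : ℝ) ≤ d := by positivity
  refine add_le_add ((norm_rpow_le_sum hs _).trans ?_) ((norm_rpow_le_sum hσ _).trans ?_)
  · refine mul_le_mul_of_nonneg_right ?_ (Finset.sum_nonneg fun i _ => by positivity)
    unfold radialConst; linarith
  · refine mul_le_mul_of_nonneg_right ?_ (Finset.sum_nonneg fun i _ => by positivity)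
    unfold radialConst; linarith

lemma symbolSeminorms_le_iff {s σ h : ℝ} (hh : 0 < h) (r : ℝ) (f : SmoothFun d d) (N : ℝ) :
    (∀ i, symbolSeminorms d d s σ σ s h r i f ≤ N) ↔ ∀ γ z, ‖mder γ f z‖ ≤
      N * wt (blockExp d σ s) h γ *
        Real.exp (r * (‖z.fst‖ ^ (1 / s) + ‖z.snd‖ ^ (1 / σ))) := by
  have key : ∀ γ z, symbolSeminorms d d s σ σ s h r
      (fun i => γ (Sum.inl i), fun i => γ (Sum.inr i), z) f ≤ N ↔ ‖mder γ f z‖ ≤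
      N * wt (blockExp d σ s) h γ *
        Real.exp (r * (‖z.fst‖ ^ (1 / s) + ‖z.snd‖ ^ (1 / σ))) := by
    intro γ z
    have hw : 0 < symbolWeight d d s σ σ s h r (fun i => γ (Sum.inl i))
        (fun i => γ (Sum.inr i)) z := by
      unfold symbolWeight
      have := multiFactorial_pos (fun i => γ (Sum.inl i))
      have := multiFactorial_pos (fun i => γ (Sum.inr i))
      positivity
    refine (scaledSeminorm_le_iff _ hw f N).trans ?_
    rw [symbolWeight, ← wt_blockExp, ← mul_assoc]
    rfl
  constructor
  · exact fun H γ z => (key γ z).1 (H _)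
  · rintro H ⟨α, β, z⟩
    exact (key (Sum.elim α β) z).2 (H (Sum.elim α β) z)

lemma symbolBound_of_symbolSeminorms {s σ h r N : ℝ} (hs : 0 < s) (hσ : 0 < σ) (hh : 0 < h)
    (hr : 0 ≤ r) {f : SmoothFun d d} (hf : ∀ i, symbolSeminorms d d s σ σ s h r i f ≤ N) :
    SymbolBound (blockExp d σ s) (blockExp d s σ) h (radialConst d s σ * r) N f := by
  intro γ z
  have h1 := (symbolSeminorms_le_iff hh r f N).1 hf
  have hN : 0 ≤ N := by
    have := (norm_nonneg _).trans (h1 0 0)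
    rw [wt_zero, mul_one] at this
    exact nonneg_of_mul_nonneg_left this (Real.exp_pos _)
  refine (h1 γ z).trans ?_
  have h2 := wt_nonneg (τ := blockExp d σ s) hh.le γ
  have h3 := radial_le_grow hs hσ z
  gcongr ?_ * ?_
  refine Real.exp_le_exp.2 ?_
  calc r * (‖z.fst‖ ^ (1 / s) + ‖z.snd‖ ^ (1 / σ)) ≤
      r * (radialConst d s σ * grow (blockExp d s σ) z) := by gcongr
    _ = _ := by ring

lemma SymbolBound.symbolSeminorms_le {s σ h r N : ℝ} (hs : 0 < s) (hσ : 0 < σ) (hh : 0 < h)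
    (hr : 0 ≤ r) {f : SmoothFun d d}
    (hf : SymbolBound (blockExp d σ s) (blockExp d s σ) h r N f)
    (i : (Fin d → ℕ) × (Fin d → ℕ) × PhaseSpace d d) :
    symbolSeminorms d d s σ σ s h (radialConst d s σ * r) i f ≤ N := by
  refine (symbolSeminorms_le_iff hh _ f N).2 (fun γ z => (hf γ z).trans ?_) i
  have h2 := wt_nonneg (τ := blockExp d σ s) hh.le γ
  have hN := hf.nonneg
  have h3 := grow_le_radial hs hσ z
  gcongr ?_ * ?_
  refine Real.exp_le_exp.2 ?_
  calc _ ≤ r * (radialConst d s σ * (‖z.fst‖ ^ (1 / s) + ‖z.snd‖ ^ (1 / σ))) := by gcongr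
    _ = _ := by ring

lemma gsSeminorms_le_iff {s σ h : ℝ} (hh : 0 < h) (u : 𝓢(PhaseSpace d d, ℂ)) (N : ℝ) :
    (∀ i, gsSeminorms d d s σ σ s h i u ≤ N) ↔ ∀ (α γ : Fin d ⊕ Fin d → ℕ) z,
      (∏ i, |coord i z| ^ α i) * ‖mder γ (ofSchwartz u) z‖ ≤
        N * (wt (blockExp d s σ) h α * wt (blockExp d σ s) h γ) := by
  have key : ∀ (α γ : Fin d ⊕ Fin d → ℕ) z, gsSeminorms d d s σ σ s h
      ((fun i => α (Sum.inl i), fun i => α (Sum.inr i)),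
        (fun i => γ (Sum.inl i), fun i => γ (Sum.inr i)), z) u ≤ N ↔
      (∏ i, |coord i z| ^ α i) * ‖mder γ (ofSchwartz u) z‖ ≤
        N * (wt (blockExp d s σ) h α * wt (blockExp d σ s) h γ) := by
    intro α γ z
    set i : GSIndex d d := ((fun i => α (Sum.inl i), fun i => α (Sum.inr i)),
        (fun i => γ (Sum.inl i), fun i => γ (Sum.inr i)), z) with hi
    have hwe : gsWeight d d s σ σ s h i =
        wt (blockExp d s σ) h α * wt (blockExp d σ s) h γ := by
      rw [wt_blockExp, wt_blockExp, gsWeight, pow_add, pow_add, pow_add, pow_add, hi]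
      ring
    have hw : 0 < gsWeight d d s σ σ s h i := by
      rw [hwe]; exact mul_pos (wt_pos hh _) (wt_pos hh _)
    refine (scaledSeminorm_le_iff _ hw u N).trans ?_
    rw [hwe]
    have : ‖gsForm d d i u‖ = (∏ i, |coord i z| ^ α i) * ‖mder γ (ofSchwartz u) z‖ := by
      change ‖((multiPow z.fst (fun i => α (Sum.inl i)) *
        multiPow z.snd (fun i => α (Sum.inr i)) : ℝ) : ℂ) • mder γ (ofSchwartz u) z‖ = _
      rw [norm_smul, Complex.norm_real, Real.norm_eq_abs, abs_mul, multiPow, multiPow,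
        Finset.abs_prod, Finset.abs_prod, Fintype.prod_sum_type]
      simp only [abs_pow, coord_inl, coord_inr]
    rw [this]
  constructor
  · exact fun H α γ z => (key α γ z).1 (H _)
  · rintro H ⟨⟨α, α'⟩, ⟨β, β'⟩, z⟩
    exact (key (Sum.elim α α') (Sum.elim β β') z).2 (H _ _ z)

/-- The bound holds for every monomial, so the exponent may be optimized in each coordinate
separately at the given point z. Each optimization costs a factor e, which explains the power of e
in the constant. -/
lemma symbolBound_of_gsSeminorms {s σ h a N : ℝ} (hs : 0 < s) (hσ : 0 < σ) (hh : 0 < h)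
    (ha : ∀ i, a ≤ (h * Real.exp 1) ^ (-(1 / blockExp d s σ i)))
    {u : 𝓢(PhaseSpace d d, ℂ)} (hu : ∀ i, gsSeminorms d d s σ σ s h i u ≤ N) :
    SymbolBound (blockExp d σ s) (blockExp d s σ) h (-a)
      (Real.exp 1 ^ Fintype.card (Fin d ⊕ Fin d) * N) (ofSchwartz u) := by
  intro γ z
  have h1 := (gsSeminorms_le_iff hh u N).1 hu
  have hN : 0 ≤ N := by
    have := h1 0 0 0
    rw [wt_zero, wt_zero] at this
    simp at this
    exact (norm_nonneg _).trans this
  choose n hn using fun i : Fin d ⊕ Fin d => exists_pow_factorial_le (abs_nonneg (coord i z)) hh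
    (blockExp_pos hs hσ i)
  have hP : wt (blockExp d s σ) h n ≤ Real.exp 1 ^ Fintype.card (Fin d ⊕ Fin d) *
      Real.exp (-a * grow (blockExp d s σ) z) * ∏ i, |coord i z| ^ n i := by
    have h2 : wt (blockExp d s σ) h n ≤ ∏ i, (Real.exp 1 *
        Real.exp (-a * |coord i z| ^ (1 / blockExp d s σ i)) * |coord i z| ^ n i) := by
      refine Finset.prod_le_prod (fun i _ => by positivity) fun i _ => (hn i).trans ?_
      have h3 : 0 ≤ |coord i z| ^ (1 / blockExp d s σ i) := by positivity
      gcongr ?_ * ?_ * ?_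
      refine Real.exp_le_exp.2 ?_
      nlinarith [mul_le_mul_of_nonneg_right (ha i) h3]
    refine h2.trans (le_of_eq ?_)
    rw [Finset.prod_mul_distrib, Finset.prod_mul_distrib, Finset.prod_const, ← Real.exp_sum,
      ← Finset.mul_sum]
    rfl
  -- The chosen monomial cannot vanish, since it dominates a positive weight; this also covers
  -- points on coordinate hyperplanes.
  have hpos : 0 < ∏ i, |coord i z| ^ n i := by
    have h4 := (wt_pos (τ := blockExp d s σ) hh n).trans_le hP
    exact pos_of_mul_pos_right h4 (by positivity)
  refine le_of_mul_le_mul_left ?_ hpos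
  have hw := wt_nonneg (τ := blockExp d σ s) hh.le γ
  calc _ ≤ N * (wt (blockExp d s σ) h n * wt (blockExp d σ s) h γ) := h1 n γ z
    _ ≤ N * ((Real.exp 1 ^ Fintype.card (Fin d ⊕ Fin d) *
      Real.exp (-a * grow (blockExp d s σ) z) * ∏ i, |coord i z| ^ n i) *
        wt (blockExp d σ s) h γ) := by gcongr
    _ = _ := by ring

/-- Conversely, `pow_le_exp_rpow` in each coordinate spends the decay a to bound the monomial; `hah`
says that h' is large enough for this. -/
lemma SymbolBound.gsSeminorms_le {s σ h a h' M : ℝ} (hs : 0 < s) (hσ : 0 < σ) (hh : 0 ≤ h)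
    (hh' : 0 < h') (hle : h ≤ h') (ha : 0 < a)
    (hah : ∀ i, (blockExp d s σ i / a) ^ blockExp d s σ i ≤ h') {u : 𝓢(PhaseSpace d d, ℂ)}
    (hu : SymbolBound (blockExp d σ s) (blockExp d s σ) h (-a) M (ofSchwartz u))
    (i : GSIndex d d) : gsSeminorms d d s σ σ s h' i u ≤ M := by
  refine (gsSeminorms_le_iff hh' u M).2 (fun α γ z => ?_) i
  have hM := hu.nonneg
  have h1 : ∏ i, |coord i z| ^ α i ≤ wt (blockExp d s σ) h' α *
      Real.exp (a * grow (blockExp d s σ) z) := by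
    have h2 : ∏ i, |coord i z| ^ α i ≤ ∏ i, ((h' ^ α i * ((α i)! : ℝ) ^ blockExp d s σ i) *
        Real.exp (a * |coord i z| ^ (1 / blockExp d s σ i))) := by
      refine Finset.prod_le_prod (fun i _ => by positivity) fun i _ => ?_
      have hp := blockExp_pos hs hσ i
      refine (pow_le_exp_rpow (abs_nonneg _) ha hp (α i)).trans ?_
      gcongr
      exact hah i
    refine h2.trans (le_of_eq ?_)
    rw [Finset.prod_mul_distrib, ← Real.exp_sum, ← Finset.mul_sum]
    rfl
  have h3 := (hu.mono hh hle le_rfl le_rfl) γ z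
  have hw := wt_nonneg (τ := blockExp d σ s) hh'.le γ
  have hw' := wt_nonneg (τ := blockExp d s σ) hh'.le α
  calc _ ≤ (wt (blockExp d s σ) h' α * Real.exp (a * grow (blockExp d s σ) z)) *
        (M * wt (blockExp d σ s) h' γ * Real.exp (-a * grow (blockExp d s σ) z)) := by gcongr
    _ = M * (wt (blockExp d s σ) h' α * wt (blockExp d σ s) h' γ) *
      (Real.exp (a * grow (blockExp d s σ) z) * Real.exp (-a * grow (blockExp d s σ) z)) := by ring
    _ = _ := by rw [← Real.exp_add]; simp

/-- This and the three lemmas that follow form the dictionary between the scale h of Gelfand–Shilov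
norms and the decay rate a: in the Roumieu case any h allows some a and conversely, in the Beurling
case any prescribed quality on one side is reached by a suitable choice on the other. -/
lemma exists_gs_decay {s σ h : ℝ} (hh : 0 < h) :
    ∃ a : ℝ, 0 < a ∧ ∀ i, a ≤ (h * Real.exp 1) ^ (-(1 / blockExp d s σ i)) := by
  have hev : ∀ᶠ a : ℝ in nhdsWithin 0 (Set.Ioi 0), ∀ i,
      a ≤ (h * Real.exp 1) ^ (-(1 / blockExp d s σ i)) :=
    Filter.eventually_all.2 fun i => Filter.Eventually.filter_mono nhdsWithin_le_nhds
      (eventually_le_nhds (by positivity))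
  obtain ⟨a, h1, h2⟩ := (hev.and self_mem_nhdsWithin).exists
  exact ⟨a, h2, h1⟩

lemma exists_gs_scale {s σ : ℝ} (hs : 0 < s) (hσ : 0 < σ) (a : ℝ) {η : ℝ} (hη : 0 < η) :
    ∃ h : ℝ, 0 < h ∧ h ≤ η ∧ ∀ i, a ≤ (h * Real.exp 1) ^ (-(1 / blockExp d s σ i)) := by
  have hev : ∀ᶠ h : ℝ in nhdsWithin 0 (Set.Ioi 0), ∀ i,
      a ≤ (h * Real.exp 1) ^ (-(1 / blockExp d s σ i)) := by
    refine Filter.eventually_all.2 fun i => ?_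
    have hp := blockExp_pos hs hσ i
    have h1 : Filter.Tendsto (fun h : ℝ => h * Real.exp 1) (nhdsWithin 0 (Set.Ioi 0))
        (nhdsWithin 0 (Set.Ioi 0)) := by
      refine tendsto_nhdsWithin_iff.2 ⟨?_, ?_⟩
      · have := (Filter.tendsto_id (α := ℝ) (x := nhds 0)).mul_const (Real.exp 1)
        rw [zero_mul] at this
        exact this.mono_left nhdsWithin_le_nhds
      · filter_upwards [self_mem_nhdsWithin] with h hh
        exact mul_pos hh (Real.exp_pos 1)
    have h2 := (tendsto_rpow_neg_nhdsGT_zero (y := -(1 / blockExp d s σ i))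
      (by simpa using hp)).comp h1
    exact h2.eventually (Filter.eventually_ge_atTop a)
  obtain ⟨h, ⟨h1, h2⟩, h3⟩ := ((hev.and (Filter.Eventually.filter_mono nhdsWithin_le_nhds
    (eventually_le_nhds hη))).and self_mem_nhdsWithin).exists
  exact ⟨h, h3, h2, h1⟩

lemma exists_gs_scale_of_decay (s σ h a : ℝ) :
    ∃ h' : ℝ, 0 < h' ∧ h ≤ h' ∧ ∀ i, (blockExp d s σ i / a) ^ blockExp d s σ i ≤ h' := by
  have hev : ∀ᶠ h' : ℝ in Filter.atTop, ∀ i,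
      (blockExp d s σ i / a) ^ blockExp d s σ i ≤ h' :=
    Filter.eventually_all.2 fun i => Filter.eventually_ge_atTop _
  obtain ⟨h', ⟨h1, h2⟩, h3⟩ := ((hev.and (Filter.eventually_ge_atTop h)).and
    (Filter.eventually_gt_atTop 0)).exists
  exact ⟨h', h3, h2, h1⟩

lemma exists_decay_of_gs_scale {s σ h' : ℝ} (hs : 0 < s) (hσ : 0 < σ) (hh' : 0 < h') :
    ∃ a : ℝ, 0 < a ∧ ∀ i, (blockExp d s σ i / a) ^ blockExp d s σ i ≤ h' := by
  have hev : ∀ᶠ a : ℝ in Filter.atTop, ∀ i,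
      (blockExp d s σ i / a) ^ blockExp d s σ i ≤ h' := by
    refine Filter.eventually_all.2 fun i => ?_
    have hp := blockExp_pos hs hσ i
    have h1 : Filter.Tendsto (fun a : ℝ => (blockExp d s σ i / a) ^ blockExp d s σ i) Filter.atTop
        (nhds (0 ^ blockExp d s σ i)) :=
      (tendsto_const_nhds.div_atTop Filter.tendsto_id).rpow_const (Or.inr hp.le)
    rw [Real.zero_rpow hp.ne'] at h1
    exact (h1.eventually (gt_mem_nhds hh')).mono fun x hx => le_of_lt hx
  obtain ⟨a, h1, h2⟩ := (hev.and (Filter.eventually_gt_atTop 0)).exists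
  exact ⟨a, h2, h1⟩

lemma mem_GSRoumieu_iff {s σ : ℝ} (hs : 0 < s) (hσ : 0 < σ) (u : 𝓢(PhaseSpace d d, ℂ)) :
    u ∈ GSRoumieu d d s σ σ s ↔ ∃ h a M : ℝ, 0 < h ∧ 0 < a ∧
      SymbolBound (blockExp d σ s) (blockExp d s σ) h (-a) M (ofSchwartz u) := by
  constructor
  · rintro ⟨h, hu⟩
    obtain ⟨a, ha, ha'⟩ := exists_gs_decay (d := d) (s := s) (σ := σ) h.2
    exact ⟨h, a, _, h.2, ha, symbolBound_of_gsSeminorms hs hσ h.2 ha'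
      fun i => le_supSeminorm _ ⟨u, hu⟩ i⟩
  · rintro ⟨h, a, M, hh, ha, hu⟩
    obtain ⟨h', h1, h2, h3⟩ := exists_gs_scale_of_decay (d := d) s σ h a
    exact ⟨⟨h', h1⟩, mem_boundedSubspace_of_le _ (hu.gsSeminorms_le hs hσ hh.le h1 h2 ha h3)⟩

lemma mem_GSBeurling_iff {s σ : ℝ} (hs : 0 < s) (hσ : 0 < σ) (u : 𝓢(PhaseSpace d d, ℂ)) :
    u ∈ GSBeurling d d s σ σ s ↔ ∀ h a : ℝ, 0 < h → 0 < a → ∃ M : ℝ,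
      SymbolBound (blockExp d σ s) (blockExp d s σ) h (-a) M (ofSchwartz u) := by
  constructor
  · intro hu h a hh ha
    obtain ⟨h', h1, h2, h3⟩ := exists_gs_scale (d := d) hs hσ a hh
    have hu' := (Submodule.mem_iInf _).1 hu ⟨h', h1⟩
    exact ⟨_, (symbolBound_of_gsSeminorms hs hσ h1 h3
      fun i => le_supSeminorm _ ⟨u, hu'⟩ i).mono h1.le h2 le_rfl le_rfl⟩
  · intro H
    refine (Submodule.mem_iInf _).2 fun h => ?_
    obtain ⟨a, ha, ha'⟩ := exists_decay_of_gs_scale (d := d) hs hσ h.2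
    obtain ⟨M, hM⟩ := H h a h.2 ha
    exact mem_boundedSubspace_of_le _ (hM.gsSeminorms_le hs hσ h.2.le h.2 le_rfl ha ha')

variable (A : Matrix (Fin d) (Fin d) ℝ)

lemma exists_gsSeminorms_expAD_le_roumieu {s σ h : ℝ} (hs : 0 < s) (hσ : 0 < σ)
    (hsσ : 1 ≤ s + σ) (hh : 0 < h) : ∃ h' : ℝ, 0 < h' ∧ ∃ C : ℝ, 0 ≤ C ∧
      ∀ (u : 𝓢(PhaseSpace d d, ℂ)) (N : ℝ), (∀ i, gsSeminorms d d s σ σ s h i u ≤ N) →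
        ∀ i, gsSeminorms d d s σ σ s h' i (expAD A u) ≤ C * N := by
  obtain ⟨a, ha, ha'⟩ := exists_gs_decay (d := d) (s := s) (σ := σ) hh
  obtain ⟨b, hb, C, hC, H⟩ := exists_expAD_symbolBound_roumieu (A := A)
    (fun i => (blockExp_pos hσ hs i).le) (blockExp_le_add hσ hs) (blockExp_pos hs hσ)
    (fun i => hsσ.trans_eq (blockExp_add s σ i).symm) (twistVec_blockExp A s σ) hh.le ha
  obtain ⟨h', h1, h2, h3⟩ := exists_gs_scale_of_decay (d := d) s σ (2 ^ (σ + s) * h) b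
  refine ⟨h', h1, C * Real.exp 1 ^ Fintype.card (Fin d ⊕ Fin d), by positivity, fun u N hu => ?_⟩
  rw [mul_assoc]
  exact (H u _ (symbolBound_of_gsSeminorms hs hσ hh ha' hu)).gsSeminorms_le hs hσ (by positivity)
    h1 h2 hb h3

lemma exists_gsSeminorms_expAD_le_beurling {s σ h' : ℝ} (hs : 0 < s) (hσ : 0 < σ)
    (hsσ : 1 ≤ s + σ) (hh' : 0 < h') : ∃ h : ℝ, 0 < h ∧ ∃ C : ℝ, 0 ≤ C ∧
      ∀ (u : 𝓢(PhaseSpace d d, ℂ)) (N : ℝ), (∀ i, gsSeminorms d d s σ σ s h i u ≤ N) →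
        ∀ i, gsSeminorms d d s σ σ s h' i (expAD A u) ≤ C * N := by
  obtain ⟨b, hb, hb'⟩ := exists_decay_of_gs_scale (d := d) hs hσ hh'
  obtain ⟨η, hη, a, ha, H⟩ := exists_expAD_symbolBound_beurling (A := A)
    (fun i => (blockExp_pos hσ hs i).le) (blockExp_le_add hσ hs) (blockExp_pos hs hσ)
    (fun i => hsσ.trans_eq (blockExp_add s σ i).symm) (twistVec_blockExp A s σ) hb
  obtain ⟨h, h1, h2, h3⟩ := exists_gs_scale (d := d) hs hσ a
    (lt_min hη (show 0 < h' / 2 ^ (σ + s) by positivity))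
  obtain ⟨C, hC, H'⟩ := H h h1.le (h2.trans (min_le_left _ _))
  have h4 : 2 ^ (σ + s) * h ≤ h' := by
    have := h2.trans (min_le_right _ _)
    rwa [le_div_iff₀' (by positivity)] at this
  refine ⟨h, h1, C * Real.exp 1 ^ Fintype.card (Fin d ⊕ Fin d), by positivity, fun u N hu => ?_⟩
  rw [mul_assoc]
  exact (H' u _ (symbolBound_of_gsSeminorms hs hσ h1 h3 hu)).gsSeminorms_le hs hσ (by positivity)
    hh' h4 hb hb'

end Comparison

/-! ## Integrals of products -/

section Integrals

open SmoothFun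

variable {d : ℕ} {τ θ : Fin d ⊕ Fin d → ℝ}

/-- The exponential beats (1 + ‖z‖)^k for k one larger than the dimension. -/
lemma integrable_exp_neg_grow (hθ : ∀ i, 0 < θ i) {a : ℝ} (ha : 0 < a) :
    Integrable fun z : PhaseSpace d d => Real.exp (-a * grow θ z) := by
  set k := Module.finrank ℝ (PhaseSpace d d) + 1 with hk
  obtain ⟨C, hC0, hC⟩ := exists_norm_pow_le (d := d) hθ ha k
  obtain ⟨C', hC0', hC'⟩ := exists_norm_pow_le (d := d) hθ ha 0
  have h1 : Integrable fun z : PhaseSpace d d => (1 + ‖z‖) ^ (-(k : ℝ)) :=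
    integrable_one_add_norm (by rw [hk]; push_cast; linarith)
  refine (h1.const_mul (2 ^ k * (C + 1))).mono'
    ((Real.continuous_exp.comp ((continuous_grow hθ).const_mul (-a))).aestronglyMeasurable)
    (Filter.Eventually.of_forall fun z => ?_)
  have hpos : 0 < 1 + ‖z‖ := by positivity
  have hg := grow_nonneg θ z
  rw [Real.norm_eq_abs, abs_of_pos (Real.exp_pos _), Real.rpow_neg hpos.le, Real.rpow_natCast,
    ← div_eq_mul_inv, le_div_iff₀ (by positivity)]
  have h2 : (1 + ‖z‖) ^ k ≤ 2 ^ k * (1 + ‖z‖ ^ k) := by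
    rcases le_total 1 ‖z‖ with h | h
    · calc (1 + ‖z‖) ^ k ≤ (2 * ‖z‖) ^ k := by gcongr; linarith
        _ = 2 ^ k * ‖z‖ ^ k := mul_pow _ _ _
        _ ≤ _ := by gcongr; linarith
    · calc (1 + ‖z‖) ^ k ≤ 2 ^ k := by gcongr; linarith
        _ ≤ _ := le_mul_of_one_le_right (by positivity) (by linarith [pow_nonneg (norm_nonneg z) k])
  have h3 : 1 ≤ Real.exp (a * grow θ z) := Real.one_le_exp (by positivity)
  calc Real.exp (-a * grow θ z) * (1 + ‖z‖) ^ k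
      ≤ Real.exp (-a * grow θ z) * (2 ^ k * (Real.exp (a * grow θ z) +
        C * Real.exp (a * grow θ z))) := by
          gcongr
          exact h2.trans (by gcongr; exact hC z)
    _ = 2 ^ k * (C + 1) * (Real.exp (-a * grow θ z) * Real.exp (a * grow θ z)) := by ring
    _ = _ := by rw [← Real.exp_add]; simp

lemma integrable_of_growth (hθ : ∀ i, 0 < θ i) {a r K : ℝ} (hra : r < a)
    {f : PhaseSpace d d → ℂ} (hf : Continuous f)
    (hK : ∀ z, ‖f z‖ ≤ K * Real.exp (r * grow θ z - a * grow θ z)) :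
    Integrable f ∧ ‖∫ z, f z‖ ≤ K * ∫ z : PhaseSpace d d, Real.exp (-(a - r) * grow θ z) := by
  have h1 := (integrable_exp_neg_grow (d := d) hθ (sub_pos.2 hra)).const_mul K
  have h2 : ∀ᵐ z, ‖f z‖ ≤ K * Real.exp (-(a - r) * grow θ z) :=
    Filter.Eventually.of_forall fun z => (hK z).trans_eq (by congr 2; ring)
  refine ⟨h1.mono' hf.aestronglyMeasurable h2, ?_⟩
  rw [← integral_const_mul]
  exact norm_integral_le_of_norm_le h1 h2

lemma integrable_mul_of_growth (hθ : ∀ i, 0 < θ i) {a r K N : ℝ} (hra : r < a)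
    {f g : PhaseSpace d d → ℂ} (hf : Continuous f) (hg : Continuous g)
    (hK : ∀ z, ‖f z‖ ≤ K * Real.exp (r * grow θ z))
    (hN : ∀ z, ‖g z‖ ≤ N * Real.exp (-a * grow θ z)) :
    Integrable (fun z => f z * g z) ∧ ‖∫ z, f z * g z‖ ≤
      K * N * ∫ z : PhaseSpace d d, Real.exp (-(a - r) * grow θ z) := by
  refine integrable_of_growth hθ hra (hf.mul hg) fun z => ?_
  rw [norm_mul, sub_eq_add_neg, Real.exp_add]
  calc ‖f z‖ * ‖g z‖ ≤ (K * Real.exp (r * grow θ z)) * (N * Real.exp (-a * grow θ z)) :=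
        mul_le_mul (hK z) (hN z) (norm_nonneg _) ((norm_nonneg _).trans (hK z))
    _ = _ := by rw [neg_mul]; ring

end Integrals

/-! ## Entire functions of order `p` decaying like `exp (-|x|^p)` on the real axis -/

section Entire

open Filter

/-- An entire function `G ≥ 0` on `ℝ`, `G(0) = 1`, with
`|G(x + iy)| ≤ C exp (-a|x|^p + b|y|^p)`. -/
structure IsEntireWindow (p : ℝ) (G : ℂ → ℂ) : Prop where
  differentiable : Differentiable ℂ G
  nonneg : ∀ x : ℝ, ∃ r : ℝ, 0 ≤ r ∧ G x = r
  map_zero : G 0 = 1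
  bound : ∃ a b C : ℝ, 0 < a ∧ 0 ≤ b ∧ 0 ≤ C ∧
    ∀ z : ℂ, ‖G z‖ ≤ C * Real.exp (-a * |z.re| ^ p + b * |z.im| ^ p)

/-- It suffices to have the decay in a sector around the real axis away from the origin. -/
lemma exists_mixed_bound {p ε a b C : ℝ} (hp : 0 < p) (hε : 0 < ε) (ha : 0 < a) (hb : 0 ≤ b)
    (hC : 0 ≤ C) {G : ℂ → ℂ} (h1 : ∀ z : ℂ, ‖G z‖ ≤ C * Real.exp (b * |z.im| ^ p))
    (h2 : ∀ z : ℂ, 1 ≤ |z.re| → |z.im| ≤ ε * |z.re| →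
      ‖G z‖ ≤ C * Real.exp (-a * |z.re| ^ p + b * |z.im| ^ p)) :
    ∃ a b C : ℝ, 0 < a ∧ 0 ≤ b ∧ 0 ≤ C ∧
      ∀ z : ℂ, ‖G z‖ ≤ C * Real.exp (-a * |z.re| ^ p + b * |z.im| ^ p) := by
  -- Outside the sector |x|^p ≤ (1/ε)^p |y|^p, so the missing decay is charged to the growth in y.
  -- For |x| < 1 it is at most the constant factor e^a.
  refine ⟨a, b + a * (1 / ε) ^ p, C * Real.exp a, ha, by positivity, by positivity, fun z => ?_⟩
  have hy : 0 ≤ |z.im| ^ p := by positivity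
  have hx : 0 ≤ |z.re| ^ p := by positivity
  have he : 0 ≤ a * (1 / ε) ^ p * |z.im| ^ p := by positivity
  rw [mul_assoc, ← Real.exp_add]
  by_cases hx1 : 1 ≤ |z.re|
  · by_cases hyx : |z.im| ≤ ε * |z.re|
    · refine (h2 z hx1 hyx).trans (mul_le_mul_of_nonneg_left (Real.exp_le_exp.2 ?_) hC)
      linarith
    · refine (h1 z).trans ?_
      gcongr
      have h3 : |z.re| ^ p ≤ (1 / ε) ^ p * |z.im| ^ p := by
        rw [← Real.mul_rpow (by positivity) (abs_nonneg _)]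
        refine Real.rpow_le_rpow (abs_nonneg _) ?_ hp.le
        rw [one_div, inv_mul_eq_div, le_div_iff₀ hε]
        linarith
      have := mul_le_mul_of_nonneg_left h3 ha.le
      linarith
  · refine (h1 z).trans ?_
    gcongr
    have h3 : |z.re| ^ p ≤ 1 := Real.rpow_le_one (abs_nonneg _) (not_le.1 hx1).le hp.le
    have := mul_le_mul_of_nonneg_left h3 ha.le
    linarith

lemma isEntireWindow_gaussian : IsEntireWindow 2 fun z => Complex.exp (-z ^ 2) where
  differentiable := by fun_prop
  nonneg x := ⟨Real.exp (-x ^ 2), (Real.exp_pos _).le, by push_cast; rfl⟩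
  map_zero := by simp
  bound := by
    refine ⟨1, 1, 1, one_pos, zero_le_one, zero_le_one, fun z => le_of_eq ?_⟩
    rw [Complex.norm_exp, one_mul]
    congr 1
    simp [sq, Complex.mul_re]
    ring

/-- Since Re z² = x² - y² and Im z² = 2xy, decay in the real part wins in a thin sector around the
real axis, while outside it everything is bounded in terms of |y|. Orders above 2 are thereby
reached by doubling. -/
lemma IsEntireWindow.comp_sq {p : ℝ} (hp : 0 < p) {G : ℂ → ℂ} (hG : IsEntireWindow p G) :
    IsEntireWindow (2 * p) fun z => G (z ^ 2) where
  differentiable := hG.differentiable.comp (by fun_prop)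
  nonneg x := by
    obtain ⟨r, hr⟩ := hG.nonneg (x ^ 2)
    exact ⟨r, by rwa [Complex.ofReal_pow] at hr⟩
  map_zero := by simpa using hG.map_zero
  bound := by
    obtain ⟨a, b, C, ha, hb, hC, H⟩ := hG.bound
    have hsq : ∀ t : ℝ, |t| ^ (2 * p) = (t ^ 2) ^ p := fun t => by
      rw [← sq_abs, ← Real.rpow_natCast, ← Real.rpow_mul (abs_nonneg _)]; norm_num
    have hre : ∀ z : ℂ, (z ^ 2).re = z.re ^ 2 - z.im ^ 2 := fun z => by
      simp [sq, Complex.mul_re]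
    have him : ∀ z : ℂ, (z ^ 2).im = 2 * z.re * z.im := fun z => by
      simp [sq, Complex.mul_im]; ring
    -- choice of the opening of the sector
    have hev : ∀ᶠ ε : ℝ in nhdsWithin 0 (Set.Ioi 0), ε ≤ 1 / 2 ∧
        b * (2 * ε) ^ p ≤ a * (1 / 2) ^ p / 2 := by
      refine Filter.Eventually.filter_mono nhdsWithin_le_nhds
        (Filter.Eventually.and (eventually_le_nhds (by norm_num)) ?_)
      have h1 : Tendsto (fun ε : ℝ => b * (2 * ε) ^ p) (nhds 0) (nhds (b * (2 * 0) ^ p)) :=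
        ((Filter.tendsto_id.const_mul 2).rpow_const (Or.inr hp.le)).const_mul b
      rw [mul_zero, Real.zero_rpow hp.ne', mul_zero] at h1
      exact (h1.eventually (gt_mem_nhds (show 0 < a * (1 / 2) ^ p / 2 by positivity))).mono
        fun x hx => le_of_lt hx
    obtain ⟨ε, ⟨hε1, hε2⟩, hε0⟩ := (hev.and self_mem_nhdsWithin).exists
    have hε0 : 0 < ε := hε0
    -- the bound away from the sector, valid for all points with the large constant
    have hbd : ∀ z : ℂ, ‖G (z ^ 2)‖ ≤ C *
        Real.exp (b * (2 / ε) ^ p * |z.im| ^ (2 * p)) := by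
      intro z
      refine (H _).trans ?_
      gcongr
      rw [hsq, hre, him]
      have h0 : 0 ≤ |z.re ^ 2 - z.im ^ 2| ^ p := by positivity
      by_cases hyx : |z.im| ≤ ε * |z.re|
      · have h1 : b * |2 * z.re * z.im| ^ p ≤ a * |z.re ^ 2 - z.im ^ 2| ^ p := by
          have hx : (z.re ^ 2) * (1 / 2) ≤ |z.re ^ 2 - z.im ^ 2| := by
            refine le_trans ?_ (le_abs_self _)
            have : z.im ^ 2 ≤ (1 / 2 * |z.re|) ^ 2 := by
              rw [← sq_abs z.im]
              exact pow_le_pow_left₀ (abs_nonneg _) (hyx.trans (by gcongr)) 2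
            rw [mul_pow, sq_abs] at this
            nlinarith [sq_nonneg z.re]
          have hy : |2 * z.re * z.im| ≤ (2 * ε) * z.re ^ 2 := by
            rw [abs_mul, abs_mul, abs_two, ← sq_abs z.re]
            nlinarith [abs_nonneg z.re, mul_le_mul_of_nonneg_left hyx (abs_nonneg z.re)]
          calc b * |2 * z.re * z.im| ^ p ≤ b * ((2 * ε) * z.re ^ 2) ^ p := by gcongr
            _ = b * (2 * ε) ^ p * (z.re ^ 2) ^ p := by
              rw [Real.mul_rpow (by positivity) (by positivity)]; ring
            _ ≤ a * (1 / 2) ^ p / 2 * (z.re ^ 2) ^ p := by gcongr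
            _ ≤ a * (1 / 2) ^ p * (z.re ^ 2) ^ p := by
              have : 0 ≤ a * (1 / 2) ^ p * (z.re ^ 2) ^ p := by positivity
              linarith
            _ = a * (z.re ^ 2 * (1 / 2)) ^ p := by
              rw [Real.mul_rpow (by positivity) (by positivity)]; ring
            _ ≤ _ := by gcongr
        have h2 : 0 ≤ b * (2 / ε) ^ p * (z.im ^ 2) ^ p := by positivity
        linarith
      · have h1 : |2 * z.re * z.im| ≤ (2 / ε) * z.im ^ 2 := by
          rw [abs_mul, abs_mul, abs_two, ← sq_abs z.im, div_mul_eq_mul_div, le_div_iff₀ hε0]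
          nlinarith [abs_nonneg z.im, abs_nonneg z.re, not_le.1 hyx]
        have h2 : b * |2 * z.re * z.im| ^ p ≤ b * ((2 / ε) * z.im ^ 2) ^ p := by gcongr
        rw [Real.mul_rpow (by positivity) (by positivity), ← mul_assoc] at h2
        nlinarith
    refine exists_mixed_bound (p := 2 * p) (a := a * (1 / 2) ^ p / 2) (by positivity) hε0
      (by positivity) (by positivity) hC hbd fun z _ hyx => ?_
    refine (H _).trans (mul_le_mul_of_nonneg_left (Real.exp_le_exp.2 ?_) hC)
    rw [hsq, hsq, hre, him]
    have hx : (z.re ^ 2) * (1 / 2) ≤ |z.re ^ 2 - z.im ^ 2| := by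
      refine le_trans ?_ (le_abs_self _)
      have : z.im ^ 2 ≤ (1 / 2 * |z.re|) ^ 2 := by
        rw [← sq_abs z.im]
        exact pow_le_pow_left₀ (abs_nonneg _) (hyx.trans (by gcongr)) 2
      rw [mul_pow, sq_abs] at this
      nlinarith [sq_nonneg z.re]
    have hy : |2 * z.re * z.im| ≤ (2 * ε) * z.re ^ 2 := by
      rw [abs_mul, abs_mul, abs_two, ← sq_abs z.re]
      nlinarith [abs_nonneg z.re, mul_le_mul_of_nonneg_left hyx (abs_nonneg z.re)]
    have h1 : b * |2 * z.re * z.im| ^ p ≤ a * (1 / 2) ^ p / 2 * (z.re ^ 2) ^ p := by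
      calc b * |2 * z.re * z.im| ^ p ≤ b * ((2 * ε) * z.re ^ 2) ^ p := by gcongr
        _ = b * (2 * ε) ^ p * (z.re ^ 2) ^ p := by
          rw [Real.mul_rpow (by positivity) (by positivity)]; ring
        _ ≤ _ := by gcongr
    have h3 : a * (1 / 2) ^ p * (z.re ^ 2) ^ p ≤ a * |z.re ^ 2 - z.im ^ 2| ^ p := by
      calc a * (1 / 2) ^ p * (z.re ^ 2) ^ p = a * (z.re ^ 2 * (1 / 2)) ^ p := by
            rw [Real.mul_rpow (by positivity) (by positivity)]; ring
        _ ≤ _ := by gcongr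
    have h4 : 0 ≤ b * (2 / ε) ^ p * (z.im ^ 2) ^ p := by positivity
    linarith

/-! ### The product `∏ cos (z / 2^k)^(2 N_k)` with `N_k = ⌈2^(kp)⌉` -/

lemma norm_cos_sq (z : ℂ) : ‖Complex.cos z‖ ^ 2 = Real.cos z.re ^ 2 + Real.sinh z.im ^ 2 := by
  rw [Complex.cos_eq z, ← Complex.normSq_eq_norm_sq, Complex.normSq_apply]
  have h1 := Real.cosh_sq z.im
  have h2 := Real.sin_sq_add_cos_sq z.re
  simp [← Complex.ofReal_cos, ← Complex.ofReal_sin, ← Complex.ofReal_cosh, ← Complex.ofReal_sinh]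
  linear_combination Real.cos z.re ^ 2 * h1 + Real.sinh z.im ^ 2 * h2

/-- The linear bound serves large imaginary parts and the quadratic one small ones. Both are needed:
after scaling by 2^k and weighting by 2^(kp), the minimum sums to order |y|^p exactly when 1 < p <
2. -/
lemma norm_cos_sq_le (z : ℂ) : ‖Complex.cos z‖ ^ 2 ≤
    Real.exp (min (2 * |z.im|) (|z.im| ^ 2)) := by
  have h0 : ‖Complex.cos z‖ ^ 2 ≤ Real.cosh z.im ^ 2 := by
    rw [norm_cos_sq, Real.cosh_sq]
    nlinarith [Real.cos_sq_le_one z.re]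
  refine h0.trans ?_
  rw [← Real.cosh_abs]
  set y := |z.im|
  have hy : 0 ≤ y := abs_nonneg _
  have h1 : Real.cosh y ^ 2 ≤ Real.exp (2 * y) := by
    rw [two_mul, Real.exp_add, ← sq]
    refine pow_le_pow_left₀ (Real.cosh_pos y).le ?_ 2
    rw [Real.cosh_eq]
    have : Real.exp (-y) ≤ Real.exp y := Real.exp_le_exp.2 (by linarith)
    linarith
  have h2 : Real.cosh y ^ 2 ≤ Real.exp (y ^ 2) := by
    refine (pow_le_pow_left₀ (Real.cosh_pos y).le (Real.cosh_le_exp_half_sq y) 2).trans ?_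
    rw [← Real.exp_nat_mul]
    exact Real.exp_le_exp.2 (by push_cast; linarith)
  rcases le_total (2 * y) (y ^ 2) with h | h
  · rwa [min_eq_left h]
  · rwa [min_eq_right h]

/-- `∑_{k < K} 2^(kp) min (2t/2^k, t²/4^k)` is at most of the order `t^p`. -/
lemma exists_sum_min_le {p : ℝ} (hp1 : 1 < p) (hp2 : p < 2) : ∃ A c : ℝ, 0 ≤ A ∧ 0 ≤ c ∧
    ∀ (K : ℕ) (t : ℝ), 0 ≤ t → ∑ k ∈ Finset.range K, ((2 : ℝ) ^ p) ^ k *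
      min (2 * (t / 2 ^ k)) ((t / 2 ^ k) ^ 2) ≤ A * t ^ p + c := by
  set q : ℝ := 2 ^ p with hq
  have hq2 : 2 < q := by
    have := Real.rpow_lt_rpow_of_exponent_lt one_lt_two hp1
    rwa [Real.rpow_one] at this
  have hq4 : q < 4 := by
    have := Real.rpow_lt_rpow_of_exponent_lt one_lt_two hp2
    rw [Real.rpow_two] at this
    linarith
  set S : ℕ → ℝ → ℝ := fun K t => ∑ k ∈ Finset.range K, q ^ k *
      min (2 * (t / 2 ^ k)) ((t / 2 ^ k) ^ 2) with hS
  -- Self-similarity: dropping the first term rescales t by 1/2 and multiplies by q, so bounds can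
  -- be propagated by induction on K.
  have hrec : ∀ K t, S (K + 1) t = min (2 * t) (t ^ 2) + q * S K (t / 2) := by
    intro K t
    simp only [hS]
    rw [Finset.sum_range_succ', add_comm, Finset.mul_sum]
    congr 1
    · simp
    · refine Finset.sum_congr rfl fun k _ => ?_
      rw [show t / 2 / 2 ^ k = t / 2 ^ (k + 1) by rw [pow_succ, div_div, mul_comm]]
      ring
  -- Fixed point of c ↦ 1 + qc/4, which makes the quadratic bound c t² reproduce itself; this uses q
  -- < 4.
  set c := 4 / (4 - q) with hc
  have hc0 : 0 < c := div_pos (by norm_num) (by linarith)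
  have hcq : c * (4 - q) = 4 := div_mul_cancel₀ _ (by linarith)
  have h1 : ∀ K t, S K t ≤ c * t ^ 2 := by
    intro K
    induction K with
    | zero => intro t; simp only [hS, Finset.range_zero, Finset.sum_empty]; positivity
    | succ K ih =>
      intro t
      rw [hrec]
      have h2 : q * S K (t / 2) ≤ q * (c * (t / 2) ^ 2) :=
        mul_le_mul_of_nonneg_left (ih _) (by linarith)
      have h3 : min (2 * t) (t ^ 2) ≤ t ^ 2 := min_le_right _ _
      have h4 : t ^ 2 + q * (c * (t / 2) ^ 2) = c * t ^ 2 := by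
        linear_combination (-t ^ 2 / 4) * hcq
      linarith
  -- The correction -e t absorbs the new term 2t, as 2 - qe/2 = -e; this uses q > 2.
  set e := 4 / (q - 2) with he
  have he0 : 0 < e := div_pos (by norm_num) (by linarith)
  have heq : e * (q - 2) = 4 := div_mul_cancel₀ _ (by linarith)
  have hhalf : ∀ t : ℝ, 0 ≤ t → q * (t / 2) ^ p = t ^ p := fun t ht => by
    rw [Real.div_rpow ht zero_le_two, mul_div_cancel₀]
    linarith
  have h2t : ∀ t : ℝ, 1 / 2 ≤ t → 2 * t ≤ q * t ^ p := fun t ht => by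
    rw [hq, ← Real.mul_rpow zero_le_two (by linarith)]
    exact Real.self_le_rpow_of_one_le (by linarith) hp1.le
  have h2 : ∀ K t, 1 / 2 ≤ t → S K t ≤ q * (c + e) * t ^ p - e * t := by
    intro K
    induction K with
    | zero =>
      intro t ht
      have h3 := mul_le_mul_of_nonneg_left (h2t t ht) (add_pos hc0 he0).le
      simp only [hS, Finset.range_zero, Finset.sum_empty]
      nlinarith
    | succ K ih =>
      intro t ht
      have ht0 : 0 ≤ t := by linarith
      by_cases ht1 : 1 ≤ t
      · rw [hrec]
        have h3 := mul_le_mul_of_nonneg_left (ih (t / 2) (by linarith))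
          (show 0 ≤ q by linarith)
        have h4 : min (2 * t) (t ^ 2) ≤ 2 * t := min_le_left _ _
        have h5 : q * (q * (c + e) * (t / 2) ^ p - e * (t / 2)) =
            q * (c + e) * t ^ p - q * e * t / 2 := by
          rw [← hhalf t ht0]; ring
        have h6 : 2 * t - q * e * t / 2 = - e * t := by linear_combination (-t / 2) * heq
        linarith
      · have h3 := mul_le_mul_of_nonneg_left (h2t t ht) (add_pos hc0 he0).le
        have h4 := h1 (K + 1) t
        have h5 : c * t ^ 2 ≤ c * t := by nlinarith
        nlinarith
  refine ⟨q * (c + e), c, by positivity, hc0.le, fun K t ht => ?_⟩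
  have ht' : 0 ≤ q * (c + e) * t ^ p := by positivity
  by_cases ht2 : 1 / 2 ≤ t
  · have := h2 K t ht2
    have : 0 ≤ e * t := by positivity
    change S K t ≤ _
    linarith
  · have h3 := h1 K t
    have h4 : t ^ 2 ≤ 1 := by nlinarith
    change S K t ≤ _
    nlinarith

/-- The exponents `N_k = ⌈2^(kp)⌉`. -/
def cosExp (p : ℝ) (k : ℕ) : ℕ := ⌈((2 : ℝ) ^ p) ^ k⌉₊

lemma le_cosExp (p : ℝ) (k : ℕ) : ((2 : ℝ) ^ p) ^ k ≤ cosExp p k := Nat.le_ceil _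

lemma cosExp_le {p : ℝ} (hp : 0 ≤ p) (k : ℕ) : (cosExp p k : ℝ) ≤ 2 * ((2 : ℝ) ^ p) ^ k := by
  have h1 : (1 : ℝ) ≤ ((2 : ℝ) ^ p) ^ k := one_le_pow₀ (Real.one_le_rpow one_le_two hp)
  have := (Nat.ceil_lt_add_one (show 0 ≤ ((2 : ℝ) ^ p) ^ k by positivity)).le
  unfold cosExp
  linarith

/-- The factors of the product. -/
def cosFactor (p : ℝ) (k : ℕ) (z : ℂ) : ℂ := (Complex.cos (z / 2 ^ k) ^ 2) ^ cosExp p k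

lemma norm_pow_sub_one_le (x : ℂ) {B : ℝ} (hB : 1 ≤ B) (hx : ‖x‖ ≤ B) (n : ℕ) :
    ‖x ^ n - 1‖ ≤ n * B ^ n * ‖x - 1‖ := by
  induction n with
  | zero => simp
  | succ n ih =>
    have h1 : x ^ (n + 1) - 1 = x ^ n * (x - 1) + (x ^ n - 1) := by ring
    have h2 : ‖x‖ ^ n ≤ B ^ n := by gcongr
    have h3 : B ^ n ≤ B ^ (n + 1) := pow_le_pow_right₀ hB (Nat.le_succ n)
    calc ‖x ^ (n + 1) - 1‖ ≤ ‖x‖ ^ n * ‖x - 1‖ + ‖x ^ n - 1‖ := by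
          rw [h1]; exact (norm_add_le _ _).trans (by rw [norm_mul, norm_pow])
      _ ≤ B ^ (n + 1) * ‖x - 1‖ + n * B ^ (n + 1) * ‖x - 1‖ := by
          gcongr
          · exact h2.trans h3
          · exact ih.trans (by gcongr)
      _ = _ := by push_cast; ring

lemma norm_sin_le (z : ℂ) : ‖Complex.sin z‖ ≤ ‖z‖ * Real.exp ‖z‖ := by
  have h1 : ∀ w : ℂ, ‖Complex.exp w - 1‖ ≤ ‖w‖ * Real.exp ‖w‖ := fun w => by
    simpa using Complex.norm_exp_sub_sum_le_norm_mul_exp w 1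
  have h2 : Complex.sin z = ((Complex.exp (-z * Complex.I) - 1) -
      (Complex.exp (z * Complex.I) - 1)) * Complex.I / 2 := by
    rw [Complex.sin]; ring
  have h3 := h1 (-z * Complex.I)
  have h4 := h1 (z * Complex.I)
  rw [norm_mul, Complex.norm_I, mul_one] at h3 h4
  rw [norm_neg] at h3
  rw [h2, norm_div, norm_mul, Complex.norm_I, mul_one, Complex.norm_ofNat]
  linarith [norm_sub_le (Complex.exp (-z * Complex.I) - 1) (Complex.exp (z * Complex.I) - 1)]

/-- Here |cos² u - 1| = |sin u|² is of order 4^(-k), and raising to the power N_k of order 2^(kp)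
multiplies it by N_k up to a bounded factor. The ratio 2^p/4 < 1 makes the product converge locally
uniformly. -/
lemma norm_cosFactor_sub_one_le {p : ℝ} (hp0 : 0 ≤ p) {R : ℝ} {z : ℂ} (hp2 : p < 2)
    (hz : ‖z‖ ≤ R) (k : ℕ) :
    ‖cosFactor p k z - 1‖ ≤ 2 * Real.exp (2 * R ^ 2) * R ^ 2 * Real.exp (2 * R) *
      ((2 : ℝ) ^ p / 4) ^ k := by
  have hR : 0 ≤ R := (norm_nonneg z).trans hz
  have h2k : (1 : ℝ) ≤ 2 ^ k := one_le_pow₀ one_le_two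
  set u := z / 2 ^ k with hu
  have hnu : ‖u‖ ≤ R / 2 ^ k := by
    rw [hu, norm_div, norm_pow, Complex.norm_ofNat]; gcongr
  have hnu' : ‖u‖ ≤ R := hnu.trans (div_le_self hR h2k)
  have hq4 : (2 : ℝ) ^ p ≤ 4 := by
    have := Real.rpow_le_rpow_of_exponent_le one_le_two hp2.le
    rw [Real.rpow_two] at this
    linarith
  have h4k : ((2 : ℝ) ^ k) ^ 2 = 4 ^ k := by rw [← pow_mul, mul_comm, pow_mul]; norm_num
  have hle : ((2 : ℝ) ^ p) ^ k ≤ 4 ^ k := by gcongr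
  have hB : ‖Complex.cos u ^ 2‖ ≤ Real.exp ((R / 2 ^ k) ^ 2) := by
    rw [norm_pow]
    refine (norm_cos_sq_le u).trans (Real.exp_le_exp.2 ((min_le_right _ _).trans ?_))
    exact pow_le_pow_left₀ (abs_nonneg _) ((Complex.abs_im_le_norm u).trans hnu) 2
  have h1 := norm_pow_sub_one_le _ (Real.one_le_exp (by positivity)) hB (cosExp p k)
  have h2 : ‖Complex.cos u ^ 2 - 1‖ ≤ (R / 2 ^ k) ^ 2 * Real.exp (2 * R) := by
    have : Complex.cos u ^ 2 - 1 = -(Complex.sin u ^ 2) := by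
      linear_combination Complex.sin_sq_add_cos_sq u
    rw [this, norm_neg, norm_pow]
    calc ‖Complex.sin u‖ ^ 2 ≤ (R / 2 ^ k * Real.exp R) ^ 2 := by
          gcongr
          exact (norm_sin_le u).trans (by gcongr)
      _ = _ := by rw [mul_pow, ← Real.exp_nat_mul]; norm_num
  have h3 : Real.exp ((R / 2 ^ k) ^ 2) ^ cosExp p k ≤ Real.exp (2 * R ^ 2) := by
    rw [← Real.exp_nat_mul]
    refine Real.exp_le_exp.2 ?_
    calc (cosExp p k : ℝ) * (R / 2 ^ k) ^ 2 ≤ (2 * 4 ^ k) * (R / 2 ^ k) ^ 2 := by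
          gcongr
          exact (cosExp_le hp0 k).trans (by gcongr)
      _ = _ := by rw [div_pow, h4k]; field_simp
  calc _ ≤ _ := h1
    _ ≤ (2 * ((2 : ℝ) ^ p) ^ k) * Real.exp (2 * R ^ 2) *
        ((R / 2 ^ k) ^ 2 * Real.exp (2 * R)) := by
          gcongr
          exact cosExp_le hp0 k
    _ = _ := by rw [div_pow, h4k, div_pow]; ring

lemma norm_cosFactor_le {p : ℝ} (hp0 : 0 ≤ p) (k : ℕ) (z : ℂ) : ‖cosFactor p k z‖ ≤
    Real.exp (2 * (((2 : ℝ) ^ p) ^ k *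
      min (2 * (|z.im| / 2 ^ k)) ((|z.im| / 2 ^ k) ^ 2))) := by
  have him : |(z / 2 ^ k).im| = |z.im| / 2 ^ k := by
    have : z / 2 ^ k = z / ((2 ^ k : ℝ) : ℂ) := by push_cast; rfl
    rw [this, Complex.div_ofReal_im, abs_div, abs_of_pos (show (0 : ℝ) < 2 ^ k by positivity)]
  have h1 := norm_cos_sq_le (z / 2 ^ k)
  rw [him] at h1
  rw [cosFactor, norm_pow, norm_pow]
  refine (pow_le_pow_left₀ (by positivity) h1 _).trans ?_
  rw [← Real.exp_nat_mul, ← mul_assoc]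
  refine Real.exp_le_exp.2 (mul_le_mul_of_nonneg_right (cosExp_le hp0 k) ?_)
  positivity

/-- The function `∏_k cos (z / 2^k)^(2 N_k)`. -/
def cosProd (p : ℝ) (z : ℂ) : ℂ := ∏' k, (1 + (cosFactor p k z - 1))

lemma differentiable_cosFactor (p : ℝ) (k : ℕ) : Differentiable ℂ (cosFactor p k) := by
  unfold cosFactor; fun_prop

lemma tendsto_cosProd {p : ℝ} (hp1 : 1 < p) (hp2 : p < 2) (R : ℝ) :
    HasProdLocallyUniformlyOn (fun k z => 1 + (cosFactor p k z - 1)) (cosProd p)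
      (Metric.ball (0 : ℂ) R) := by
  have hq4 : (2 : ℝ) ^ p < 4 := by
    have := Real.rpow_lt_rpow_of_exponent_lt one_lt_two hp2
    rw [Real.rpow_two] at this
    linarith
  have hs : Summable fun k : ℕ => 2 * Real.exp (2 * R ^ 2) * R ^ 2 * Real.exp (2 * R) *
      ((2 : ℝ) ^ p / 4) ^ k :=
    (summable_geometric_of_lt_one (by positivity) (by linarith)).mul_left _
  refine Summable.hasProdLocallyUniformlyOn_nat_one_add Metric.isOpen_ball hs
    (Eventually.of_forall fun k z hz => norm_cosFactor_sub_one_le (by linarith) hp2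
      (by simpa using (Metric.mem_ball.1 hz).le) k)
    fun k => ((differentiable_cosFactor p k).continuous.sub continuous_const).continuousOn

lemma hasProd_cosProd {p : ℝ} (hp1 : 1 < p) (hp2 : p < 2) (z : ℂ) :
    Tendsto (fun K => ∏ k ∈ Finset.range K, cosFactor p k z) atTop (nhds (cosProd p z)) := by
  have h1 := (tendsto_cosProd hp1 hp2 (‖z‖ + 1)).hasProd (x := z) (by simp)
  simpa using h1.tendsto_prod_nat

/-- Growth in |y| comes from summing the factor bounds (`exists_sum_min_le`). Decay in |x| comes
from a single factor: for 2^n ≤ |x| < 2^(n+1) the argument of the factor of index n + 1 has modulus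
of real part in [1/2, 1], its squared cosine is at most some γ < 1, and its exponent is at least
|x|^p. -/
lemma isEntireWindow_cosProd {p : ℝ} (hp1 : 1 < p) (hp2 : p < 2) :
    IsEntireWindow p (cosProd p) where
  differentiable := by
    intro z
    have h1 := tendsto_cosProd hp1 hp2 (‖z‖ + 1)
    have h2 : DifferentiableOn ℂ (cosProd p) (Metric.ball 0 (‖z‖ + 1)) := by
      refine TendstoLocallyUniformlyOn.differentiableOn
        h1.tendstoLocallyUniformlyOn_finsetRange (Eventually.of_forall fun K => ?_)
        Metric.isOpen_ball
      refine Differentiable.differentiableOn ?_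
      refine Differentiable.fun_finsetProd fun k _ => ?_
      exact ((differentiable_cosFactor p k).sub_const 1).const_add 1
    exact (h2 z (by simp)).differentiableAt (Metric.isOpen_ball.mem_nhds (by simp))
  nonneg x := by
    have h1 : ∀ K : ℕ, ∃ r : ℝ, 0 ≤ r ∧ ∏ k ∈ Finset.range K, cosFactor p k x = r := by
      intro K
      refine ⟨∏ k ∈ Finset.range K, (Real.cos (x / 2 ^ k) ^ 2) ^ cosExp p k,
        Finset.prod_nonneg fun k _ => by positivity, ?_⟩
      push_cast
      rfl
    choose r hr0 hr using h1
    have h2 := hasProd_cosProd hp1 hp2 x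
    simp only [hr] at h2
    have h3 := (Complex.continuous_re.tendsto _).comp h2
    have h4 := (Complex.continuous_im.tendsto _).comp h2
    have h5 : (cosProd p x).im = 0 := by
      refine tendsto_nhds_unique h4 ?_
      simp [Function.comp_def]
    refine ⟨(cosProd p x).re, ge_of_tendsto' h3 fun K => ?_, ?_⟩
    · simpa using hr0 K
    · exact Complex.ext (by simp) (by simp [h5])
  map_zero := by
    simp [cosProd, cosFactor]
  bound := by
    have hp0 : 0 < p := by linarith
    obtain ⟨B, c, hB, hc, hS⟩ := exists_sum_min_le hp1 hp2
    have hcos : Real.cos (1 / 2) ^ 2 < 1 := by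
      have h1 : Real.cos (1 / 2) < Real.cos 0 :=
        Real.cos_lt_cos_of_nonneg_of_le_pi le_rfl (by linarith [Real.pi_gt_three]) (by norm_num)
      rw [Real.cos_zero] at h1
      have h2 : 0 ≤ Real.cos (1 / 2) :=
        Real.cos_nonneg_of_mem_Icc ⟨by linarith [Real.pi_gt_three], by linarith [Real.pi_gt_three]⟩
      nlinarith
    -- The sector must be so thin that |cos|² = cos² + sinh² stays below 1 for real parts in [1/2,
    -- 1].
    have hev : ∀ᶠ ε : ℝ in nhdsWithin 0 (Set.Ioi 0),
        Real.cos (1 / 2) ^ 2 + Real.sinh ε ^ 2 < 1 := by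
      refine Filter.Eventually.filter_mono nhdsWithin_le_nhds ?_
      have h1 : Tendsto (fun ε : ℝ => Real.cos (1 / 2) ^ 2 + Real.sinh ε ^ 2) (nhds 0)
          (nhds (Real.cos (1 / 2) ^ 2 + Real.sinh 0 ^ 2)) :=
        (Continuous.tendsto (by fun_prop) _)
      rw [Real.sinh_zero] at h1
      exact h1.eventually (gt_mem_nhds (by linarith))
    obtain ⟨ε, hε1, hε0⟩ := (hev.and self_mem_nhdsWithin).exists
    have hε0 : 0 < ε := hε0
    set γ := Real.cos (1 / 2) ^ 2 + Real.sinh ε ^ 2 with hγ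
    have hγ0 : 0 < γ := by
      have : 0 < Real.sinh ε := Real.sinh_pos_iff.2 hε0
      positivity
    have ha : 0 < -Real.log γ := neg_pos.2 (Real.log_neg hγ0 hε1)
    set E : ℕ → ℂ → ℝ := fun k z => 2 * (((2 : ℝ) ^ p) ^ k *
      min (2 * (|z.im| / 2 ^ k)) ((|z.im| / 2 ^ k) ^ 2)) with hE
    have hE0 : ∀ k z, 0 ≤ E k z := fun k z => by positivity
    have hES : ∀ K z, ∑ k ∈ Finset.range K, E k z ≤ 2 * c + 2 * B * |z.im| ^ p := fun K z => by
      simp only [hE]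
      rw [← Finset.mul_sum]
      linarith [hS K |z.im| (abs_nonneg _)]
    refine exists_mixed_bound (a := -Real.log γ) (b := 2 * B) (C := Real.exp (2 * c)) hp0 hε0 ha
      (by positivity) (by positivity) (fun z => ?_) fun z hx hyx => ?_
    · refine le_of_tendsto (hasProd_cosProd hp1 hp2 z).norm (Eventually.of_forall fun K => ?_)
      rw [norm_prod, ← Real.exp_add]
      refine (Finset.prod_le_prod (fun _ _ => norm_nonneg _)
        fun k _ => norm_cosFactor_le hp0.le k z).trans ?_
      rw [← Real.exp_sum]
      exact Real.exp_le_exp.2 (hES K z)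
    · obtain ⟨n, hn1, hn2⟩ := exists_nat_pow_near hx one_lt_two
      have hx0 : 0 < |z.re| := by linarith
      have h2k : (0 : ℝ) < 2 ^ (n + 1) := by positivity
      have hfac : ‖cosFactor p (n + 1) z‖ ≤ Real.exp (-(-Real.log γ) * |z.re| ^ p) := by
        have hcast : z / 2 ^ (n + 1) = z / ((2 ^ (n + 1) : ℝ) : ℂ) := by push_cast; rfl
        have hre : |(z / 2 ^ (n + 1)).re| = |z.re| / 2 ^ (n + 1) := by
          rw [hcast, Complex.div_ofReal_re, abs_div, abs_of_pos h2k]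
        have him : |(z / 2 ^ (n + 1)).im| = |z.im| / 2 ^ (n + 1) := by
          rw [hcast, Complex.div_ofReal_im, abs_div, abs_of_pos h2k]
        have h1 : ‖Complex.cos (z / 2 ^ (n + 1))‖ ^ 2 ≤ γ := by
          rw [norm_cos_sq, ← Real.cos_abs, ← sq_abs (Real.sinh _), Real.abs_sinh, hre, him]
          have h3 : 1 / 2 ≤ |z.re| / 2 ^ (n + 1) := by
            rw [le_div_iff₀ h2k, pow_succ]; linarith
          have h4 : |z.re| / 2 ^ (n + 1) ≤ 1 := by
            rw [div_le_one h2k]; exact hn2.le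
          have h5 : Real.cos (|z.re| / 2 ^ (n + 1)) ≤ Real.cos (1 / 2) :=
            Real.cos_le_cos_of_nonneg_of_le_pi (by norm_num) (by linarith [Real.pi_gt_three]) h3
          have h6 : 0 ≤ Real.cos (|z.re| / 2 ^ (n + 1)) :=
            Real.cos_nonneg_of_mem_Icc ⟨by linarith [Real.pi_gt_three],
              by linarith [Real.pi_gt_three]⟩
          have h7 : |z.im| / 2 ^ (n + 1) ≤ ε := by
            rw [div_le_iff₀ h2k]
            exact hyx.trans (by gcongr)
          have h8 : Real.sinh (|z.im| / 2 ^ (n + 1)) ≤ Real.sinh ε := Real.sinh_le_sinh.2 h7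
          have h9 : 0 ≤ Real.sinh (|z.im| / 2 ^ (n + 1)) := Real.sinh_nonneg_iff.2 (by positivity)
          rw [hγ]
          gcongr
        rw [cosFactor, norm_pow, norm_pow]
        refine (pow_le_pow_left₀ (by positivity) h1 _).trans ?_
        rw [← Real.exp_log (pow_pos hγ0 _), Real.log_pow]
        refine Real.exp_le_exp.2 ?_
        have h3 : |z.re| ^ p ≤ cosExp p (n + 1) := by
          refine le_trans ?_ (le_cosExp p (n + 1))
          calc |z.re| ^ p ≤ ((2 : ℝ) ^ (n + 1)) ^ p := by gcongr
            _ = _ := by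
              rw [← Real.rpow_natCast, ← Real.rpow_natCast, ← Real.rpow_mul zero_le_two,
                ← Real.rpow_mul zero_le_two, mul_comm]
        nlinarith
      refine le_of_tendsto (hasProd_cosProd hp1 hp2 z).norm
        ((eventually_gt_atTop (n + 1)).mono fun K hK => ?_)
      rw [norm_prod, ← Real.exp_add]
      have hmem : n + 1 ∈ Finset.range K := Finset.mem_range.2 hK
      -- The factor with index n + 1 supplies the decay; all the others are estimated by their
      -- growth in y.
      have h1 : ∏ k ∈ Finset.range K, ‖cosFactor p k z‖ ≤
          Real.exp (-(-Real.log γ) * |z.re| ^ p) *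
            ∏ k ∈ (Finset.range K).erase (n + 1), Real.exp (E k z) := by
        rw [← Finset.mul_prod_erase _ _ hmem]
        refine mul_le_mul hfac (Finset.prod_le_prod (fun _ _ => norm_nonneg _)
          fun k _ => norm_cosFactor_le hp0.le k z) (Finset.prod_nonneg fun _ _ => norm_nonneg _)
          (Real.exp_pos _).le
      refine h1.trans ?_
      rw [← Real.exp_sum, ← Real.exp_add]
      refine Real.exp_le_exp.2 ?_
      have h2 : ∑ k ∈ (Finset.range K).erase (n + 1), E k z ≤ ∑ k ∈ Finset.range K, E k z :=
        Finset.sum_le_sum_of_subset_of_nonneg (Finset.erase_subset _ _) fun k _ _ => hE0 k z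
      linarith [hES K z]

lemma exists_isEntireWindow {p : ℝ} (hp : 1 < p) : ∃ G : ℂ → ℂ, IsEntireWindow p G := by
  have key : ∀ (n : ℕ) (p : ℝ), 1 < p → p ≤ 2 ^ (n + 1) → ∃ G : ℂ → ℂ, IsEntireWindow p G := by
    intro n
    -- Orders in (1, 2) use the cosine product, order 2 the Gaussian, and larger orders are halved
    -- until they fall in this range.
    induction n with
    | zero =>
      intro p hp hp2
      rcases lt_or_eq_of_le hp2 with h | h
      · exact ⟨_, isEntireWindow_cosProd hp (by simpa using h)⟩
      · rw [h, zero_add, pow_one]; exact ⟨_, isEntireWindow_gaussian⟩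
    | succ n ih =>
      intro p hp hp2
      by_cases h : p ≤ 2
      · exact ih p hp (h.trans (by
          rw [pow_succ]; nlinarith [one_le_pow₀ (n := n) (one_le_two (α := ℝ))]))
      · obtain ⟨G, hG⟩ := ih (p / 2) (by linarith) (by
          rw [pow_succ] at hp2; linarith)
        have := hG.comp_sq (by linarith)
        rw [mul_div_cancel₀ _ two_ne_zero] at this
        exact ⟨_, this⟩
  obtain ⟨n, hn⟩ := pow_unbounded_of_one_lt p one_lt_two
  exact key n p hp (hn.le.trans (pow_le_pow_right₀ one_le_two (Nat.le_succ n)))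

end Entire

/-! ## Partitions of unity in one variable -/

section OneVariable

open Filter

/-- `|w^(n)(t)| ≤ C h^n n!^τ exp (-a |t|^{1/θ})`. -/
def DecayBound (τ θ h a C : ℝ) (w : ℝ → ℂ) : Prop :=
  ∀ (n : ℕ) (t : ℝ), ‖iteratedDeriv n w t‖ ≤
    C * (h ^ n * (n ! : ℝ) ^ τ) * Real.exp (-a * |t| ^ (1 / θ))

lemma DecayBound.nonneg {τ θ h a C : ℝ} {w : ℝ → ℂ} (hw : DecayBound τ θ h a C w) : 0 ≤ C := by
  have h1 := (norm_nonneg _).trans (hw 0 0)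
  simp only [pow_zero, Nat.factorial_zero, Nat.cast_one, Real.one_rpow, mul_one] at h1
  exact nonneg_of_mul_nonneg_left h1 (Real.exp_pos _)

lemma exists_exp_rpow_le {a a' p p' : ℝ} (hp : 0 ≤ p) (hpp : p ≤ p') (ha : 0 < a) (ha' : 0 < a')
    (h : p < p' ∨ a' ≤ a) : ∃ C : ℝ, 0 ≤ C ∧ ∀ t : ℝ, 0 ≤ t →
      Real.exp (-a * t ^ p') ≤ C * Real.exp (-a' * t ^ p) := by
  suffices H : ∃ c : ℝ, ∀ t : ℝ, 0 ≤ t → a' * t ^ p ≤ a * t ^ p' + c by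
    obtain ⟨c, hc⟩ := H
    refine ⟨Real.exp c, (Real.exp_pos c).le, fun t ht => ?_⟩
    rw [← Real.exp_add]
    exact Real.exp_le_exp.2 (by linarith [hc t ht])
  rcases h with h | h
  · have hev : ∀ᶠ x : ℝ in atTop, a' / a ≤ x ^ (p' - p) :=
      (tendsto_rpow_atTop (sub_pos.2 h)).eventually (eventually_ge_atTop _)
    obtain ⟨t₀, ht₀, ht₀'⟩ := (hev.and (eventually_gt_atTop 0)).exists
    refine ⟨a' * t₀ ^ p, fun t ht => ?_⟩
    have h1 : 0 ≤ a * t ^ p' := by positivity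
    have h1' : 0 ≤ a' * t₀ ^ p := by positivity
    rcases le_total t t₀ with h2 | h2
    · have : a' * t ^ p ≤ a' * t₀ ^ p := by gcongr
      linarith
    · have h3 : a' / a ≤ t ^ (p' - p) :=
        ht₀.trans (Real.rpow_le_rpow ht₀'.le h2 (sub_pos.2 h).le)
      have h4 : a' * t ^ p ≤ a * t ^ p' := by
        have h5 : t ^ p' = t ^ (p' - p) * t ^ p := by
          rw [← Real.rpow_add (ht₀'.trans_le h2), sub_add_cancel]
        rw [h5, ← mul_assoc]
        refine mul_le_mul_of_nonneg_right ?_ (by positivity)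
        rwa [div_le_iff₀' ha] at h3
      linarith
  · refine ⟨a, fun t ht => ?_⟩
    have h1 : t ^ p ≤ t ^ p' + 1 := by
      rcases le_total t 1 with h2 | h2
      · have h3 : t ^ p ≤ 1 := Real.rpow_le_one ht h2 hp
        have h4 : 0 ≤ t ^ p' := by positivity
        linarith
      · linarith [Real.rpow_le_rpow_of_exponent_le h2 hpp]
    have h0 : 0 ≤ t ^ p := by positivity
    nlinarith

lemma exists_pow_factorial_rpow_le {h h' τ τ' : ℝ} (hh : 0 ≤ h) (hh' : 0 < h') (hτ : τ' ≤ τ)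
    (H : τ' < τ ∨ h ≤ h') : ∃ C : ℝ, 0 ≤ C ∧ ∀ n : ℕ,
      h ^ n * (n ! : ℝ) ^ τ' ≤ C * (h' ^ n * (n ! : ℝ) ^ τ) := by
  rcases H with H | H
  · refine ⟨Real.exp ((τ - τ') * (h / h') ^ (1 / (τ - τ'))), (Real.exp_pos _).le, fun n => ?_⟩
    have hδ : 0 < τ - τ' := sub_pos.2 H
    have h1 := pow_le_exp_rpow (div_nonneg hh hh'.le) hδ hδ n
    rw [div_self hδ.ne', Real.one_rpow, one_pow, one_mul, div_pow, div_le_iff₀ (by positivity)] at h1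
    have hn : (0 : ℝ) < n ! := by positivity
    calc h ^ n * (n ! : ℝ) ^ τ' ≤ ((n ! : ℝ) ^ (τ - τ') *
          Real.exp ((τ - τ') * (h / h') ^ (1 / (τ - τ'))) * h' ^ n) * (n ! : ℝ) ^ τ' := by gcongr
      _ = Real.exp ((τ - τ') * (h / h') ^ (1 / (τ - τ'))) *
          (h' ^ n * ((n ! : ℝ) ^ (τ - τ') * (n ! : ℝ) ^ τ')) := by ring
      _ = _ := by rw [← Real.rpow_add hn, sub_add_cancel]
  · refine ⟨1, zero_le_one, fun n => ?_⟩
    rw [one_mul]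
    have : (1 : ℝ) ≤ n ! := by exact_mod_cast Nat.one_le_iff_ne_zero.2 (Nat.factorial_ne_zero n)
    gcongr

/-- A strict gain in an exponent allows any scale or rate, as needed for Beurling windows. With
equal exponents the scale may only grow and the rate only shrink, which suffices for Roumieu
windows. -/
lemma DecayBound.weaken {τ θ τ' θ' h h' a a' C : ℝ} {w : ℝ → ℂ} (hw : DecayBound τ' θ' h a C w)
    (hθ : 0 < θ) (hθ' : 0 < θ') (hh : 0 ≤ h) (hh' : 0 < h') (ha : 0 < a) (ha' : 0 < a')
    (hτ : τ' ≤ τ) (hθθ : θ' ≤ θ) (Hτ : τ' < τ ∨ h ≤ h') (Hθ : θ' < θ ∨ a' ≤ a) :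
    ∃ C', DecayBound τ θ h' a' C' w := by
  obtain ⟨C₁, hC₁, H₁⟩ := exists_pow_factorial_rpow_le hh hh' hτ Hτ
  obtain ⟨C₂, hC₂, H₂⟩ := exists_exp_rpow_le (p := 1 / θ) (p' := 1 / θ') (by positivity)
    (one_div_le_one_div_of_le hθ' hθθ) ha ha' (Hθ.imp_left (one_div_lt_one_div_of_lt hθ'))
  refine ⟨C * C₁ * C₂, fun n t => (hw n t).trans ?_⟩
  have hC := hw.nonneg
  calc _ ≤ C * (C₁ * (h' ^ n * (n ! : ℝ) ^ τ)) * (C₂ * Real.exp (-a' * |t| ^ (1 / θ))) := by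
        exact mul_le_mul (mul_le_mul_of_nonneg_left (H₁ n) hC) (H₂ |t| (abs_nonneg t))
          (Real.exp_pos _).le (by positivity)
    _ = _ := by ring

lemma iteratedDeriv_ofReal_comp {G : ℂ → ℂ} (hG : Differentiable ℂ G) (n : ℕ) :
    iteratedDeriv n (fun t : ℝ => G t) = fun t : ℝ => iteratedDeriv n G t := by
  induction n with
  | zero => simp
  | succ n ih =>
    rw [iteratedDeriv_succ, ih]
    funext t
    have h1 : Differentiable ℂ (iteratedDeriv n G) :=
      (hG.contDiff (n := ∞)).differentiable_iteratedDeriv n (WithTop.coe_lt_coe.2 (WithTop.coe_lt_top n))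
    rw [(h1 t).hasDerivAt.comp_ofReal.deriv, iteratedDeriv_succ]

/-- Cauchy's estimate on a circle of radius (n+1)^(1/p): there the growth in y costs only a
geometric factor, and n!/R^n ≤ n!^(1-1/p). So the two exponents add up to exactly 1. -/
lemma IsEntireWindow.exists_decayBound {p : ℝ} (hp : 1 < p) {G : ℂ → ℂ}
    (hG : IsEntireWindow p G) : ∃ h a C : ℝ, 0 < h ∧ 0 < a ∧
      DecayBound (1 - 1 / p) (1 / p) h a C (fun t : ℝ => G t) := by
  obtain ⟨a, b, C, ha, hb, hC, H⟩ := hG.bound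
  have hp0 : 0 < p := by linarith
  refine ⟨Real.exp (a + b), a / 2 ^ p, C * Real.exp (a + b), Real.exp_pos _, by positivity,
    fun n t => ?_⟩
  rw [iteratedDeriv_ofReal_comp hG.differentiable, one_div_one_div]
  -- The shift by 1 keeps the radius positive for n = 0.
  set R : ℝ := ((n : ℝ) + 1) ^ (1 / p) with hR
  have hR0 : 0 < R := by positivity
  have hRp : R ^ p = n + 1 := by
    rw [hR, ← Real.rpow_mul (by positivity), one_div_mul_cancel hp0.ne', Real.rpow_one]
  have hsph : ∀ z ∈ Metric.sphere (t : ℂ) R, ‖G z‖ ≤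
      C * (Real.exp (a + b) * Real.exp (a + b) ^ n * Real.exp (-(a / 2 ^ p) * |t| ^ p)) := by
    intro z hz
    have hz' : ‖z - t‖ = R := by simpa [dist_eq_norm] using hz
    refine (H z).trans (mul_le_mul_of_nonneg_left ?_ hC)
    rw [← Real.exp_nat_mul, ← Real.exp_add, ← Real.exp_add]
    refine Real.exp_le_exp.2 ?_
    have h1 : |z.im| ^ p ≤ n + 1 := by
      rw [← hRp]
      refine Real.rpow_le_rpow (abs_nonneg _) ?_ hp0.le
      have := Complex.abs_im_le_norm (z - t)
      rw [hz'] at this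
      simpa using this
    have h2 : |t - z.re| ^ p ≤ n + 1 := by
      rw [← hRp]
      refine Real.rpow_le_rpow (abs_nonneg _) ?_ hp0.le
      have := Complex.abs_re_le_norm (z - t)
      rw [hz'] at this
      rw [abs_sub_comm]
      simpa using this
    have h3 : |t| ^ p ≤ 2 ^ p * (|z.re| ^ p + |t - z.re| ^ p) := by
      simpa using abs_add_rpow_le (x := z.re) (y := t - z.re) hp0.le
    have h4 : a / 2 ^ p * |t| ^ p ≤ a * |z.re| ^ p + a * (n + 1) := by
      calc a / 2 ^ p * |t| ^ p ≤ a / 2 ^ p * (2 ^ p * (|z.re| ^ p + |t - z.re| ^ p)) := by gcongr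
        _ = a * |z.re| ^ p + a * |t - z.re| ^ p := by field_simp
        _ ≤ _ := by gcongr
    nlinarith
  refine (Complex.norm_iteratedDeriv_le_of_forall_mem_sphere_norm_le n hR0
    hG.differentiable.diffContOnCl hsph).trans ?_
  have h1 : (n ! : ℝ) / R ^ n ≤ (n ! : ℝ) ^ (1 - 1 / p) := by
    have hn : (0 : ℝ) < n ! := by positivity
    rw [Real.rpow_sub hn, Real.rpow_one]
    refine div_le_div_of_nonneg_left hn.le (by positivity) ?_
    have h2 : (n ! : ℝ) ≤ ((n : ℝ) + 1) ^ n := by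
      have h3 : (n ! : ℝ) ≤ (n : ℝ) ^ n := by exact_mod_cast Nat.factorial_le_pow n
      exact h3.trans (by gcongr; linarith)
    calc (n ! : ℝ) ^ (1 / p) ≤ (((n : ℝ) + 1) ^ n) ^ (1 / p) := by gcongr
      _ = _ := by
        rw [hR, ← Real.rpow_natCast, ← Real.rpow_natCast, ← Real.rpow_mul (by positivity),
          ← Real.rpow_mul (by positivity), mul_comm]
  calc _ = (n ! : ℝ) / R ^ n * (C * (Real.exp (a + b) * Real.exp (a + b) ^ n *
        Real.exp (-(a / 2 ^ p) * |t| ^ p))) := by ring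
    _ ≤ (n ! : ℝ) ^ (1 - 1 / p) * (C * (Real.exp (a + b) * Real.exp (a + b) ^ n *
        Real.exp (-(a / 2 ^ p) * |t| ^ p))) := by gcongr
    _ = _ := by ring

lemma DecayBound.integrable {τ θ h a C : ℝ} {w : ℝ → ℂ} (hw : DecayBound τ θ h a C w)
    (hc : Continuous w) (hθ : 0 < θ) (ha : 0 < a) : Integrable w := by
  have hC := hw.nonneg
  set K := 1 + ((θ / a) ^ θ) ^ 2 * (2 ! : ℝ) ^ θ with hK
  have hK0 : 0 < K := by positivity
  refine (integrable_inv_one_add_sq.const_mul (C * K)).mono' hc.aestronglyMeasurable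
    (Eventually.of_forall fun t => ?_)
  have h1 : ‖w t‖ ≤ C * Real.exp (-a * |t| ^ (1 / θ)) := by simpa using hw 0 t
  refine h1.trans ?_
  rw [mul_assoc]
  refine mul_le_mul_of_nonneg_left ?_ hC
  rw [← div_eq_mul_inv, le_div_iff₀ (by positivity)]
  have h2 := pow_le_exp_rpow (abs_nonneg t) ha hθ 2
  rw [sq_abs] at h2
  have h3 : 1 ≤ Real.exp (a * |t| ^ (1 / θ)) := Real.one_le_exp (by positivity)
  have h4 : 1 + t ^ 2 ≤ K * Real.exp (a * |t| ^ (1 / θ)) := by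
    rw [hK, add_mul]; linarith
  calc _ ≤ Real.exp (-a * |t| ^ (1 / θ)) * (K * Real.exp (a * |t| ^ (1 / θ))) := by gcongr
    _ = K * (Real.exp (-a * |t| ^ (1 / θ)) * Real.exp (a * |t| ^ (1 / θ))) := by ring
    _ = _ := by rw [← Real.exp_add]; simp

/-- The function `t ↦ ∫_{t-1}^t w / ∫ w`, whose integer translates form a partition of unity. -/
def normalizedPrimitive (w : ℝ → ℂ) (t : ℝ) : ℂ := (∫ x, w x)⁻¹ * ∫ x in (t - 1)..t, w x

lemma hasDerivAt_normalizedPrimitive {w : ℝ → ℂ} (hw : Continuous w) (t : ℝ) :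
    HasDerivAt (normalizedPrimitive w) ((∫ x, w x)⁻¹ * (w t - w (t - 1))) t := by
  have h0 : normalizedPrimitive w = fun t => (∫ x, w x)⁻¹ *
      ((∫ x in (0 : ℝ)..t, w x) - ∫ x in (0 : ℝ)..(t - 1), w x) := by
    funext t
    rw [intervalIntegral.integral_interval_sub_left (hw.intervalIntegrable _ _)
      (hw.intervalIntegrable _ _)]
    rfl
  have h1 : ∀ t, HasDerivAt (fun u => ∫ x in (0 : ℝ)..u, w x) (w t) t := fun t =>
    intervalIntegral.integral_hasDerivAt_right (hw.intervalIntegrable _ _)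
      (hw.stronglyMeasurableAtFilter _ _) hw.continuousAt
  rw [h0]
  exact ((h1 t).sub ((h1 (t - 1)).comp_sub_const t 1)).const_mul _

lemma contDiff_normalizedPrimitive {w : ℝ → ℂ} (hw : ContDiff ℝ ∞ w) :
    ContDiff ℝ ∞ (normalizedPrimitive w) := by
  have h := hasDerivAt_normalizedPrimitive hw.continuous
  refine contDiff_infty_iff_deriv.2 ⟨fun t => (h t).differentiableAt, ?_⟩
  rw [funext fun t => (h t).deriv]
  exact contDiff_const.mul (hw.sub (hw.comp (contDiff_id.sub contDiff_const)))

lemma DecayBound.normalizedPrimitive {τ θ h a C : ℝ} {w : ℝ → ℂ} (hw : DecayBound τ θ h a C w)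
    (hs : ContDiff ℝ ∞ w) (hτ : 0 ≤ τ) (hθ : 0 < θ) (hh : 0 < h) (ha : 0 < a) :
    ∃ C', DecayBound τ θ h (a / 2 ^ (1 / θ)) C' (normalizedPrimitive w) := by
  set N := ‖(∫ x, w x)⁻¹‖ with hN
  have hC := hw.nonneg
  -- Both the interval of integration and the points t, t - 1 in the derivative lie within distance
  -- 1 of t, so the decay of w is kept up to a constant and a smaller rate.
  have key : ∀ x t : ℝ, |t - x| ≤ 1 → Real.exp (-a * |x| ^ (1 / θ)) ≤
      Real.exp a * Real.exp (-(a / 2 ^ (1 / θ)) * |t| ^ (1 / θ)) := by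
    intro x t hx
    rw [← Real.exp_add]
    refine Real.exp_le_exp.2 ?_
    have h1 : |t| ^ (1 / θ) ≤ 2 ^ (1 / θ) * (|x| ^ (1 / θ) + |t - x| ^ (1 / θ)) := by
      simpa using abs_add_rpow_le (x := x) (y := t - x) (p := 1 / θ) (by positivity)
    have h2 : |t - x| ^ (1 / θ) ≤ 1 := Real.rpow_le_one (abs_nonneg _) hx (by positivity)
    have h3 : a / 2 ^ (1 / θ) * |t| ^ (1 / θ) ≤ a * |x| ^ (1 / θ) + a := by
      calc _ ≤ a / 2 ^ (1 / θ) * (2 ^ (1 / θ) * (|x| ^ (1 / θ) + |t - x| ^ (1 / θ))) := by gcongr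
        _ = a * |x| ^ (1 / θ) + a * |t - x| ^ (1 / θ) := by field_simp
        _ ≤ a * |x| ^ (1 / θ) + a * 1 := by gcongr
        _ = _ := by ring
    linarith
  refine ⟨N * C * Real.exp a * (1 + 2 / h), fun n t => ?_⟩
  have hnn : 0 ≤ N := norm_nonneg _
  set e := Real.exp (-(a / 2 ^ (1 / θ)) * |t| ^ (1 / θ)) with he
  have he0 : 0 < e := Real.exp_pos _
  cases n with
  | zero =>
    have h1 : ‖∫ x in (t - 1)..t, w x‖ ≤ C * (Real.exp a * e) * |t - (t - 1)| := by
      refine intervalIntegral.norm_integral_le_of_norm_le_const fun x hx => ?_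
      rw [Set.uIoc_of_le (by linarith)] at hx
      have h2 : ‖w x‖ ≤ C * Real.exp (-a * |x| ^ (1 / θ)) := by simpa using hw 0 x
      refine h2.trans (mul_le_mul_of_nonneg_left (key x t ?_) hC)
      rw [abs_le]; constructor <;> linarith [hx.1, hx.2]
    rw [iteratedDeriv_zero, pow_zero, Nat.factorial_zero, Nat.cast_one, Real.one_rpow, mul_one,
      mul_one, _root_.normalizedPrimitive, norm_mul, ← hN]
    have h3 : 0 ≤ N * C * Real.exp a * (2 / h) * e := by positivity
    have h4 : |t - (t - 1)| = 1 := by rw [sub_sub_cancel, abs_one]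
    rw [h4, mul_one] at h1
    have h5 := mul_le_mul_of_nonneg_left h1 hnn
    nlinarith
  | succ n =>
    have hd : iteratedDeriv (n + 1) (_root_.normalizedPrimitive w) t =
        (∫ x, w x)⁻¹ * (iteratedDeriv n w t - iteratedDeriv n w (t - 1)) := by
      rw [iteratedDeriv_succ', funext fun t =>
        (hasDerivAt_normalizedPrimitive hs.continuous t).deriv]
      have hs1 : ContDiff ℝ ∞ fun t => w (t - 1) := hs.comp (contDiff_id.sub contDiff_const)
      have hn : (n : WithTop ℕ∞) ≤ ∞ := by exact_mod_cast le_top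
      rw [iteratedDeriv_const_mul _ ((hs.sub hs1).of_le hn).contDiffAt,
        iteratedDeriv_fun_sub (hs.of_le hn).contDiffAt (hs1.of_le hn).contDiffAt,
        iteratedDeriv_comp_sub_const]
    rw [hd, norm_mul, ← hN]
    have h1 : ‖iteratedDeriv n w t‖ ≤ C * (h ^ n * (n ! : ℝ) ^ τ) * (Real.exp a * e) :=
      (hw n t).trans (mul_le_mul_of_nonneg_left (key t t (by simp)) (by positivity))
    have h2 : ‖iteratedDeriv n w (t - 1)‖ ≤ C * (h ^ n * (n ! : ℝ) ^ τ) * (Real.exp a * e) :=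
      (hw n (t - 1)).trans (mul_le_mul_of_nonneg_left (key (t - 1) t (by simp)) (by positivity))
    have h3 : (n ! : ℝ) ^ τ ≤ ((n + 1)! : ℝ) ^ τ := by
      gcongr
      exact Nat.le_succ n
    calc N * ‖iteratedDeriv n w t - iteratedDeriv n w (t - 1)‖
        ≤ N * (C * (h ^ n * (n ! : ℝ) ^ τ) * (Real.exp a * e) +
          C * (h ^ n * (n ! : ℝ) ^ τ) * (Real.exp a * e)) := by
            gcongr
            exact (norm_sub_le _ _).trans (add_le_add h1 h2)
      _ = N * C * Real.exp a * (2 / h) * (h ^ (n + 1) * (n ! : ℝ) ^ τ) * e := by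
            rw [pow_succ]; field_simp; ring
      _ ≤ N * C * Real.exp a * (1 + 2 / h) * (h ^ (n + 1) * ((n + 1)! : ℝ) ^ τ) * e := by
            gcongr
            linarith

/-- The intervals [t-k-1, t-k] tile the line, so the integrals over them add up to the whole
integral. -/
lemma hasSum_normalizedPrimitive {w : ℝ → ℂ} (hw : Integrable w) (h0 : ∫ x, w x ≠ 0) (t : ℝ) :
    HasSum (fun k : ℤ => normalizedPrimitive w (t - k)) 1 := by
  have h1 : Integrable fun x => w (x + (t - 1)) := hw.comp_add_right _
  have h2 := h1.hasSum_intervalIntegral_comp_add_int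
  rw [integral_add_right_eq_self (fun x => w x)] at h2
  have h3 := ((Equiv.neg ℤ).hasSum_iff.2 h2).mul_left (∫ x, w x)⁻¹
  rw [inv_mul_cancel₀ h0] at h3
  refine (funext fun k : ℤ => ?_ : (fun k : ℤ => normalizedPrimitive w (t - k)) = _) ▸ h3
  have h4 := intervalIntegral.integral_comp_add_right (a := 0) (b := 1) w (-(k : ℝ) + (t - 1))
  rw [show (0 : ℝ) + (-(k : ℝ) + (t - 1)) = t - k - 1 by ring,
    show (1 : ℝ) + (-(k : ℝ) + (t - 1)) = t - k by ring] at h4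
  rw [normalizedPrimitive, ← h4]
  simp [add_assoc]

lemma IsEntireWindow.integral_ne_zero {p : ℝ} {G : ℂ → ℂ}
    (hG : IsEntireWindow p G) (hi : Integrable fun t : ℝ => G t) : ∫ t : ℝ, G t ≠ 0 := by
  have hre : ∀ t : ℝ, G t = ((G t).re : ℂ) ∧ 0 ≤ (G t).re := fun t => by
    obtain ⟨r, hr, h⟩ := hG.nonneg t
    rw [h]; simpa using hr
  have hc : Continuous fun t : ℝ => (G t).re :=
    Complex.continuous_re.comp (hG.differentiable.continuous.comp Complex.continuous_ofReal)
  have h1 : 0 < ∫ t : ℝ, (G t).re :=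
    integral_pos_of_integrable_nonneg_nonzero (x := 0) hc hi.re (fun t => (hre t).2)
      (by simp [hG.map_zero])
  have h2 : ∫ t : ℝ, G t = ((∫ t : ℝ, (G t).re : ℝ) : ℂ) := by
    rw [← integral_complex_ofReal]
    exact integral_congr_ae (Eventually.of_forall fun t => (hre t).1)
  rw [h2]
  exact_mod_cast h1.ne'

/-- Existence of one-dimensional partitions of unity by integer translates. -/
lemma exists_partition {p : ℝ} (hp : 1 < p) : ∃ w : ℝ → ℂ, ContDiff ℝ ∞ w ∧
    (∀ t, HasSum (fun k : ℤ => w (t - k)) 1) ∧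
    ∃ h a C : ℝ, 0 < h ∧ 0 < a ∧ DecayBound (1 - 1 / p) (1 / p) h a C w := by
  obtain ⟨G, hG⟩ := exists_isEntireWindow hp
  obtain ⟨h, a, C, hh, ha, H⟩ := hG.exists_decayBound hp
  have hp0 : 0 < 1 / p := by positivity
  have hp1 : 0 ≤ 1 - 1 / p := by
    rw [sub_nonneg, div_le_one (by linarith)]; exact hp.le
  have hs : ContDiff ℝ ∞ fun t : ℝ => G t :=
    (hG.differentiable.contDiff.restrict_scalars ℝ).comp Complex.ofRealCLM.contDiff
  have hi := H.integrable hs.continuous hp0 ha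
  obtain ⟨C', H'⟩ := H.normalizedPrimitive hs hp1 hp0 hh ha
  exact ⟨_, contDiff_normalizedPrimitive hs,
    hasSum_normalizedPrimitive hi (hG.integral_ne_zero hi), h, _, C', hh, by positivity, H'⟩

lemma exists_partition_roumieu {τ θ : ℝ} (hτ : 0 < τ) (hθ : 0 < θ) (hτθ : 1 ≤ τ + θ) :
    ∃ w : ℝ → ℂ, ContDiff ℝ ∞ w ∧ (∀ t, HasSum (fun k : ℤ => w (t - k)) 1) ∧
    ∃ h a : ℝ, 0 < h ∧ 0 < a ∧ ∀ h' a', h ≤ h' → 0 < a' → a' ≤ a →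
      ∃ C, DecayBound τ θ h' a' C w := by
  -- x = 1/p must satisfy 0 < x < 1, x ≤ θ and 1 - x ≤ τ. The value 1/2 only caps x below 1 when θ
  -- is large.
  set x := max (1 - τ) (min θ (1 / 2)) with hx
  have hx0 : 0 < x := lt_max_of_lt_right (lt_min hθ (by norm_num))
  have hx1 : x < 1 := max_lt (by linarith) (min_lt_of_right_lt (by norm_num))
  have hxθ : x ≤ θ := max_le (by linarith) (min_le_left _ _)
  have hxτ : 1 - x ≤ τ := by linarith [le_max_left (1 - τ) (min θ (1 / 2))]
  obtain ⟨w, h1, h2, h, a, C, hh, ha, H⟩ := exists_partition (one_lt_one_div hx0 hx1)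
  rw [one_div_one_div] at H
  exact ⟨w, h1, h2, h, a, hh, ha, fun h' a' hh' ha' haa =>
    H.weaken hθ hx0 hh.le (hh.trans_le hh') ha ha' hxτ hxθ (Or.inr hh') (Or.inr haa)⟩

lemma exists_partition_beurling {τ θ : ℝ} (hτ : 0 < τ) (hθ : 0 < θ) (hτθ : 1 < τ + θ) :
    ∃ w : ℝ → ℂ, ContDiff ℝ ∞ w ∧ (∀ t, HasSum (fun k : ℤ => w (t - k)) 1) ∧
    ∀ h a : ℝ, 0 < h → 0 < a → ∃ C, DecayBound τ θ h a C w := by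
  -- Because τ + θ > 1, x = 1/p can be chosen with x < θ and 1 - x < τ strictly, which frees both
  -- the scale and the rate.
  obtain ⟨x, hx1, hx2⟩ := exists_between (show max (1 - τ) 0 < min θ 1 from
    max_lt (lt_min (by linarith) (by linarith)) (lt_min hθ one_pos))
  have hx0 : 0 < x := (le_max_right _ _).trans_lt hx1
  have hxτ : 1 - x < τ := by linarith [(le_max_left (1 - τ) 0).trans_lt hx1]
  obtain ⟨w, h1, h2, h, a, C, hh, ha, H⟩ :=
    exists_partition (one_lt_one_div hx0 (hx2.trans_le (min_le_right _ _)))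
  rw [one_div_one_div] at H
  have hxθ := hx2.trans_le (min_le_left _ _)
  exact ⟨w, h1, h2, fun h' a' hh' ha' =>
    H.weaken hθ hx0 hh.le hh' ha ha' hxτ.le hxθ.le (Or.inl hxτ) (Or.inl hxθ)⟩

/-- Sums of products over functions with values in a lattice. -/
lemma summable_norm_prod_fin (n : ℕ) (f : Fin n → ℤ → ℂ) (hf : ∀ i, Summable fun k => ‖f i k‖) :
    (Summable fun k : Fin n → ℤ => ‖∏ i, f i (k i)‖) ∧
      ∑' k : Fin n → ℤ, ∏ i, f i (k i) = ∏ i, ∑' m, f i m := by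
  induction n with
  | zero => exact ⟨(hasSum_unique _).summable, by simp⟩
  | succ n ih =>
    obtain ⟨h1, h2⟩ := ih (fun i => f i.succ) fun i => hf i.succ
    have e := Fin.consEquiv fun _ : Fin (n + 1) => ℤ
    have h3 := summable_mul_of_summable_norm (hf 0).norm h1.norm
    have h4 := tsum_mul_tsum_of_summable_norm (hf 0) h1
    constructor
    · rw [← (Fin.consEquiv fun _ : Fin (n + 1) => ℤ).summable_iff]
      refine h3.congr fun x => ?_
      simp [Fin.consEquiv, Fin.prod_univ_succ]
    · rw [← (Fin.consEquiv fun _ : Fin (n + 1) => ℤ).tsum_eq, Fin.prod_univ_succ, ← h2, h4]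
      refine tsum_congr fun x => ?_
      simp [Fin.consEquiv, Fin.prod_univ_succ]

lemma summable_norm_prod {ι : Type*} [Fintype ι] (f : ι → ℤ → ℂ)
    (hf : ∀ i, Summable fun k => ‖f i k‖) :
    (Summable fun k : ι → ℤ => ‖∏ i, f i (k i)‖) ∧
      ∑' k : ι → ℤ, ∏ i, f i (k i) = ∏ i, ∑' m, f i m := by
  set e := Fintype.equivFin ι
  obtain ⟨h1, h2⟩ := summable_norm_prod_fin _ (fun i => f (e.symm i)) fun i => hf _
  have h3 : ∀ k : ι → ℤ, ∏ i, f (e.symm i) ((e.arrowCongr (Equiv.refl ℤ)) k i) =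
      ∏ i, f i (k i) := fun k => by
    simpa using e.symm.prod_comp fun i => f i (k i)
  rw [← (e.arrowCongr (Equiv.refl ℤ)).summable_iff] at h1
  rw [← (e.arrowCongr (Equiv.refl ℤ)).tsum_eq] at h2
  simp only [Function.comp_def, h3] at h1 h2
  exact ⟨h1, h2.trans (e.symm.prod_comp fun i => ∑' m, f i m)⟩

lemma summable_exp_neg_int_rpow {θ a : ℝ} (hθ : 0 < θ) (ha : 0 < a) :
    Summable fun k : ℤ => Real.exp (-a * |(k : ℝ)| ^ (1 / θ)) := by
  have h1 : Summable fun k : ℤ => ((θ / a) ^ θ) ^ 2 * (2 ! : ℝ) ^ θ * (|(k : ℝ)| ^ (2 : ℕ))⁻¹ := by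
    refine Summable.mul_left _ ?_
    have := (Real.summable_one_div_int_pow (p := 2)).2 one_lt_two
    refine this.congr fun k => ?_
    rw [sq_abs, one_div]
  refine Summable.of_norm_bounded_eventually h1 ?_
  filter_upwards [(Set.finite_singleton (0 : ℤ)).compl_mem_cofinite] with k hk
  have hk0 : (0 : ℝ) < |(k : ℝ)| := abs_pos.2 (by exact_mod_cast hk)
  have h2 := pow_le_exp_rpow hk0.le ha hθ 2
  rw [Real.norm_eq_abs, abs_of_pos (Real.exp_pos _), ← div_eq_mul_inv, le_div_iff₀ (by positivity)]
  calc _ ≤ Real.exp (-a * |(k : ℝ)| ^ (1 / θ)) * (((θ / a) ^ θ) ^ 2 * (2 ! : ℝ) ^ θ *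
        Real.exp (a * |(k : ℝ)| ^ (1 / θ))) := by gcongr
    _ = ((θ / a) ^ θ) ^ 2 * (2 ! : ℝ) ^ θ * (Real.exp (-a * |(k : ℝ)| ^ (1 / θ)) *
        Real.exp (a * |(k : ℝ)| ^ (1 / θ))) := by ring
    _ = _ := by rw [← Real.exp_add]; simp

end OneVariable

/-! ## Partitions of unity on phase space -/

section Windows

open SmoothFun Filter

variable {d : ℕ} {τ θ : Fin d ⊕ Fin d → ℝ}

/-- The lattice point with integer coordinates `k`. -/
def lat (k : Fin d ⊕ Fin d → ℤ) : PhaseSpace d d := ∑ i, (k i : ℝ) • bvec i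

lemma coord_lat (k : Fin d ⊕ Fin d → ℤ) (i : Fin d ⊕ Fin d) : coord i (lat k) = k i := by
  simp [lat, coord_bvec, -Fintype.sum_sum_type]

/-- The function `z ↦ ∏ w_i(z_i)`. -/
def prodFun (w : Fin d ⊕ Fin d → ℝ → ℂ) (hw : ∀ i, ContDiff ℝ ∞ (w i)) : SmoothFun d d :=
  ⟨fun z => ∏ i, w i (coord i z), contDiff_prod fun i _ => (hw i).comp (coord i).contDiff⟩

lemma prodFun_apply (w : Fin d ⊕ Fin d → ℝ → ℂ) (hw : ∀ i, ContDiff ℝ ∞ (w i))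
    (z : PhaseSpace d d) : prodFun w hw z = ∏ i, w i (coord i z) := rfl

lemma contDiff_iteratedDeriv_infty {w : ℝ → ℂ} (hw : ContDiff ℝ ∞ w) (n : ℕ) :
    ContDiff ℝ ∞ (iteratedDeriv n w) := by
  induction n with
  | zero => simpa using hw
  | succ n ih => rw [iteratedDeriv_succ]; exact (contDiff_infty_iff_deriv.1 ih).2

lemma pderiv_prodFun (w : Fin d ⊕ Fin d → ℝ → ℂ) (hw : ∀ i, ContDiff ℝ ∞ (w i))
    (j : Fin d ⊕ Fin d) (z : PhaseSpace d d) :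
    pderiv (bvec j) (prodFun w hw) z =
      deriv (w j) (coord j z) * ∏ i ∈ Finset.univ.erase j, w i (coord i z) := by
  rw [pderiv_apply, ← (prodFun w hw).differentiable.differentiableAt.lineDeriv_eq_fderiv]
  refine HasLineDerivAt.lineDeriv ?_
  have h1 : ∀ t : ℝ, (prodFun w hw).1 (z + t • bvec j) =
      w j (coord j z + t) * ∏ i ∈ Finset.univ.erase j, w i (coord i z) := by
    intro t
    change ∏ i, w i (coord i (z + t • bvec j)) = _
    rw [← Finset.mul_prod_erase _ _ (Finset.mem_univ j)]
    congr 1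
    · simp [coord_bvec]
    · refine Finset.prod_congr rfl fun i hi => ?_
      simp [coord_bvec, Finset.ne_of_mem_erase hi]
  have h2 : HasDerivAt (fun t : ℝ => w j (coord j z + t) *
      ∏ i ∈ Finset.univ.erase j, w i (coord i z))
      (deriv (w j) (coord j z) * ∏ i ∈ Finset.univ.erase j, w i (coord i z)) 0 := by
    refine HasDerivAt.mul_const ?_ _
    have h3 := ((hw j).differentiable (by simp) (coord j z + 0)).hasDerivAt.comp_const_add
      (coord j z) 0
    rwa [add_zero] at h3
  exact h2.congr_of_eventuallyEq (Eventually.of_forall fun t => h1 t)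

lemma mder_prodFun (w : Fin d ⊕ Fin d → ℝ → ℂ) (hw : ∀ i, ContDiff ℝ ∞ (w i))
    (γ : Fin d ⊕ Fin d → ℕ) : mder γ (prodFun w hw) =
      prodFun (fun i => iteratedDeriv (γ i) (w i))
        fun i => contDiff_iteratedDeriv_infty (hw i) (γ i) := by
  induction γ using multiindex_induction with
  | h0 => rw [mder_zero]; refine SmoothFun.ext fun z => ?_; simp [prodFun_apply]
  | hs γ j ih =>
    rw [mder_add_single', ih]
    refine SmoothFun.ext fun z => ?_
    rw [pderiv_prodFun, prodFun_apply, ← Finset.mul_prod_erase _ _ (Finset.mem_univ j),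
      ← iteratedDeriv_succ]
    congr 1
    · simp
    · refine Finset.prod_congr rfl fun i hi => ?_
      simp [Finset.ne_of_mem_erase hi]

lemma symbolBound_prodFun {h a : ℝ} {w : Fin d ⊕ Fin d → ℝ → ℂ} (hw : ∀ i, ContDiff ℝ ∞ (w i))
    {C : Fin d ⊕ Fin d → ℝ} (H : ∀ i, DecayBound (τ i) (θ i) h a (C i) (w i)) :
    SymbolBound τ θ h (-a) (∏ i, C i) (prodFun w hw) := by
  intro γ z
  rw [mder_prodFun]
  change ‖∏ i, iteratedDeriv (γ i) (w i) (coord i z)‖ ≤ _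
  rw [norm_prod]
  refine (Finset.prod_le_prod (fun _ _ => norm_nonneg _) fun i _ => H i (γ i) (coord i z)).trans
    (le_of_eq ?_)
  rw [Finset.prod_mul_distrib, Finset.prod_mul_distrib, ← Real.exp_sum, ← Finset.mul_sum]
  rfl

/-- The integer translates of `w` form a partition of unity. -/
def IsPartition (w : SmoothFun d d) : Prop :=
  ∀ z, HasSum (fun k : Fin d ⊕ Fin d → ℤ => w (z - lat k)) 1

/-- Absolute convergence in each variable turns the product of the one-variable sums into a sum over
the lattice. -/
lemma isPartition_prodFun {w : Fin d ⊕ Fin d → ℝ → ℂ} (hw : ∀ i, ContDiff ℝ ∞ (w i))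
    (hs : ∀ i t, HasSum (fun k : ℤ => w i (t - k)) 1) : IsPartition (prodFun w hw) := by
  intro z
  obtain ⟨h1, h2⟩ := summable_norm_prod (fun (i : Fin d ⊕ Fin d) (k : ℤ) => w i (coord i z - k))
    fun i => (hs i _).summable.norm
  have h3 := h1.of_norm.hasSum
  rw [h2] at h3
  simp only [fun i => (hs i (coord i z)).tsum_eq, Finset.prod_const_one] at h3
  refine (funext fun k => ?_ : (fun k => (prodFun w hw).1 (z - lat k)) = _) ▸ h3
  change ∏ i, w i (coord i (z - lat k)) = _
  simp only [map_sub, coord_lat]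

lemma exists_window_roumieu (hτ : ∀ i, 0 < τ i) (hθ : ∀ i, 0 < θ i)
    (hτθ : ∀ i, 1 ≤ τ i + θ i) : ∃ w : SmoothFun d d, IsPartition w ∧
      ∃ h a M : ℝ, 0 < h ∧ 0 < a ∧ SymbolBound τ θ h (-a) M w := by
  choose w hw hs h a hh ha H using fun i => exists_partition_roumieu (hτ i) (hθ i) (hτθ i)
  -- The one-variable windows have their own scales and rates; a common larger scale and smaller
  -- rate serve all coordinates.
  have hev : ∀ᶠ h' : ℝ in atTop, ∀ i, h i ≤ h' :=
    Filter.eventually_all.2 fun i => eventually_ge_atTop _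
  have hev2 : ∀ᶠ a' : ℝ in nhdsWithin 0 (Set.Ioi 0), ∀ i, a' ≤ a i :=
    Filter.eventually_all.2 fun i => Filter.Eventually.filter_mono nhdsWithin_le_nhds
      (eventually_le_nhds (ha i))
  obtain ⟨h', hh', hh0⟩ := (hev.and (eventually_gt_atTop 0)).exists
  obtain ⟨a', ha', ha0⟩ := (hev2.and self_mem_nhdsWithin).exists
  choose C hC using fun i => H i h' a' (hh' i) ha0 (ha' i)
  exact ⟨prodFun w hw, isPartition_prodFun hw hs, h', a', _, hh0, ha0,
    symbolBound_prodFun hw hC⟩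

lemma exists_window_beurling (hτ : ∀ i, 0 < τ i) (hθ : ∀ i, 0 < θ i)
    (hτθ : ∀ i, 1 < τ i + θ i) : ∃ w : SmoothFun d d, IsPartition w ∧
      ∀ h a : ℝ, 0 < h → 0 < a → ∃ M, SymbolBound τ θ h (-a) M w := by
  choose w hw hs H using fun i => exists_partition_beurling (hτ i) (hθ i) (hτθ i)
  refine ⟨prodFun w hw, isPartition_prodFun hw hs, fun h a hh ha => ?_⟩
  choose C hC using fun i => H i h a hh ha
  exact ⟨_, symbolBound_prodFun hw hC⟩

lemma summable_exp_neg_grow_lat (hθ : ∀ i, 0 < θ i) {a : ℝ} (ha : 0 < a) :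
    Summable fun k : Fin d ⊕ Fin d → ℤ => Real.exp (-a * grow θ (lat k)) := by
  have h1 := (summable_norm_prod (fun (i : Fin d ⊕ Fin d) (k : ℤ) =>
    ((Real.exp (-a * |(k : ℝ)| ^ (1 / θ i)) : ℝ) : ℂ)) fun i =>
      (summable_exp_neg_int_rpow (hθ i) ha).congr fun k => by
        rw [Complex.norm_real, Real.norm_eq_abs, abs_of_pos (Real.exp_pos _)]).1
  refine h1.congr fun k => ?_
  rw [norm_prod, grow, Finset.mul_sum, Real.exp_sum]
  refine Finset.prod_congr rfl fun i _ => ?_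
  rw [coord_lat, Complex.norm_real, Real.norm_eq_abs, abs_of_pos (Real.exp_pos _)]

end Windows

/-! ## The operator on symbols -/

section SymbolOperator

open SmoothFun Filter

variable {d : ℕ} {τ θ : Fin d ⊕ Fin d → ℝ} (A : Matrix (Fin d) (Fin d) ℝ) (w : SmoothFun d d)

/-- The function `z ↦ f(z + k) w(z)`. -/
def windowed (f : SmoothFun d d) (k : PhaseSpace d d) : SmoothFun d d := mulL (shift k f) w

/-- The image of `z ↦ f(z) w(z - k)` under `e^{i⟨AD_ξ,D_x⟩}`. -/
def symbolTerm (f : SmoothFun d d) (k : Fin d ⊕ Fin d → ℤ) : SmoothFun d d :=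
  shift (-lat k) (ofSchwartz (expAD A (schwartzOf (windowed w f (lat k)))))

open Classical in
/-- The operator `e^{i⟨AD_ξ,D_x⟩}` on functions of moderate growth, defined with the help of the
partition of unity given by `w`. -/
def symbolOp (f : SmoothFun d d) : SmoothFun d d :=
  if h : LocSummable (symbolTerm A w f) then h.sum else 0

variable {A w}

/-- The translate of f by k has the same bounds near the origin up to exp(c r `grow` k), and the
fixed window supplies the decay. Scale and decay rate are thus independent of k. -/
lemma SymbolBound.windowed {h r M h₀ a M₀ : ℝ} {f : SmoothFun d d} (hτ : ∀ i, 0 ≤ τ i)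
    (hθ : ∀ i, 0 < θ i) (hh : 0 ≤ h) (hh₀ : 0 ≤ h₀) (hr : 0 ≤ r) (hf : SymbolBound τ θ h r M f)
    (hw : SymbolBound τ θ h₀ (-a) M₀ w) (k : PhaseSpace d d) :
    SymbolBound τ θ (h + h₀) (-(a - growConst θ * r))
      (M * Real.exp (growConst θ * r * grow θ k) * M₀) (windowed w f k) :=
  ((hf.shift hθ hh hr k).mul hτ hh hh₀ hw).mono (by positivity) le_rfl (by linarith) le_rfl

/-- Decay around k is traded for growth in z through `grow` k ≤ c (`grow` z + `grow` (z - k)). The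
reward is a constant decaying in k, which makes sums over the lattice converge. -/
lemma SymbolBound.shift_neg_of_decay {h a a' M : ℝ} {f : SmoothFun d d} (hθ : ∀ i, 0 < θ i)
    (hh : 0 ≤ h) (hf : SymbolBound τ θ h (-a) M f) (ha' : 0 ≤ a') (haa : a' ≤ a)
    (k : PhaseSpace d d) :
    SymbolBound τ θ h a' (M * Real.exp (-(a' / growConst θ) * grow θ k)) (SmoothFun.shift (-k) f) := by
  intro γ z
  have hM := hf.nonneg
  have hw := wt_nonneg (τ := τ) hh γ
  have hc : 0 < growConst θ := zero_lt_one.trans_le (one_le_growConst θ)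
  rw [mder_shift, shift_apply]
  refine (hf γ (z + -k)).trans ?_
  have h1 : grow θ k ≤ growConst θ * (grow θ z + grow θ (z + -k)) := by
    have := grow_sub_le hθ z (z + -k)
    rwa [sub_add_eq_sub_sub, sub_self, zero_sub, neg_neg] at this
  have h2 := grow_nonneg θ (z + -k)
  have h3 : -a * grow θ (z + -k) ≤ -(a' / growConst θ) * grow θ k + a' * grow θ z := by
    have h4 : a' / growConst θ * grow θ k ≤ a' * (grow θ z + grow θ (z + -k)) := by
      calc _ ≤ a' / growConst θ * (growConst θ * (grow θ z + grow θ (z + -k))) := by gcongr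
        _ = _ := by field_simp
    nlinarith
  calc M * wt τ h γ * Real.exp (-a * grow θ (z + -k)) ≤ M * wt τ h γ *
        Real.exp (-(a' / growConst θ) * grow θ k + a' * grow θ z) := by gcongr
    _ = _ := by rw [Real.exp_add]; ring

/-- The exponent in k is the balance between the gain a''/c of `shift_neg_of_decay` and the loss c r
from translating f, where c is `growConst`. -/
lemma symbolBound_symbolTerm {h r M h₀ a M₀ h₁ a' a'' C : ℝ} {f : SmoothFun d d}
    (hτ : ∀ i, 0 ≤ τ i) (hθ : ∀ i, 0 < θ i) (hh : 0 ≤ h) (hh₀ : 0 ≤ h₀) (hh₁ : 0 ≤ h₁) (hr : 0 ≤ r)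
    (hf : SymbolBound τ θ h r M f) (hw : SymbolBound τ θ h₀ (-a) M₀ w)
    (hra : growConst θ * r < a)
    (hT : ∀ (u : 𝓢(PhaseSpace d d, ℂ)) (N : ℝ),
      SymbolBound τ θ (h + h₀) (-(a - growConst θ * r)) N (ofSchwartz u) →
      SymbolBound τ θ h₁ (-a') (C * N) (ofSchwartz (expAD A u)))
    (ha'' : 0 ≤ a'') (haa : a'' ≤ a') (k : Fin d ⊕ Fin d → ℤ) :
    SymbolBound τ θ h₁ a'' (C * M * M₀ *
      Real.exp (-(a'' / growConst θ - growConst θ * r) * grow θ (lat k))) (symbolTerm A w f k) := by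
  have h1 := SymbolBound.windowed hτ hθ hh hh₀ hr hf hw (lat k)
  have h2 := h1.ofSchwartz_schwartzOf hθ (by positivity) (sub_pos.2 hra)
  have h3 := (hT _ _ (by rw [h2]; exact h1)).shift_neg_of_decay hθ hh₁ ha'' haa (lat k)
  refine h3.mono hh₁ le_rfl le_rfl (le_of_eq ?_)
  rw [neg_sub, sub_mul, sub_eq_add_neg, Real.exp_add, ← neg_mul]
  ring

/-- The pairing of `F` with a test function is the pairing of `f` with the image of the test
function under `e^{i⟨AD_ξ,D_x⟩}`, for `f`, `F` of growth `r`, `R`. -/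
def IsTransform (A : Matrix (Fin d) (Fin d) ℝ) (θ : Fin d ⊕ Fin d → ℝ) (r R : ℝ)
    (f F : SmoothFun d d) : Prop :=
  ∀ (u : 𝓢(PhaseSpace d d, ℂ)) (N N' b b' : ℝ), R < b → r < b' →
    (∀ z, ‖u z‖ ≤ N * Real.exp (-b * grow θ z)) →
    (∀ z, ‖expAD A u z‖ ≤ N' * Real.exp (-b' * grow θ z)) →
    ∫ z, F z * u z = ∫ z, f z * expAD A u z

lemma IsTransform.mono {r R R' : ℝ} {f F : SmoothFun d d} (h : IsTransform A θ r R f F)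
    (hR : R ≤ R') : IsTransform A θ r R' f F :=
  fun u N N' b b' hb => h u N N' b b' (hR.trans_lt hb)

lemma integral_tsum_mul {K : Type*} [Countable K] (hθ : ∀ i, 0 < θ i)
    {G : K → PhaseSpace d d → ℂ} {u : PhaseSpace d d → ℂ} {m : K → ℝ} {R b N : ℝ}
    (hG : ∀ k, Continuous (G k)) (hu : Continuous u) (hm : Summable m) (hR : R < b)
    (hGb : ∀ k z, ‖G k z‖ ≤ m k * Real.exp (R * grow θ z))
    (hub : ∀ z, ‖u z‖ ≤ N * Real.exp (-b * grow θ z)) :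
    ∫ z, (∑' k, G k z) * u z = ∑' k, ∫ z, G k z * u z := by
  have h1 := fun k => integrable_mul_of_growth hθ hR (hG k) hu (hGb k) hub
  have h2 := fun k => integrable_mul_of_growth hθ hR (f := fun z => (‖G k z‖ : ℂ))
    (g := fun z => (‖u z‖ : ℂ)) (Complex.continuous_ofReal.comp (hG k).norm)
    (Complex.continuous_ofReal.comp hu.norm) (by simpa using hGb k) (by simpa using hub)
  rw [integral_tsum_of_summable_integral_norm (fun k => (h1 k).1)]
  · exact integral_congr_ae (Eventually.of_forall fun z => tsum_mul_right.symm)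
  · refine Summable.of_nonneg_of_le (fun k => by positivity) (fun k => ?_)
      ((hm.mul_right N).mul_right (∫ z : PhaseSpace d d, Real.exp (-(b - R) * grow θ z)))
    refine le_trans (le_of_eq ?_) (h2 k).2
    have h3 : ∫ z, (‖G k z‖ : ℂ) * (‖u z‖ : ℂ) = ((∫ z, ‖G k z * u z‖ : ℝ) : ℂ) := by
      rw [← integral_complex_ofReal]
      exact integral_congr_ae (Eventually.of_forall fun z => by simp)
    rw [h3, Complex.norm_real, Real.norm_eq_abs, abs_of_nonneg (by positivity)]

/-- Translate the integral to the origin, use the symmetry of the operator on Schwartz functions,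
and translate back; the operator commutes with translations. -/
lemma integral_symbolTerm_mul {f : SmoothFun d d} {k : Fin d ⊕ Fin d → ℤ}
    (h : ofSchwartz (schwartzOf (windowed w f (lat k))) = windowed w f (lat k))
    (u : 𝓢(PhaseSpace d d, ℂ)) :
    ∫ z, symbolTerm A w f k z * u z = ∫ z, f z * w (z - lat k) * expAD A u z := by
  set p := schwartzOf (windowed w f (lat k)) with hp
  set v : 𝓢(PhaseSpace d d, ℂ) := SchwartzMap.compSubConstCLM ℂ (-lat k) u with hv
  have hv' : ∀ z, v z = u (z + lat k) := fun z => by simp [hv]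
  have h1 : ∫ z, symbolTerm A w f k z * u z = ∫ z, expAD A p z * v z := by
    rw [← integral_sub_right_eq_self (fun z => expAD A p z * v z) (lat k)]
    refine integral_congr_ae (Eventually.of_forall fun z => ?_)
    simp only [hv', sub_add_cancel]
    rw [sub_eq_add_neg]
    rfl
  have h2 : ∀ z, p z = f (z + lat k) * w z := fun z => congrArg (fun g : SmoothFun d d => g.1 z) h
  rw [h1, integral_expAD_mul,
    ← integral_sub_right_eq_self (fun z => p z * expAD A v z) (lat k)]
  refine integral_congr_ae (Eventually.of_forall fun z => ?_)
  simp only [h2, expAD_translate A (lat k) hv', sub_add_cancel]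

lemma IsPartition.tsum_mul (hw : IsPartition w) (f : SmoothFun d d) (z : PhaseSpace d d) :
    ∑' k, f z * w (z - lat k) = f z := by
  rw [tsum_mul_left, (hw z).tsum_eq, mul_one]

lemma isTransform_sum {r M h₀ a M₀ R : ℝ} {f : SmoothFun d d} (hθ : ∀ i, 0 < θ i) (hh₀ : 0 ≤ h₀)
    (ha : 0 < a) (hP : IsPartition w) (hf : ∀ z, ‖f z‖ ≤ M * Real.exp (r * grow θ z))
    (hw : SymbolBound τ θ h₀ (-a) M₀ w)
    (hp : ∀ k, ofSchwartz (schwartzOf (windowed w f (lat k))) = windowed w f (lat k))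
    {m : (Fin d ⊕ Fin d → ℤ) → ℝ} (hm : Summable m)
    (hb : ∀ k z, ‖symbolTerm A w f k z‖ ≤ m k * Real.exp (R * grow θ z))
    (hl : LocSummable (symbolTerm A w f)) : IsTransform A θ r R f hl.sum := by
  intro u N N' b b' hRb hrb hu hTu
  have hc : 0 < growConst θ := zero_lt_one.trans_le (one_le_growConst θ)
  have h1 := integral_tsum_mul hθ (G := fun k z => symbolTerm A w f k z)
    (fun k => (symbolTerm A w f k).continuous) u.continuous hm hRb hb hu
  -- Only part of the window's decay is spent on summability in k, so that the total growth r + a₁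
  -- stays below the decay b' of the transformed test function.
  set a₁ := min a ((b' - r) / 2) with ha₁
  have ha₁0 : 0 < a₁ := lt_min ha (half_pos (sub_pos.2 hrb))
  have hM : 0 ≤ M := nonneg_of_mul_nonneg_left ((norm_nonneg _).trans (hf 0)) (Real.exp_pos _)
  have hM₀ := hw.nonneg
  have h2 := integral_tsum_mul hθ (G := fun k z => f z * w (z - lat k)) (u := expAD A u)
    (m := fun k => M * (M₀ * Real.exp (-(a₁ / growConst θ) * grow θ (lat k)))) (R := r + a₁)
    (fun k => f.continuous.mul (w.continuous.comp (continuous_id.sub continuous_const)))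
    (expAD A u).continuous
    (((summable_exp_neg_grow_lat hθ (by positivity)).mul_left M₀).mul_left M)
    (by linarith [min_le_right a ((b' - r) / 2)]) (fun k z => by
      have h3 := (hw.shift_neg_of_decay hθ hh₀ ha₁0.le (min_le_left _ _) (lat k)).norm_le z
      rw [shift_apply, ← sub_eq_add_neg] at h3
      rw [norm_mul, add_mul, Real.exp_add]
      calc _ ≤ (M * Real.exp (r * grow θ z)) * (M₀ * Real.exp (-(a₁ / growConst θ) *
            grow θ (lat k)) * Real.exp (a₁ * grow θ z)) :=
              mul_le_mul (hf z) h3 (norm_nonneg _) (by positivity)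
        _ = _ := by ring) hTu
  have h3 : ∀ z, ∑' k, (f z * w (z - lat k)) = f z := hP.tsum_mul f
  rw [integral_congr_ae (Eventually.of_forall fun z => by
    change _ = (∑' k, f z * w (z - lat k)) * expAD A u z
    rw [h3] : (fun z => f z * expAD A u z) =ᵐ[volume] _), h2, ← tsum_congr fun k =>
      integral_symbolTerm_mul (hp k) u]
  exact h1

lemma exists_symbolOp_bound {h r h₀ a M₀ h₁ a' a'' C : ℝ}
    (hτ : ∀ i, 0 ≤ τ i) (hθ : ∀ i, 0 < θ i) (hh : 0 ≤ h) (hh₀ : 0 ≤ h₀) (hh₁ : 0 ≤ h₁) (hr : 0 ≤ r)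
    (hP : IsPartition w) (hw : SymbolBound τ θ h₀ (-a) M₀ w) (hra : growConst θ * r < a)
    (hT : ∀ (u : 𝓢(PhaseSpace d d, ℂ)) (N : ℝ),
      SymbolBound τ θ (h + h₀) (-(a - growConst θ * r)) N (ofSchwartz u) →
      SymbolBound τ θ h₁ (-a') (C * N) (ofSchwartz (expAD A u)))
    (ha'' : 0 ≤ a'') (haa : a'' ≤ a') (hδ : growConst θ * r < a'' / growConst θ) :
    ∃ C' : ℝ, ∀ (f : SmoothFun d d) (M : ℝ), SymbolBound τ θ h r M f →
      IsTransform A θ r a'' f (symbolOp A w f) ∧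
        SymbolBound τ θ h₁ a'' (C' * M) (symbolOp A w f) := by
  have hs := summable_exp_neg_grow_lat (d := d) hθ (sub_pos.2 hδ)
  refine ⟨C * M₀ * ∑' k : Fin d ⊕ Fin d → ℤ,
    Real.exp (-(a'' / growConst θ - growConst θ * r) * grow θ (lat k)), fun f M hf => ?_⟩
  have hb := symbolBound_symbolTerm hτ hθ hh hh₀ hh₁ hr hf hw hra hT ha'' haa
  have hl : LocSummable (symbolTerm A w f) := locSummable_of_symbolBound hθ (hs.mul_left _) hb
  rw [symbolOp, dif_pos hl]
  have hc : 0 < growConst θ := zero_lt_one.trans_le (one_le_growConst θ)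
  refine ⟨isTransform_sum hθ hh₀ ((mul_nonneg hc.le hr).trans_lt hra) hP hf.norm_le hw
    (fun k => (SymbolBound.windowed hτ hθ hh hh₀ hr hf hw (lat k)).ofSchwartz_schwartzOf hθ
      (by positivity) (sub_pos.2 hra)) (hs.mul_left _) (fun k => (hb k).norm_le) hl, ?_⟩
  refine (hl.symbolBound_sum (hs.mul_left _) hb).mono hh₁ le_rfl le_rfl (le_of_eq ?_)
  rw [tsum_mul_left]
  ring

/-- The new scale depends on h but not on R, while r is chosen after R. This order of quantifiers is
the one demanded by an inductive limit of projective limits. -/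
lemma exists_symbolOp_roumieu {h₀ a M₀ T : ℝ} (hτ : ∀ i, 0 ≤ τ i) (hT : ∀ i, τ i ≤ T)
    (hθ : ∀ i, 0 < θ i) (hτθ : ∀ i, 1 ≤ τ i + θ i)
    (hA : ∀ i l, coord l (twistVec A i) = 0 ∨ τ l = θ i) (hh₀ : 0 ≤ h₀) (ha : 0 < a)
    (hP : IsPartition w) (hw : SymbolBound τ θ h₀ (-a) M₀ w) {h R : ℝ} (hh : 0 ≤ h) (hR : 0 < R) :
    ∃ r : ℝ, 0 < r ∧ r ≤ R ∧ ∃ C : ℝ, ∀ (f : SmoothFun d d) (M : ℝ), SymbolBound τ θ h r M f →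
      IsTransform A θ r R f (symbolOp A w f) ∧
        SymbolBound τ θ (2 ^ T * (h + h₀)) R (C * M) (symbolOp A w f) := by
  have hc : 0 < growConst θ := zero_lt_one.trans_le (one_le_growConst θ)
  obtain ⟨a', ha', C, hC, H⟩ := exists_expAD_symbolBound_roumieu (A := A) hτ hT hθ hτθ hA
    (add_nonneg hh hh₀) (half_pos ha)
  set a'' := min a' R with ha''
  have ha0 : 0 < a'' := lt_min ha' hR
  -- The bound by a/2 leaves decay a/2 after translating the symbol; the other bound makes the
  -- lattice sum converge.
  set r := min (a'' / growConst θ / 2) (a / 2) / growConst θ with hr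
  have hr0 : 0 < r := by positivity
  have hcr : growConst θ * r = min (a'' / growConst θ / 2) (a / 2) := mul_div_cancel₀ _ hc.ne'
  have h1 : growConst θ * r ≤ a'' / growConst θ / 2 := hcr ▸ min_le_left _ _
  have h2 : growConst θ * r ≤ a / 2 := hcr ▸ min_le_right _ _
  have h3 : 0 < a'' / growConst θ := by positivity
  obtain ⟨C', HC⟩ := exists_symbolOp_bound (h₁ := 2 ^ T * (h + h₀)) (a'' := a'') hτ hθ hh hh₀
    (by positivity) hr0.le hP hw (by linarith)
    (fun u N hu => H u N (hu.mono (by positivity) le_rfl (by linarith) le_rfl)) ha0.le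
    (min_le_left _ _) (by linarith)
  have h4 : r ≤ R := by
    have h5 : r ≤ growConst θ * r := le_mul_of_one_le_left hr0.le (one_le_growConst θ)
    have h6 : a'' / growConst θ ≤ a'' := div_le_self ha0.le (one_le_growConst θ)
    linarith [min_le_right a' R]
  exact ⟨r, hr0, h4, C', fun f M hf =>
    ⟨(HC f M hf).1.mono (min_le_right _ _),
      (HC f M hf).2.mono (by positivity) le_rfl (min_le_right _ _) le_rfl⟩⟩

lemma exists_symbolOp_beurling {T : ℝ} (hτ : ∀ i, 0 ≤ τ i) (hT : ∀ i, τ i ≤ T)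
    (hθ : ∀ i, 0 < θ i) (hτθ : ∀ i, 1 ≤ τ i + θ i)
    (hA : ∀ i l, coord l (twistVec A i) = 0 ∨ τ l = θ i)
    (hP : IsPartition w) (hw : ∀ h a : ℝ, 0 < h → 0 < a → ∃ M, SymbolBound τ θ h (-a) M w)
    {r R h₁ : ℝ} (hr : 0 < r) (hrR : growConst θ * (growConst θ * r) < R) (hh₁ : 0 < h₁) :
    ∃ h : ℝ, 0 < h ∧ ∃ C : ℝ, ∀ (f : SmoothFun d d) (M : ℝ), SymbolBound τ θ h r M f →
      IsTransform A θ r R f (symbolOp A w f) ∧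
        SymbolBound τ θ h₁ R (C * M) (symbolOp A w f) := by
  have hc : 0 < growConst θ := zero_lt_one.trans_le (one_le_growConst θ)
  have hR : 0 < R := lt_trans (by positivity) hrR
  obtain ⟨η, hη, a, ha, H⟩ := exists_expAD_symbolBound_beurling (A := A) hτ hT hθ hτθ hA hR
  -- Half for the symbol and half for the window: the scales add in the product, and the operator
  -- multiplies the sum by 2^T.
  set h := min η (h₁ / 2 ^ T) / 2 with hh
  have hh0 : 0 < h := by positivity
  have h1 : h + h = min η (h₁ / 2 ^ T) := by rw [hh]; ring
  obtain ⟨C, hC, H'⟩ := H (h + h) (by positivity) (h1 ▸ min_le_left _ _)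
  obtain ⟨M₀, hM₀⟩ := hw h (a + growConst θ * r) hh0 (by positivity)
  obtain ⟨C', HC⟩ := exists_symbolOp_bound (h₁ := 2 ^ T * (h + h)) (a'' := R) hτ hθ hh0.le hh0.le
    (by positivity) hr.le hP hM₀ (by linarith)
    (fun u N hu => H' u N (hu.mono (by positivity) le_rfl (by linarith) le_rfl)) hR.le
    le_rfl (by rwa [lt_div_iff₀' hc])
  refine ⟨h, hh0, C', fun f M hf => ⟨(HC f M hf).1,
    (HC f M hf).2.mono (by positivity) ?_ le_rfl le_rfl⟩⟩
  rw [h1, ← le_div_iff₀' (by positivity)]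
  exact min_le_right _ _

lemma SymbolBound.shift_of_decay {h a M : ℝ} {f : SmoothFun d d} (hθ : ∀ i, 0 < θ i)
    (hh : 0 ≤ h) (ha : 0 ≤ a) (hf : SymbolBound τ θ h (-a) M f) (k : PhaseSpace d d) :
    SymbolBound τ θ h (-(a / growConst θ)) (M * Real.exp (a * grow θ k)) (SmoothFun.shift k f) := by
  intro γ z
  have hM := hf.nonneg
  have hw := wt_nonneg (τ := τ) hh γ
  have hc : 0 < growConst θ := zero_lt_one.trans_le (one_le_growConst θ)
  rw [mder_shift, shift_apply]
  refine (hf γ (z + k)).trans ?_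
  have h1 : grow θ z ≤ growConst θ * (grow θ (z + k) + grow θ k) := by
    simpa using grow_sub_le hθ (z + k) k
  have h3 : -a * grow θ (z + k) ≤ a * grow θ k + -(a / growConst θ) * grow θ z := by
    have h4 : a / growConst θ * grow θ z ≤ a * (grow θ (z + k) + grow θ k) := by
      calc _ ≤ a / growConst θ * (growConst θ * (grow θ (z + k) + grow θ k)) := by gcongr
        _ = _ := by field_simp
    linarith
  calc M * wt τ h γ * Real.exp (-a * grow θ (z + k)) ≤ M * wt τ h γ *
        Real.exp (a * grow θ k + -(a / growConst θ) * grow θ z) := by gcongr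
    _ = _ := by rw [Real.exp_add]; ring

/-- A test function which detects `f` near the lattice point `k`. -/
def detector (w f : SmoothFun d d) (k : Fin d ⊕ Fin d → ℤ) : SmoothFun d d :=
  SmoothFun.shift (-lat k) (mulL (SmoothFun.conj (windowed w f (lat k))) w)

lemma symbolBound_detector {h r M h₀ a M₀ : ℝ} {f : SmoothFun d d} (hτ : ∀ i, 0 ≤ τ i)
    (hθ : ∀ i, 0 < θ i) (hh : 0 ≤ h) (hh₀ : 0 ≤ h₀) (hr : 0 ≤ r) (hf : SymbolBound τ θ h r M f)
    (hw : SymbolBound τ θ h₀ (-a) M₀ w) (hra : growConst θ * r ≤ a) (k : Fin d ⊕ Fin d → ℤ) :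
    ∃ M', SymbolBound τ θ (h + h₀ + h₀) (-(a / growConst θ)) M' (detector w f k) := by
  have h1 := (SymbolBound.windowed hτ hθ hh hh₀ hr hf hw (lat k)).conj.mul hτ (by positivity) hh₀ hw
  have hc : 0 < growConst θ := zero_lt_one.trans_le (one_le_growConst θ)
  exact ⟨_, (h1.mono (r' := -a) (by positivity) le_rfl (by linarith) le_rfl).shift_of_decay hθ
    (by positivity) ((mul_nonneg hc.le hr).trans hra) _⟩

/-- f times its detector is |f w(·-k)|², so a vanishing integral forces f w(·-k) = 0 by continuity;
summing over the partition of unity gives f = 0. -/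
lemma eq_zero_of_integral_detector {f : SmoothFun d d} (hP : IsPartition w)
    (hi : ∀ k, Integrable fun z => f z * detector w f k z)
    (h0 : ∀ k, ∫ z, f z * detector w f k z = 0) : f = 0 := by
  have h1 : ∀ k z, f z * detector w f k z = ((‖f z * w (z - lat k)‖ ^ 2 : ℝ) : ℂ) := by
    intro k z
    have h2 : detector w f k z = (starRingEnd ℂ) (f z * w (z - lat k)) * w (z - lat k) := by
      have h3 : z + -lat k + lat k = z := by abel
      change (starRingEnd ℂ) (f.1 (z + -lat k + lat k) * w.1 (z + -lat k)) * w.1 (z + -lat k) = _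
      rw [h3, ← sub_eq_add_neg]
    rw [h2, ← Complex.normSq_eq_norm_sq, ← Complex.mul_conj]
    ring
  refine SmoothFun.ext fun z => ?_
  have h2 : ∀ k, f z * w (z - lat k) = 0 := by
    intro k
    have hc : Continuous fun z => ‖f z * w (z - lat k)‖ ^ 2 :=
      ((f.continuous.mul (w.continuous.comp (continuous_id.sub continuous_const))).norm).pow 2
    have h3 : ∫ z, ‖f z * w (z - lat k)‖ ^ 2 = 0 := by
      have := h0 k
      simp only [h1, integral_complex_ofReal] at this
      exact_mod_cast this
    have h4 : Integrable fun z => ‖f z * w (z - lat k)‖ ^ 2 := by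
      have := (hi k).re
      refine this.congr (Filter.Eventually.of_forall fun z => ?_)
      exact (congrArg Complex.re (h1 k z)).trans (Complex.ofReal_re _)
    have h5 := (integral_eq_zero_iff_of_nonneg (fun z => by positivity) h4).1 h3
    have h6 := congrFun ((hc.ae_eq_iff_eq volume continuous_const).1 h5) z
    have h7 : ‖f z * w (z - lat k)‖ ^ 2 = 0 := h6
    exact norm_eq_zero.1 (pow_eq_zero_iff two_ne_zero |>.1 h7)
  have h3 := hP.tsum_mul f z
  simp only [h2, tsum_zero] at h3
  exact h3.symm

end SymbolOperator

/-! ## Continuity of linear maps on limits of normed spaces -/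

section Continuity

variable {ι ι' κ κ' E : Type*} [AddCommGroup E] [Module ℂ E]

/-- The auxiliary map j allows the domain to carry a topology finer than that of a single norm, as
for projective limits. -/
lemma continuous_boundedSubspace_of_le {V : Type*} [AddCommGroup V] [Module ℂ V]
    [TopologicalSpace V] (q : ι → Seminorm ℂ E) (q' : ι' → Seminorm ℂ E)
    (T : V →ₗ[ℂ] boundedSubspace q') (j : V →ₗ[ℂ] boundedSubspace q) (hj : Continuous j) (C : ℝ)
    (H : ∀ x N, (∀ i, q i (j x) ≤ N) → ∀ i, q' i (T x) ≤ C * N) : Continuous T := by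
  let := (supSeminorm q).toAddGroupSeminorm.toSeminormedAddCommGroup
  let := (supSeminorm q').toAddGroupSeminorm.toSeminormedAddCommGroup
  refine continuous_iff_continuousAt.2 fun x => ?_
  have h1 : Filter.Tendsto (fun y => |C| * dist (j y) (j x)) (nhds x) (nhds 0) := by
    have := (tendsto_iff_dist_tendsto_zero.1 (hj.tendsto x)).const_mul |C|
    rwa [mul_zero] at this
  refine tendsto_iff_dist_tendsto_zero.2
    (squeeze_zero (fun _ => dist_nonneg) (fun y => ?_) h1)
  rw [dist_eq_norm, dist_eq_norm, ← map_sub, ← map_sub]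
  change supSeminorm q' (T (y - x)) ≤ |C| * supSeminorm q (j (y - x))
  refine supSeminorm_le _ (mul_nonneg (abs_nonneg _) (apply_nonneg _ _)) fun i => ?_
  exact (H _ _ (le_supSeminorm q _) i).trans
    (mul_le_mul_of_nonneg_right (le_abs_self C) (apply_nonneg _ _))

lemma continuous_projectiveLimit_of_le (q : κ → ι → Seminorm ℂ E) (q' : κ' → ι' → Seminorm ℂ E)
    (T : (⨅ k, boundedSubspace (q k) : Submodule ℂ E) →ₗ[ℂ]
      (⨅ k, boundedSubspace (q' k) : Submodule ℂ E))
    (H : ∀ k', ∃ k C, ∀ (x : (⨅ k, boundedSubspace (q k) : Submodule ℂ E)) N,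
      (∀ i, q k i (x : E) ≤ N) → ∀ i, q' k' i (T x : E) ≤ C * N) :
    @Continuous _ _
      (projectiveLimitTopology fun k =>
        Submodule.inclusion (iInf_le (fun k => boundedSubspace (q k)) k))
      (projectiveLimitTopology fun k =>
        Submodule.inclusion (iInf_le (fun k => boundedSubspace (q' k)) k)) T := by
  let : TopologicalSpace (⨅ k, boundedSubspace (q k) : Submodule ℂ E) :=
    projectiveLimitTopology fun k =>
      Submodule.inclusion (iInf_le (fun k => boundedSubspace (q k)) k)
  refine continuous_iInf_rng.2 fun k' => continuous_induced_rng.2 ?_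
  obtain ⟨k, C, hC⟩ := H k'
  exact continuous_boundedSubspace_of_le (q k) (q' k')
    (Submodule.inclusion (iInf_le (fun k => boundedSubspace (q' k)) k') ∘ₗ T)
    (Submodule.inclusion (iInf_le (fun k => boundedSubspace (q k)) k))
    (continuous_iInf_dom continuous_induced_dom) C hC

/-- The topology pulled back along T is a locally convex vector topology for which all j_i are
continuous, hence it is among those whose infimum defines the limit topology. -/
lemma continuous_inductiveLimit {F : κ → Type*} [∀ i, TopologicalSpace (F i)] (j : ∀ i, F i → E)
    (T : E →ₗ[ℂ] E) (H : ∀ i, ∃ i', ∃ g : F i → F i', Continuous g ∧ ∀ x, T (j i x) = j i' (g x)) :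
    @Continuous _ _ (inductiveLimitTopology j) (inductiveLimitTopology j) T := by
  rw [continuous_iff_le_induced]
  refine sInf_le ⟨fun i => ?_, ?_, ?_, ?_⟩
  · obtain ⟨i', g, hg, h⟩ := H i
    rw [continuous_induced_rng]
    have h1 : T ∘ j i = j i' ∘ g := funext h
    rw [h1]
    exact continuous_sInf_rng.2 fun t ht => (ht.1 i').comp hg
  · let := inductiveLimitTopology j
    have : IsTopologicalAddGroup E := topologicalAddGroup_sInf fun t ht => ht.2.1
    exact topologicalAddGroup_induced T
  · let := inductiveLimitTopology j
    have : ContinuousSMul ℂ E := continuousSMul_sInf fun t ht => ht.2.2.1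
    exact continuousSMul_induced T
  · let := inductiveLimitTopology j
    have : LocallyConvexSpace ℝ E := LocallyConvexSpace.sInf fun t ht => ht.2.2.2
    exact LocallyConvexSpace.induced (T.restrictScalars ℝ)

end Continuity

/-! ## Transposes and homeomorphisms -/

section Transpose

open SmoothFun

variable {d : ℕ} {S : Submodule ℂ 𝓢(PhaseSpace d d, ℂ)} {D : Set (S →ₗ[ℂ] ℂ)}

/-- The functions `a`, `b` satisfy `∫ b p = ∫ a e^{i⟨AD_ξ,D_x⟩} p` for all test functions `p`. -/
def IsWeakTransform (S : Submodule ℂ 𝓢(PhaseSpace d d, ℂ)) (A : Matrix (Fin d) (Fin d) ℝ)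
    (a b : SmoothFun d d) : Prop :=
  ∀ p ∈ S, ∫ z, b z * p z = ∫ z, a z * expAD A p z

/-- The transpose of the restriction of `e^{i⟨AD_ξ,D_x⟩}` to `S`. -/
def transposeExpAD (A : Matrix (Fin d) (Fin d) ℝ) (hS : ∀ p ∈ S, expAD A p ∈ S)
    (hD : ∀ u ∈ D, u ∘ₗ (expAD A).toLinearMap.restrict hS ∈ D) (u : D) : D :=
  ⟨u.1 ∘ₗ (expAD A).toLinearMap.restrict hS, hD u.1 u.2⟩

lemma isDistributionalExtension_transposeExpAD {A : Matrix (Fin d) (Fin d) ℝ}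
    (hS : ∀ p ∈ S, expAD A p ∈ S)
    (hD : ∀ u ∈ D, u ∘ₗ (expAD A).toLinearMap.restrict hS ∈ D)
    (hψ : ∀ ψ : 𝓢(PhaseSpace d d, ℂ), ∃ u : D, IsGivenBy u.1 ψ) :
    IsDistributionalExtension A (transposeExpAD A hS hD) where
  maps_test := hS
  transpose _ _ := rfl
  extends_schwartz ψ := by
    obtain ⟨u, hu⟩ := hψ ψ
    obtain ⟨v, hv⟩ := hψ (expAD A ψ)
    refine ⟨u, hu, fun p => ⟨(hv p).1, ?_⟩⟩
    rw [integral_expAD_mul]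
    exact (hu ⟨expAD A p, hS p p.2⟩).2

lemma integral_sub_mul {a b p : PhaseSpace d d → ℂ} (ha : Integrable fun z => a z * p z)
    (hb : Integrable fun z => b z * p z) :
    ∫ z, (a z - b z) * p z = (∫ z, a z * p z) - ∫ z, b z * p z := by
  rw [← integral_sub ha hb]
  simp only [sub_mul]

/-- The maps F B are only required to satisfy the weak identity. Linearity, the relation between F A
and F (-A), and the description of the graph all follow because pairings with S separate the
elements of Γ (`huniq`). -/
theorem IsDistributionalExtension.restrictsToHomeomorphism {A : Matrix (Fin d) (Fin d) ℝ}
    {L : D → D} (hL : IsDistributionalExtension A L) {Γ : Submodule ℂ (SmoothFun d d)}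
    [TopologicalSpace Γ] (hS : ∀ p ∈ S, expAD (-A) p ∈ S)
    (hΓ : ∀ a ∈ Γ, ∃ u : D, IsGivenBy u.1 a)
    (huniq : ∀ a ∈ Γ, (∀ p ∈ S, ∫ z, a z * p z = 0) → a = 0)
    (F : Matrix (Fin d) (Fin d) ℝ → SmoothFun d d → SmoothFun d d)
    (hF : ∀ B, ∀ a ∈ Γ, F B a ∈ Γ ∧ IsWeakTransform S B a (F B a))
    (hcont : ∀ (B : Matrix (Fin d) (Fin d) ℝ) (T : Γ →ₗ[ℂ] Γ),
      (∀ a : Γ, (T a : SmoothFun d d) = F B a) → Continuous T) :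
    RestrictsToHomeomorphism L Γ := by
  have hint : ∀ a ∈ Γ, ∀ p ∈ S, Integrable fun z => a z * p z := fun a ha p hp => by
    obtain ⟨u, hu⟩ := hΓ a ha
    exact (hu ⟨p, hp⟩).1
  have hext : ∀ a b : Γ, (∀ p ∈ S, ∫ z, a.1 z * p z = ∫ z, b.1 z * p z) → a = b := by
    intro a b h
    refine Subtype.ext (sub_eq_zero.1 (huniq _ (Γ.sub_mem a.2 b.2) fun p hp => ?_))
    exact (integral_sub_mul (hint a a.2 p hp) (hint b b.2 p hp)).trans (sub_eq_zero.2 (h p hp))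
  have hSB : ∀ B, B = A ∨ B = -A → ∀ p ∈ S, expAD B p ∈ S := by
    rintro B (rfl | rfl)
    · exact hL.maps_test
    · exact hS
  have hT : ∀ B, B = A ∨ B = -A → ∃ T : Γ →ₗ[ℂ] Γ, Continuous T ∧
      ∀ a : Γ, IsWeakTransform S B a (T a) := by
    intro B hB
    have hF' := fun a : Γ => hF B a a.2
    suffices h : ∃ T : Γ →ₗ[ℂ] Γ, ∀ a : Γ, (T a : SmoothFun d d) = F B a by
      obtain ⟨T, hT⟩ := h
      exact ⟨T, hcont B T hT, fun a => by rw [hT]; exact (hF' a).2⟩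
    refine ⟨⟨⟨fun a => ⟨F B a, (hF' a).1⟩, fun a b => hext _ _ fun p hp => ?_⟩,
      fun c a => hext _ _ fun p hp => ?_⟩, fun a => rfl⟩
    · have h1 := hSB B hB p hp
      have h2 : ∫ z, (F B a z + F B b z) * p z = ∫ z, (a.1 z + b.1 z) * expAD B p z := by
        simp only [add_mul]
        rw [integral_add (hint _ (hF' a).1 p hp) (hint _ (hF' b).1 p hp),
          integral_add (hint _ a.2 _ h1) (hint _ b.2 _ h1), (hF' a).2 p hp, (hF' b).2 p hp]
      exact ((hF' (a + b)).2 p hp).trans h2.symm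
    · have h2 : ∫ z, (c * F B a z) * p z = ∫ z, (c * a.1 z) * expAD B p z := by
        simp only [mul_assoc]
        rw [integral_const_mul, integral_const_mul, (hF' a).2 p hp]
      exact ((hF' (c • a)).2 p hp).trans h2.symm
  obtain ⟨T, hTc, hT1⟩ := hT A (Or.inl rfl)
  obtain ⟨T', hTc', hT2⟩ := hT (-A) (Or.inr rfl)
  -- Against a test function the two transforms become `expAD A` after `expAD (-A)`, which is the
  -- identity on Schwartz functions.
  have h1 : ∀ a, T' (T a) = a := fun a => hext _ _ fun p hp => by
    rw [hT2 (T a) p hp, hT1 a _ (hS p hp), expAD_expAD_neg]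
  have h2 : ∀ a, T (T' a) = a := fun a => hext _ _ fun p hp => by
    rw [hT1 (T' a) p hp, hT2 a _ (hL.maps_test p hp), expAD_neg_expAD]
  refine ⟨⟨LinearEquiv.ofLinearMap T T' (LinearMap.ext h2) (LinearMap.ext h1), hTc, hTc'⟩, fun a b => ⟨?_, ?_⟩⟩
  · rintro rfl
    obtain ⟨u, hu⟩ := hΓ a a.2
    obtain ⟨v, hv⟩ := hΓ (T a) (T a).2
    refine ⟨u, hu, fun p => ⟨(hv p).1, ?_⟩⟩
    rw [hL.transpose, (hu _).2]
    exact (hT1 a p p.2).symm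
  · rintro ⟨u, hu, hv⟩
    refine hext _ _ fun p hp => ?_
    have h3 := (hv ⟨p, hp⟩).2
    rw [hL.transpose, (hu _).2] at h3
    exact (hT1 a p hp).trans h3

end Transpose

/-! ## Symbol classes in terms of bounds -/

section SymbolClasses

open SmoothFun

variable {d : ℕ} {s σ : ℝ}

lemma exists_symbolBound_of_mem_symbolStep (hs : 0 < s) (hσ : 0 < σ) {h r : ℝ} (hh : 0 < h)
    (hr : 0 < r) {f : SmoothFun d d} (hf : f ∈ symbolStep d d s σ σ s h r) :
    ∃ M, SymbolBound (blockExp d σ s) (blockExp d s σ) h (radialConst d s σ * r) M f :=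
  ⟨_, symbolBound_of_symbolSeminorms hs hσ hh hr.le fun i => le_supSeminorm _ ⟨f, hf⟩ i⟩

lemma SymbolBound.mem_symbolStep (hs : 0 < s) (hσ : 0 < σ) {h r M : ℝ} (hh : 0 < h)
    (hr : 0 < r) {f : SmoothFun d d} (hf : SymbolBound (blockExp d σ s) (blockExp d s σ) h r M f) :
    f ∈ symbolStep d d s σ σ s h (radialConst d s σ * r) :=
  mem_boundedSubspace_of_le _ (hf.symbolSeminorms_le hs hσ hh hr.le)

lemma radialConst_mul_div (d : ℕ) (s σ r : ℝ) : radialConst d s σ * (r / radialConst d s σ) = r :=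
  mul_div_cancel₀ _ (radialConst_pos d s σ).ne'

lemma mem_symbolAllGrowth_iff (hs : 0 < s) (hσ : 0 < σ) (h : PosReal) (f : SmoothFun d d) :
    f ∈ symbolAllGrowth d d s σ σ s h ↔ ∀ r, 0 < r →
      ∃ M, SymbolBound (blockExp d σ s) (blockExp d s σ) h r M f := by
  have hK := radialConst_pos d s σ
  refine ⟨fun hf r hr => ?_, fun H => (Submodule.mem_iInf _).2 fun r => ?_⟩
  · have h1 := exists_symbolBound_of_mem_symbolStep hs hσ h.2 (div_pos hr hK)
      ((Submodule.mem_iInf _).1 hf ⟨r / radialConst d s σ, div_pos hr hK⟩)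
    rwa [radialConst_mul_div] at h1
  · obtain ⟨M, hM⟩ := H (r.1 / radialConst d s σ) (div_pos r.2 hK)
    have h1 := hM.mem_symbolStep hs hσ h.2 (div_pos r.2 hK)
    rwa [radialConst_mul_div] at h1

lemma mem_GammaRoumieuZero_iff (hs : 0 < s) (hσ : 0 < σ) (f : SmoothFun d d) :
    f ∈ GammaRoumieuZero d d s σ σ s ↔ ∃ h, 0 < h ∧ ∀ r, 0 < r →
      ∃ M, SymbolBound (blockExp d σ s) (blockExp d s σ) h r M f :=
  ⟨fun ⟨h, hf⟩ => ⟨h, h.2, (mem_symbolAllGrowth_iff hs hσ h f).1 hf⟩,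
    fun ⟨h, hh, hf⟩ => ⟨⟨h, hh⟩, (mem_symbolAllGrowth_iff hs hσ ⟨h, hh⟩ f).2 hf⟩⟩

lemma exists_symbolBound_of_mem_symbolAllScale (hs : 0 < s) (hσ : 0 < σ) {r : PosReal}
    {f : SmoothFun d d} (hf : f ∈ symbolAllScale d d s σ σ s r) {h : ℝ} (hh : 0 < h) :
    ∃ M, SymbolBound (blockExp d σ s) (blockExp d s σ) h (radialConst d s σ * r) M f :=
  exists_symbolBound_of_mem_symbolStep hs hσ hh r.2 ((Submodule.mem_iInf _).1 hf ⟨h, hh⟩)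

lemma mem_symbolAllScale_of_symbolBound (hs : 0 < s) (hσ : 0 < σ) {r r' : PosReal}
    (hr : r'.1 = radialConst d s σ * r) {f : SmoothFun d d} (H : ∀ h, 0 < h →
      ∃ M, SymbolBound (blockExp d σ s) (blockExp d s σ) h r M f) :
    f ∈ symbolAllScale d d s σ σ s r' := by
  refine (Submodule.mem_iInf _).2 fun h => ?_
  obtain ⟨M, hM⟩ := H h h.2
  rw [hr]
  exact hM.mem_symbolStep hs hσ h.2 r.2

lemma mem_GammaBeurling_iff (hs : 0 < s) (hσ : 0 < σ) (f : SmoothFun d d) :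
    f ∈ GammaBeurling d d s σ σ s ↔ ∃ r, 0 < r ∧ ∀ h, 0 < h →
      ∃ M, SymbolBound (blockExp d σ s) (blockExp d s σ) h r M f := by
  have hK := radialConst_pos d s σ
  exact ⟨fun ⟨r, hf⟩ => ⟨_, mul_pos hK r.2,
      fun h hh => exists_symbolBound_of_mem_symbolAllScale hs hσ hf hh⟩,
    fun ⟨r, hr, hf⟩ => ⟨⟨_, mul_pos hK hr⟩,
      mem_symbolAllScale_of_symbolBound hs hσ (r := ⟨r, hr⟩) rfl hf⟩⟩

lemma mem_GammaBeurlingZero_iff (hs : 0 < s) (hσ : 0 < σ) (f : SmoothFun d d) :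
    f ∈ GammaBeurlingZero d d s σ σ s ↔ ∀ h r, 0 < h → 0 < r →
      ∃ M, SymbolBound (blockExp d σ s) (blockExp d s σ) h r M f := by
  have hK := radialConst_pos d s σ
  refine ⟨fun hf h r hh hr => ?_, fun H => (Submodule.mem_iInf _).2 fun p => ?_⟩
  · have h1 := exists_symbolBound_of_mem_symbolStep hs hσ hh (div_pos hr hK)
      ((Submodule.mem_iInf _).1 hf ⟨⟨h, hh⟩, ⟨r / radialConst d s σ, div_pos hr hK⟩⟩)
    rwa [radialConst_mul_div] at h1
  · obtain ⟨M, hM⟩ := H p.1 (p.2.1 / radialConst d s σ) p.1.2 (div_pos p.2.2 hK)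
    have h1 := hM.mem_symbolStep hs hσ p.1.2 (div_pos p.2.2 hK)
    rwa [radialConst_mul_div] at h1

/-- The hypothesis sends each step with scale h into one with scale h' independent of R, so the
restricted map is continuous between projective limits and the inductive limit criterion applies. -/
lemma continuous_GammaRoumieuZero (hs : 0 < s) (hσ : 0 < σ)
    (T : GammaRoumieuZero d d s σ σ s →ₗ[ℂ] GammaRoumieuZero d d s σ σ s)
    (H : ∀ h, 0 < h → ∃ h', 0 < h' ∧ ∀ R, 0 < R → ∃ r, 0 < r ∧ ∃ C : ℝ,
      ∀ (f : GammaRoumieuZero d d s σ σ s) (M : ℝ),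
        SymbolBound (blockExp d σ s) (blockExp d s σ) h r M f →
        SymbolBound (blockExp d σ s) (blockExp d s σ) h' R (C * M) (T f)) : Continuous T := by
  have hK := radialConst_pos d s σ
  refine continuous_inductiveLimit _ T fun h => ?_
  obtain ⟨h', hh', H⟩ := H h h.2
  have hle : symbolAllGrowth d d s σ σ s h ≤ GammaRoumieuZero d d s σ σ s := fun f hf => ⟨h, hf⟩
  refine ⟨⟨h', hh'⟩, ((GammaRoumieuZero d d s σ σ s).subtype ∘ₗ T ∘ₗ
    Submodule.inclusion hle).codRestrict _ fun f => ?_, ?_, fun x => rfl⟩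
  · refine (mem_symbolAllGrowth_iff hs hσ _ _).2 fun R hR => ?_
    obtain ⟨r, hr, C, H⟩ := H R hR
    obtain ⟨M, hM⟩ := (mem_symbolAllGrowth_iff hs hσ h f.1).1 f.2 r hr
    exact ⟨C * M, H ⟨f, hle f.2⟩ M hM⟩
  · refine continuous_projectiveLimit_of_le
      (fun r : PosReal => symbolSeminorms d d s σ σ s h r)
      (fun r : PosReal => symbolSeminorms d d s σ σ s h' r) _ fun R => ?_
    obtain ⟨r, hr, C, H⟩ := H (R / radialConst d s σ) (div_pos R.2 hK)
    refine ⟨⟨r / radialConst d s σ, div_pos hr hK⟩, C, fun f N hf => ?_⟩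
    have h1 := symbolBound_of_symbolSeminorms hs hσ h.2 (div_pos hr hK).le hf
    rw [radialConst_mul_div] at h1
    have h2 := (H ⟨f, hle f.2⟩ N h1).symbolSeminorms_le hs hσ hh' (div_pos R.2 hK).le
    rw [radialConst_mul_div] at h2
    exact h2

lemma continuous_GammaBeurling (hs : 0 < s) (hσ : 0 < σ)
    (T : GammaBeurling d d s σ σ s →ₗ[ℂ] GammaBeurling d d s σ σ s)
    (H : ∀ r, 0 < r → ∃ R, 0 < R ∧ ∀ h', 0 < h' → ∃ h, 0 < h ∧ ∃ C : ℝ,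
      ∀ (f : GammaBeurling d d s σ σ s) (M : ℝ),
        SymbolBound (blockExp d σ s) (blockExp d s σ) h r M f →
        SymbolBound (blockExp d σ s) (blockExp d s σ) h' R (C * M) (T f)) : Continuous T := by
  have hK := radialConst_pos d s σ
  refine continuous_inductiveLimit _ T fun r => ?_
  obtain ⟨R, hR, H⟩ := H _ (mul_pos hK r.2)
  have hle : symbolAllScale d d s σ σ s r ≤ GammaBeurling d d s σ σ s := fun f hf => ⟨r, hf⟩
  refine ⟨⟨_, mul_pos hK hR⟩, ((GammaBeurling d d s σ σ s).subtype ∘ₗ T ∘ₗ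
    Submodule.inclusion hle).codRestrict _ fun f => ?_, ?_, fun x => rfl⟩
  · refine mem_symbolAllScale_of_symbolBound hs hσ (r := ⟨R, hR⟩) rfl fun h' hh' => ?_
    obtain ⟨h, hh, C, H⟩ := H h' hh'
    obtain ⟨M, hM⟩ := exists_symbolBound_of_mem_symbolAllScale hs hσ f.2 hh
    exact ⟨C * M, H ⟨f, hle f.2⟩ M hM⟩
  · refine continuous_projectiveLimit_of_le
      (fun h : PosReal => symbolSeminorms d d s σ σ s h r)
      (fun h : PosReal => symbolSeminorms d d s σ σ s h (radialConst d s σ * R)) _ fun h' => ?_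
    obtain ⟨h, hh, C, H⟩ := H h' h'.2
    refine ⟨⟨h, hh⟩, C, fun f N hf => ?_⟩
    have h1 := symbolBound_of_symbolSeminorms hs hσ hh r.2.le hf
    exact (H ⟨f, hle f.2⟩ N h1).symbolSeminorms_le hs hσ h'.2 hR.le

lemma continuous_GammaBeurlingZero (hs : 0 < s) (hσ : 0 < σ)
    (T : GammaBeurlingZero d d s σ σ s →ₗ[ℂ] GammaBeurlingZero d d s σ σ s)
    (H : ∀ h' R, 0 < h' → 0 < R → ∃ h r, 0 < h ∧ 0 < r ∧ ∃ C : ℝ,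
      ∀ (f : GammaBeurlingZero d d s σ σ s) (M : ℝ),
        SymbolBound (blockExp d σ s) (blockExp d s σ) h r M f →
        SymbolBound (blockExp d σ s) (blockExp d s σ) h' R (C * M) (T f)) : Continuous T := by
  have hK := radialConst_pos d s σ
  refine continuous_projectiveLimit_of_le
    (fun p : PosReal × PosReal => symbolSeminorms d d s σ σ s p.1 p.2)
    (fun p : PosReal × PosReal => symbolSeminorms d d s σ σ s p.1 p.2) T fun p => ?_
  obtain ⟨h, r, hh, hr, C, H⟩ := H p.1 (p.2 / radialConst d s σ) p.1.2 (div_pos p.2.2 hK)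
  refine ⟨⟨⟨h, hh⟩, ⟨r / radialConst d s σ, div_pos hr hK⟩⟩, C, fun f N hf => ?_⟩
  have h1 := symbolBound_of_symbolSeminorms hs hσ hh (div_pos hr hK).le hf
  rw [radialConst_mul_div] at h1
  have h2 := (H f N h1).symbolSeminorms_le hs hσ p.1.2 (div_pos p.2.2 hK).le
  rw [radialConst_mul_div] at h2
  exact h2

end SymbolClasses

/-! ## Functions of moderate growth as distributions -/

section Distributions

open SmoothFun

variable {d : ℕ} {s σ : ℝ}

/-- The linear form `p ↦ ∫ f p`. -/
def pairing {S : Submodule ℂ 𝓢(PhaseSpace d d, ℂ)} (f : PhaseSpace d d → ℂ)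
    (hf : ∀ p ∈ S, Integrable fun z => f z * p z) : S →ₗ[ℂ] ℂ where
  toFun p := ∫ z, f z * p.1 z
  map_add' p q := by
    rw [← integral_add (hf p p.2) (hf q q.2)]
    exact integral_congr_ae (Filter.Eventually.of_forall fun z => mul_add _ _ _)
  map_smul' c p := by
    rw [RingHom.id_apply, smul_eq_mul, ← integral_const_mul]
    exact integral_congr_ae (Filter.Eventually.of_forall fun z => mul_left_comm _ _ _)

lemma norm_le_of_gsSeminorms (hs : 0 < s) (hσ : 0 < σ) {h a N : ℝ} (hh : 0 < h)
    (ha : ∀ i, a ≤ (h * Real.exp 1) ^ (-(1 / blockExp d s σ i))) {p : 𝓢(PhaseSpace d d, ℂ)}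
    (hp : ∀ i, gsSeminorms d d s σ σ s h i p ≤ N) (z : PhaseSpace d d) :
    ‖p z‖ ≤ Real.exp 1 ^ Fintype.card (Fin d ⊕ Fin d) * N *
      Real.exp (-a * grow (blockExp d s σ) z) :=
  (symbolBound_of_gsSeminorms hs hσ hh ha hp).norm_le z

/-- A test function decays at some rate a, and the symbol grows at rate at most a/2; the same a
works for all test functions of one Gelfand–Shilov step. -/
lemma exists_roumieuDual_isGivenBy (hs : 0 < s) (hσ : 0 < σ) {f : PhaseSpace d d → ℂ}
    (hf : Continuous f) (H : ∀ r, 0 < r → ∃ K : ℝ, ∀ z,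
      ‖f z‖ ≤ K * Real.exp (r * grow (blockExp d s σ) z)) :
    ∃ u : GSRoumieuDual d d s σ σ s, IsGivenBy u.1 f := by
  have hθ := blockExp_pos (d := d) hs hσ
  have hi : ∀ p ∈ GSRoumieu d d s σ σ s, Integrable fun z => f z * p z := by
    intro p hp
    obtain ⟨h, a, M, hh, ha, hM⟩ := (mem_GSRoumieu_iff hs hσ p).1 hp
    obtain ⟨K, hK⟩ := H (a / 2) (half_pos ha)
    exact (integrable_mul_of_growth hθ (half_lt_self ha) hf p.continuous hK hM.norm_le).1
  refine ⟨⟨pairing f hi, fun h => ?_⟩, fun p => ⟨hi p p.2, rfl⟩⟩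
  obtain ⟨a, ha, ha'⟩ := exists_gs_decay (d := d) (s := s) (σ := σ) h.2
  obtain ⟨K, hK⟩ := H (a / 2) (half_pos ha)
  refine ⟨K * Real.exp 1 ^ Fintype.card (Fin d ⊕ Fin d) *
    ∫ z : PhaseSpace d d, Real.exp (-(a - a / 2) * grow (blockExp d s σ) z), fun p hp => ?_⟩
  refine (integrable_mul_of_growth hθ (half_lt_self ha) hf p.1.continuous hK
    (norm_le_of_gsSeminorms hs hσ h.2 ha' fun i => le_supSeminorm _ ⟨p.1, hp⟩ i)).2.trans
      (le_of_eq ?_)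
  ring

lemma exists_beurlingDual_isGivenBy (hs : 0 < s) (hσ : 0 < σ) {f : PhaseSpace d d → ℂ}
    (hf : Continuous f) {r K : ℝ} (hr : 0 ≤ r)
    (hK : ∀ z, ‖f z‖ ≤ K * Real.exp (r * grow (blockExp d s σ) z)) :
    ∃ u : GSBeurlingDual d d s σ σ s, IsGivenBy u.1 f := by
  have hθ := blockExp_pos (d := d) hs hσ
  have hr1 : r < r + 1 := lt_add_one r
  have hi : ∀ p ∈ GSBeurling d d s σ σ s, Integrable fun z => f z * p z := by
    intro p hp
    obtain ⟨M, hM⟩ := (mem_GSBeurling_iff hs hσ p).1 hp 1 (r + 1) one_pos (by positivity)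
    exact (integrable_mul_of_growth hθ hr1 hf p.continuous hK hM.norm_le).1
  obtain ⟨h, hh, -, ha'⟩ := exists_gs_scale (d := d) hs hσ (r + 1) one_pos
  refine ⟨⟨pairing f hi, ⟨h, hh⟩, K * Real.exp 1 ^ Fintype.card (Fin d ⊕ Fin d) *
    ∫ z : PhaseSpace d d, Real.exp (-(r + 1 - r) * grow (blockExp d s σ) z), fun p hp => ?_⟩,
    fun p => ⟨hi p p.2, rfl⟩⟩
  refine (integrable_mul_of_growth hθ hr1 hf p.1.continuous hK
    (norm_le_of_gsSeminorms hs hσ hh ha' fun i => le_supSeminorm _ ⟨p.1, hp⟩ i)).2.trans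
      (le_of_eq ?_)
  ring

lemma schwartz_norm_le_exp_grow (θ : Fin d ⊕ Fin d → ℝ) {r : ℝ} (hr : 0 ≤ r)
    (p : 𝓢(PhaseSpace d d, ℂ)) (z : PhaseSpace d d) :
    ‖p z‖ ≤ SchwartzMap.seminorm ℂ 0 0 p * Real.exp (r * grow θ z) := by
  have h1 := SchwartzMap.norm_le_seminorm ℂ p z
  exact h1.trans (le_mul_of_one_le_right ((norm_nonneg _).trans h1)
    (Real.one_le_exp (mul_nonneg hr (grow_nonneg θ z))))

variable (A : Matrix (Fin d) (Fin d) ℝ)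

lemma expAD_mem_GSRoumieu (hs : 0 < s) (hσ : 0 < σ) (hsσ : 1 ≤ s + σ) :
    ∀ p ∈ GSRoumieu d d s σ σ s, expAD A p ∈ GSRoumieu d d s σ σ s := by
  rintro p ⟨h, hp⟩
  obtain ⟨h', hh', C, hC, H⟩ := exists_gsSeminorms_expAD_le_roumieu A hs hσ hsσ h.2
  exact ⟨⟨h', hh'⟩, mem_boundedSubspace_of_le _ (H p _ fun i => le_supSeminorm _ ⟨p, hp⟩ i)⟩

lemma expAD_mem_GSBeurling (hs : 0 < s) (hσ : 0 < σ) (hsσ : 1 ≤ s + σ) :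
    ∀ p ∈ GSBeurling d d s σ σ s, expAD A p ∈ GSBeurling d d s σ σ s := by
  intro p hp
  refine (Submodule.mem_iInf _).2 fun h' => ?_
  obtain ⟨h, hh, C, hC, H⟩ := exists_gsSeminorms_expAD_le_beurling A hs hσ hsσ h'.2
  have hp' := (Submodule.mem_iInf _).1 hp ⟨h, hh⟩
  exact mem_boundedSubspace_of_le _ (H p _ fun i => le_supSeminorm _ ⟨p, hp'⟩ i)

lemma comp_expAD_mem_GSRoumieuDual (hs : 0 < s) (hσ : 0 < σ) (hsσ : 1 ≤ s + σ) :
    ∀ u ∈ GSRoumieuDual d d s σ σ s,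
      u ∘ₗ (expAD A).toLinearMap.restrict (expAD_mem_GSRoumieu A hs hσ hsσ) ∈
        GSRoumieuDual d d s σ σ s := by
  intro u hu h
  obtain ⟨h', hh', C, hC, H⟩ := exists_gsSeminorms_expAD_le_roumieu A hs hσ hsσ h.2
  obtain ⟨C', hC'⟩ := hu ⟨h', hh'⟩
  refine ⟨|C'| * C, fun p hp => ?_⟩
  have h1 := H p _ fun i => le_supSeminorm _ ⟨p.1, hp⟩ i
  refine (hC' ⟨expAD A p, expAD_mem_GSRoumieu A hs hσ hsσ p p.2⟩
    (mem_boundedSubspace_of_le _ h1)).trans ?_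
  rw [mul_assoc]
  refine mul_le_mul (le_abs_self _) ?_ (apply_nonneg _ _) (abs_nonneg _)
  exact supSeminorm_le _ (mul_nonneg hC (apply_nonneg _ _)) h1

lemma comp_expAD_mem_GSBeurlingDual (hs : 0 < s) (hσ : 0 < σ) (hsσ : 1 ≤ s + σ) :
    ∀ u ∈ GSBeurlingDual d d s σ σ s,
      u ∘ₗ (expAD A).toLinearMap.restrict (expAD_mem_GSBeurling A hs hσ hsσ) ∈
        GSBeurlingDual d d s σ σ s := by
  rintro u ⟨h', C', hC'⟩
  obtain ⟨h, hh, C, hC, H⟩ := exists_gsSeminorms_expAD_le_beurling A hs hσ hsσ h'.2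
  refine ⟨⟨h, hh⟩, |C'| * C, fun p hp => ?_⟩
  have h1 := H p _ fun i => le_supSeminorm _ ⟨p.1, hp⟩ i
  refine (hC' ⟨expAD A p, expAD_mem_GSBeurling A hs hσ hsσ p p.2⟩
    (mem_boundedSubspace_of_le _ h1)).trans ?_
  rw [mul_assoc]
  refine mul_le_mul (le_abs_self _) ?_ (apply_nonneg _ _) (abs_nonneg _)
  exact supSeminorm_le _ (mul_nonneg hC (apply_nonneg _ _)) h1

lemma exists_roumieu_extension (hs : 0 < s) (hσ : 0 < σ) (hsσ : 1 ≤ s + σ) :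
    ∃ L : GSRoumieuDual d d s σ σ s → GSRoumieuDual d d s σ σ s, IsDistributionalExtension A L :=
  ⟨_, isDistributionalExtension_transposeExpAD (expAD_mem_GSRoumieu A hs hσ hsσ)
    (comp_expAD_mem_GSRoumieuDual A hs hσ hsσ) fun p =>
      exists_roumieuDual_isGivenBy hs hσ p.continuous fun _ hr =>
        ⟨_, schwartz_norm_le_exp_grow _ hr.le p⟩⟩

lemma exists_beurling_extension (hs : 0 < s) (hσ : 0 < σ) (hsσ : 1 ≤ s + σ) :
    ∃ L : GSBeurlingDual d d s σ σ s → GSBeurlingDual d d s σ σ s, IsDistributionalExtension A L :=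
  ⟨_, isDistributionalExtension_transposeExpAD (expAD_mem_GSBeurling A hs hσ hsσ)
    (comp_expAD_mem_GSBeurlingDual A hs hσ hsσ) fun p =>
      exists_beurlingDual_isGivenBy hs hσ p.continuous le_rfl
        (schwartz_norm_le_exp_grow _ le_rfl p)⟩

end Distributions

/-! ## The operator on symbol classes -/

section Homeomorphisms

open SmoothFun

variable {d : ℕ} {s σ : ℝ}

lemma eq_zero_of_integral_GSRoumieu (hs : 0 < s) (hσ : 0 < σ) (hsσ : 1 ≤ s + σ)
    {f : SmoothFun d d} (hf : f ∈ GammaRoumieuZero d d s σ σ s)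
    (h0 : ∀ p ∈ GSRoumieu d d s σ σ s, ∫ z, f z * p z = 0) : f = 0 := by
  obtain ⟨h, hh, H⟩ := (mem_GammaRoumieuZero_iff hs hσ f).1 hf
  have hθ := blockExp_pos (d := d) hs hσ
  obtain ⟨w, hP, h₀, a, M₀, hh₀, ha, hw⟩ := exists_window_roumieu (blockExp_pos (d := d) hσ hs) hθ
    fun i => hsσ.trans_eq (blockExp_add s σ i).symm
  have hc : 0 < growConst (blockExp d s σ) := zero_lt_one.trans_le (one_le_growConst _)
  -- The growth of f is taken just small enough for the window to absorb it, so that the detectors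
  -- are test functions.
  obtain ⟨M, hM⟩ := H (a / growConst (blockExp d s σ)) (div_pos ha hc)
  obtain ⟨u, hu⟩ := exists_roumieuDual_isGivenBy (f := f) hs hσ f.continuous fun r hr => by
    obtain ⟨M, hM⟩ := H r hr
    exact ⟨M, hM.norm_le⟩
  have key : ∀ k, ∃ p ∈ GSRoumieu d d s σ σ s, ∀ z, p z = detector w f k z := by
    intro k
    obtain ⟨M', hM'⟩ := symbolBound_detector (fun i => (blockExp_pos hσ hs i).le) hθ hh.le hh₀.le
      (div_pos ha hc).le hM hw (mul_div_cancel₀ _ hc.ne').le k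
    have h1 := hM'.ofSchwartz_schwartzOf hθ (by positivity) (div_pos ha hc)
    refine ⟨schwartzOf (detector w f k), (mem_GSRoumieu_iff hs hσ _).2
      ⟨h + h₀ + h₀, _, M', by positivity, div_pos ha hc, by rw [h1]; exact hM'⟩,
      fun z => congrArg (fun g : SmoothFun d d => g z) h1⟩
  choose p hp hpd using key
  refine eq_zero_of_integral_detector hP (fun k => ?_) fun k => ?_
  · simpa only [hpd] using (hu ⟨p k, hp k⟩).1
  · simpa only [hpd] using h0 (p k) (hp k)

lemma eq_zero_of_integral_GSBeurling (hs : 0 < s) (hσ : 0 < σ) (hsσ : 1 < s + σ)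
    {f : SmoothFun d d} (hf : f ∈ GammaBeurling d d s σ σ s)
    (h0 : ∀ p ∈ GSBeurling d d s σ σ s, ∫ z, f z * p z = 0) : f = 0 := by
  obtain ⟨r, hr, H⟩ := (mem_GammaBeurling_iff hs hσ f).1 hf
  have hθ := blockExp_pos (d := d) hs hσ
  obtain ⟨w, hP, hw⟩ := exists_window_beurling (blockExp_pos (d := d) hσ hs) hθ
    fun i => hsσ.trans_eq (blockExp_add s σ i).symm
  have hc : 0 < growConst (blockExp d s σ) := zero_lt_one.trans_le (one_le_growConst _)
  obtain ⟨u, hu⟩ := exists_beurlingDual_isGivenBy (f := f) hs hσ f.continuous hr.le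
    (H 1 one_pos).choose_spec.norm_le
  have key' : ∀ k (h a : ℝ), 0 < h → 0 < a → ∃ M',
      SymbolBound (blockExp d σ s) (blockExp d s σ) h (-a) M' (detector w f k) := by
    intro k h a hh ha
    obtain ⟨M, hM⟩ := H (h / 3) (by positivity)
    -- The detector contains f once and the window twice, whence three equal shares of the scale.
    -- Translating f and the detector each costs a factor `growConst`; the stated decay leaves at
    -- least a.
    obtain ⟨M₀, hM₀⟩ := hw (h / 3) (growConst (blockExp d s σ) * (r + a)) (by positivity)
      (by positivity)
    obtain ⟨M', hM'⟩ := symbolBound_detector (fun i => (blockExp_pos hσ hs i).le) hθ (by positivity)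
      (by positivity) hr.le hM hM₀ (by nlinarith) k
    refine ⟨M', hM'.mono (by positivity) (by linarith) ?_ le_rfl⟩
    rw [mul_div_cancel_left₀ _ hc.ne']
    linarith
  have key : ∀ k, ∃ p ∈ GSBeurling d d s σ σ s, ∀ z, p z = detector w f k z := by
    intro k
    obtain ⟨M', hM'⟩ := key' k 1 1 one_pos one_pos
    have h1 := hM'.ofSchwartz_schwartzOf hθ zero_le_one one_pos
    refine ⟨schwartzOf (detector w f k), (mem_GSBeurling_iff hs hσ _).2 ?_,
      fun z => congrArg (fun g : SmoothFun d d => g z) h1⟩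
    rw [h1]
    exact key' k
  choose p hp hpd using key
  refine eq_zero_of_integral_detector hP (fun k => ?_) fun k => ?_
  · simpa only [hpd] using (hu ⟨p k, hp k⟩).1
  · simpa only [hpd] using h0 (p k) (hp k)

lemma isWeakTransform_GSRoumieu {A : Matrix (Fin d) (Fin d) ℝ} (hs : 0 < s) (hσ : 0 < σ)
    (hsσ : 1 ≤ s + σ) {f F : SmoothFun d d}
    (H : ∀ R, 0 < R → ∃ r, r ≤ R ∧ IsTransform A (blockExp d s σ) r R f F) :
    IsWeakTransform (GSRoumieu d d s σ σ s) A f F := by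
  intro p hp
  obtain ⟨h₁, a, M, -, ha, hM⟩ := (mem_GSRoumieu_iff hs hσ p).1 hp
  obtain ⟨h₂, a', M', -, ha', hM'⟩ := (mem_GSRoumieu_iff hs hσ _).1 (expAD_mem_GSRoumieu A hs hσ hsσ p hp)
  have h0 : 0 < min a a' := lt_min ha ha'
  obtain ⟨r, hr, h⟩ := H (min a a' / 2) (half_pos h0)
  exact h p M M' a a' (by linarith [min_le_left a a']) (by linarith [min_le_right a a'])
    hM.norm_le hM'.norm_le

lemma isWeakTransform_GSBeurling {A : Matrix (Fin d) (Fin d) ℝ} (hs : 0 < s) (hσ : 0 < σ)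
    (hsσ : 1 ≤ s + σ) {f F : SmoothFun d d} {r R : ℝ} (hr : 0 < r) (hR : 0 < R)
    (H : IsTransform A (blockExp d s σ) r R f F) :
    IsWeakTransform (GSBeurling d d s σ σ s) A f F := by
  intro p hp
  obtain ⟨M, hM⟩ := (mem_GSBeurling_iff hs hσ p).1 hp 1 (R + 1) one_pos (by positivity)
  obtain ⟨M', hM'⟩ := (mem_GSBeurling_iff hs hσ _).1 (expAD_mem_GSBeurling A hs hσ hsσ p hp) 1
    (r + 1) one_pos (by positivity)
  exact H p M M' _ _ (lt_add_one R) (lt_add_one r) hM.norm_le hM'.norm_le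

lemma GammaBeurlingZero_le (hs : 0 < s) (hσ : 0 < σ) :
    GammaBeurlingZero d d s σ σ s ≤ GammaBeurling d d s σ σ s := fun f hf =>
  (mem_GammaBeurling_iff hs hσ f).2
    ⟨1, one_pos, fun h hh => (mem_GammaBeurlingZero_iff hs hσ f).1 hf h 1 hh one_pos⟩

lemma GammaBeurlingZero_le_GammaRoumieuZero (hs : 0 < s) (hσ : 0 < σ) :
    GammaBeurlingZero d d s σ σ s ≤ GammaRoumieuZero d d s σ σ s := fun f hf =>
  (mem_GammaRoumieuZero_iff hs hσ f).2
    ⟨1, one_pos, fun r hr => (mem_GammaBeurlingZero_iff hs hσ f).1 hf 1 r one_pos hr⟩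

lemma exists_dual_of_mem_GammaRoumieuZero (hs : 0 < s) (hσ : 0 < σ) :
    ∀ f ∈ GammaRoumieuZero d d s σ σ s, ∃ u : GSRoumieuDual d d s σ σ s, IsGivenBy u.1 f := by
  intro f hf
  obtain ⟨h, hh, H⟩ := (mem_GammaRoumieuZero_iff hs hσ f).1 hf
  refine exists_roumieuDual_isGivenBy hs hσ f.continuous fun r hr => ?_
  obtain ⟨M, hM⟩ := H r hr
  exact ⟨M, hM.norm_le⟩

lemma exists_dual_of_mem_GammaBeurling (hs : 0 < s) (hσ : 0 < σ) :
    ∀ f ∈ GammaBeurling d d s σ σ s, ∃ u : GSBeurlingDual d d s σ σ s, IsGivenBy u.1 f := by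
  intro f hf
  obtain ⟨r, hr, H⟩ := (mem_GammaBeurling_iff hs hσ f).1 hf
  exact exists_beurlingDual_isGivenBy hs hσ f.continuous hr.le
    (H 1 one_pos).choose_spec.norm_le

/-- A window defining `e^{i⟨AD_ξ,D_x⟩}` on the classes paired with `𝒮`. -/
lemma exists_symbolOp_window_roumieu (d : ℕ) (hs : 0 < s) (hσ : 0 < σ) (hsσ : 1 ≤ s + σ) :
    ∃ w : SmoothFun d d, ∀ A : Matrix (Fin d) (Fin d) ℝ,
      (∀ h, 0 < h → ∃ h', 0 < h' ∧ ∀ R, 0 < R → ∃ r, 0 < r ∧ ∃ C : ℝ,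
        ∀ (f : SmoothFun d d) (M : ℝ), SymbolBound (blockExp d σ s) (blockExp d s σ) h r M f →
          SymbolBound (blockExp d σ s) (blockExp d s σ) h' R (C * M) (symbolOp A w f)) ∧
      ∀ f ∈ GammaRoumieuZero d d s σ σ s, symbolOp A w f ∈ GammaRoumieuZero d d s σ σ s ∧
        IsWeakTransform (GSRoumieu d d s σ σ s) A f (symbolOp A w f) := by
  have hθ := blockExp_pos (d := d) hs hσ
  have hτθ : ∀ i : Fin d ⊕ Fin d, 1 ≤ blockExp d σ s i + blockExp d s σ i :=
    fun i => hsσ.trans_eq (blockExp_add s σ i).symm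
  obtain ⟨w, hP, h₀, a, M₀, hh₀, ha, hw⟩ :=
    exists_window_roumieu (blockExp_pos (d := d) hσ hs) hθ hτθ
  refine ⟨w, fun A => ?_⟩
  have H := fun {h R : ℝ} => exists_symbolOp_roumieu (A := A) (h := h) (R := R)
    (fun i => (blockExp_pos hσ hs i).le)
    (blockExp_le_add hσ hs) hθ hτθ (twistVec_blockExp A s σ) hh₀.le ha hP hw
  refine ⟨fun h hh => ⟨2 ^ (σ + s) * (h + h₀), by positivity, fun R hR => ?_⟩, fun f hf => ?_⟩
  · obtain ⟨r, hr, -, C, HC⟩ := H hh.le hR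
    exact ⟨r, hr, C, fun f M hf => (HC f M hf).2⟩
  · obtain ⟨h, hh, hf'⟩ := (mem_GammaRoumieuZero_iff hs hσ f).1 hf
    refine ⟨(mem_GammaRoumieuZero_iff hs hσ _).2 ⟨2 ^ (σ + s) * (h + h₀), by positivity,
      fun R hR => ?_⟩, isWeakTransform_GSRoumieu hs hσ hsσ fun R hR => ?_⟩
    · obtain ⟨r, hr, -, C, HC⟩ := H hh.le hR
      obtain ⟨M, hM⟩ := hf' r hr
      exact ⟨_, (HC f M hM).2⟩
    · obtain ⟨r, hr, hrR, C, HC⟩ := H hh.le hR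
      obtain ⟨M, hM⟩ := hf' r hr
      exact ⟨r, hrR, (HC f M hM).1⟩

theorem restrictsToHomeomorphism_GammaRoumieuZero {A : Matrix (Fin d) (Fin d) ℝ} (hs : 0 < s)
    (hσ : 0 < σ) (hsσ : 1 ≤ s + σ) {L : GSRoumieuDual d d s σ σ s → GSRoumieuDual d d s σ σ s}
    (hL : IsDistributionalExtension A L) :
    RestrictsToHomeomorphism L (GammaRoumieuZero d d s σ σ s) := by
  obtain ⟨w, hw⟩ := exists_symbolOp_window_roumieu d hs hσ hsσ
  refine hL.restrictsToHomeomorphism (expAD_mem_GSRoumieu (-A) hs hσ hsσ)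
    (exists_dual_of_mem_GammaRoumieuZero hs hσ)
    (fun f hf => eq_zero_of_integral_GSRoumieu hs hσ hsσ hf) (fun B => symbolOp B w)
    (fun B => (hw B).2) fun B T hT => continuous_GammaRoumieuZero hs hσ T fun h hh => ?_
  obtain ⟨h', hh', H⟩ := (hw B).1 h hh
  refine ⟨h', hh', fun R hR => ?_⟩
  obtain ⟨r, hr, C, H⟩ := H R hR
  refine ⟨r, hr, C, fun f M hf => ?_⟩
  rw [hT]
  exact H f M hf

/-- A window defining `e^{i⟨AD_ξ,D_x⟩}` on the classes paired with `Σ`. -/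
lemma exists_symbolOp_window_beurling (d : ℕ) (hs : 0 < s) (hσ : 0 < σ) (hsσ : 1 < s + σ) :
    ∃ (w : SmoothFun d d) (c : ℝ), 0 < c ∧ ∀ (A : Matrix (Fin d) (Fin d) ℝ) (r R h' : ℝ), 0 < r →
      c * r < R → 0 < h' → ∃ h, 0 < h ∧ ∃ C : ℝ, ∀ (f : SmoothFun d d) (M : ℝ),
        SymbolBound (blockExp d σ s) (blockExp d s σ) h r M f →
          IsTransform A (blockExp d s σ) r R f (symbolOp A w f) ∧
          SymbolBound (blockExp d σ s) (blockExp d s σ) h' R (C * M) (symbolOp A w f) := by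
  have hθ := blockExp_pos (d := d) hs hσ
  have hτθ : ∀ i : Fin d ⊕ Fin d, 1 < blockExp d σ s i + blockExp d s σ i :=
    fun i => hsσ.trans_eq (blockExp_add s σ i).symm
  obtain ⟨w, hP, hw⟩ := exists_window_beurling (blockExp_pos (d := d) hσ hs) hθ hτθ
  have hc : 0 < growConst (blockExp d s σ) := zero_lt_one.trans_le (one_le_growConst _)
  refine ⟨w, growConst (blockExp d s σ) * growConst (blockExp d s σ), by positivity,
    fun A r R h' hr hrR hh' => ?_⟩
  exact exists_symbolOp_beurling (fun i => (blockExp_pos hσ hs i).le) (blockExp_le_add hσ hs) hθ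
    (fun i => (hτθ i).le) (twistVec_blockExp A s σ) hP hw hr (by rwa [← mul_assoc]) hh'

theorem restrictsToHomeomorphism_GammaBeurling {A : Matrix (Fin d) (Fin d) ℝ} (hs : 0 < s)
    (hσ : 0 < σ) (hsσ : 1 < s + σ) {L : GSBeurlingDual d d s σ σ s → GSBeurlingDual d d s σ σ s}
    (hL : IsDistributionalExtension A L) :
    RestrictsToHomeomorphism L (GammaBeurling d d s σ σ s) := by
  obtain ⟨w, c, hc, hw⟩ := exists_symbolOp_window_beurling d hs hσ hsσ
  refine hL.restrictsToHomeomorphism (expAD_mem_GSBeurling (-A) hs hσ hsσ.le)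
    (exists_dual_of_mem_GammaBeurling hs hσ)
    (fun f hf => eq_zero_of_integral_GSBeurling hs hσ hsσ hf) (fun B => symbolOp B w)
    (fun B f hf => ?_) fun B T hT => continuous_GammaBeurling hs hσ T fun r hr => ?_
  · obtain ⟨r, hr, hf'⟩ := (mem_GammaBeurling_iff hs hσ f).1 hf
    have hR : 0 < c * r + 1 := by positivity
    refine ⟨(mem_GammaBeurling_iff hs hσ _).2 ⟨c * r + 1, hR, fun h' hh' => ?_⟩, ?_⟩
    · obtain ⟨h, hh, C, H⟩ := hw B r _ h' hr (lt_add_one _) hh'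
      obtain ⟨M, hM⟩ := hf' h hh
      exact ⟨_, (H f M hM).2⟩
    · obtain ⟨h, hh, C, H⟩ := hw B r _ 1 hr (lt_add_one _) one_pos
      obtain ⟨M, hM⟩ := hf' h hh
      exact isWeakTransform_GSBeurling hs hσ hsσ.le hr hR (H f M hM).1
  · refine ⟨c * r + 1, by positivity, fun h' hh' => ?_⟩
    obtain ⟨h, hh, C, H⟩ := hw B r _ h' hr (lt_add_one _) hh'
    refine ⟨h, hh, C, fun f M hf => ?_⟩
    rw [hT]
    exact (H f M hf).2

theorem restrictsToHomeomorphism_GammaBeurlingZero {A : Matrix (Fin d) (Fin d) ℝ} (hs : 0 < s)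
    (hσ : 0 < σ) (hsσ : 1 < s + σ) {L : GSBeurlingDual d d s σ σ s → GSBeurlingDual d d s σ σ s}
    (hL : IsDistributionalExtension A L) :
    RestrictsToHomeomorphism L (GammaBeurlingZero d d s σ σ s) := by
  obtain ⟨w, c, hc, hw⟩ := exists_symbolOp_window_beurling d hs hσ hsσ
  have hle := GammaBeurlingZero_le (d := d) hs hσ
  have hr : ∀ R, 0 < R → ∃ r, 0 < r ∧ c * r < R := fun R hR =>
    ⟨R / 2 / c, by positivity, by rw [mul_div_cancel₀ _ hc.ne']; exact half_lt_self hR⟩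
  refine hL.restrictsToHomeomorphism (expAD_mem_GSBeurling (-A) hs hσ hsσ.le)
    (fun f hf => exists_dual_of_mem_GammaBeurling hs hσ f (hle hf))
    (fun f hf => eq_zero_of_integral_GSBeurling hs hσ hsσ (hle hf)) (fun B => symbolOp B w)
    (fun B f hf => ?_) fun B T hT => continuous_GammaBeurlingZero hs hσ T fun h' R hh' hR => ?_
  · have hf' := (mem_GammaBeurlingZero_iff hs hσ f).1 hf
    refine ⟨(mem_GammaBeurlingZero_iff hs hσ _).2 fun h' R hh' hR => ?_, ?_⟩
    · obtain ⟨r, hr, hrR⟩ := hr R hR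
      obtain ⟨h, hh, C, H⟩ := hw B r R h' hr hrR hh'
      obtain ⟨M, hM⟩ := hf' h r hh hr
      exact ⟨_, (H f M hM).2⟩
    · obtain ⟨h, hh, C, H⟩ := hw B 1 (c * 1 + 1) 1 one_pos (lt_add_one _) one_pos
      obtain ⟨M, hM⟩ := hf' h 1 hh one_pos
      exact isWeakTransform_GSBeurling hs hσ hsσ.le one_pos (by positivity) (H f M hM).1
  · obtain ⟨r, hr, hrR⟩ := hr R hR
    obtain ⟨h, hh, C, H⟩ := hw B r R h' hr hrR hh'
    refine ⟨h, r, hh, hr, C, fun f M hf => ?_⟩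
    rw [hT]
    exact (H f M hf).2

end Homeomorphisms

/-! ## Entire symbols -/

section Taylor

/-- Taylor's formula as a bound: the estimate for g 1 is integrated by the mean value inequality
with a polynomial majorant, so no integral remainder is needed. -/
lemma norm_le_taylor_sum {g : ℕ → ℝ → ℂ} {b : ℕ → ℝ} {B : ℝ} (n : ℕ) {t : ℝ}
    (hg : ∀ n u, HasDerivAt (g n) (g (n + 1) u) u) (hb : ∀ n, ‖g n 0‖ ≤ b n)
    (hB : ∀ u ∈ Set.Icc 0 t, ‖g n u‖ ≤ B) : ∀ u ∈ Set.Icc 0 t,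
      ‖g 0 u‖ ≤ ∑ k ∈ Finset.range n, u ^ k / k ! * b k + u ^ n / n ! * B := by
  induction n generalizing g b with
  | zero => intro u hu; simpa using hB u hu
  | succ n ih =>
    have h1 := ih (g := fun k => g (k + 1)) (b := fun k => b (k + 1)) (fun k => hg (k + 1))
      (fun k => hb (k + 1)) hB
    have hd : ∀ (k : ℕ) (x : ℝ), HasDerivAt (fun u : ℝ => u ^ (k + 1) / (k + 1)!) (x ^ k / k !) x := by
      intro k x
      refine ((hasDerivAt_pow (k + 1) x).div_const ((k + 1)! : ℝ)).congr_deriv ?_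
      have : ((k : ℝ) + 1) ≠ 0 := by positivity
      rw [Nat.factorial_succ]
      push_cast
      field_simp
    intro u hu
    have h2 := image_norm_le_of_norm_deriv_right_le_deriv_boundary (f := g 0) (f' := g 1) (a := 0)
      (b := t) (B := fun u => b 0 + (∑ k ∈ Finset.range n, u ^ (k + 1) / (k + 1)! * b (k + 1) +
        u ^ (n + 1) / (n + 1)! * B))
      (B' := fun u => ∑ k ∈ Finset.range n, u ^ k / k ! * b (k + 1) + u ^ n / n ! * B)
      (fun x _ => (hg 0 x).continuousAt.continuousWithinAt)
      (fun x _ => (hg 0 x).hasDerivWithinAt) (by simpa using hb 0)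
      (fun x => ((HasDerivAt.fun_sum fun k _ => (hd k x).mul_const _).add
        ((hd n x).mul_const B)).const_add _)
      (fun x hx => h1 x ⟨hx.1, hx.2.le⟩) hu
    refine h2.trans (le_of_eq ?_)
    rw [Finset.sum_range_succ' _ n]
    simp
    ring

/-- The crude bound K' enters only through the remainder, which tends to 0; the final estimate
retains only the data at 0, measured by K. -/
lemma norm_le_of_taylor {g : ℕ → ℝ → ℂ} {t K K' : ℝ} (ht : 0 ≤ t) {q : ℕ → ℝ}
    (hg : ∀ n u, HasDerivAt (g n) (g (n + 1) u) u) (hb : ∀ n, ‖g n 0‖ ≤ K * q n)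
    (hB : ∀ n, ∀ u ∈ Set.Icc 0 t, ‖g n u‖ ≤ K' * q n) (hK : 0 ≤ K) (hK' : 0 ≤ K') {Q : ℝ}
    (hQ : 0 ≤ Q) (hq : ∀ n, t ^ n / n ! * q n ≤ Q * (1 / 2) ^ n) : ‖g 0 t‖ ≤ 2 * Q * K := by
  have h1 : ∀ n, ‖g 0 t‖ ≤ 2 * Q * K + K' * (Q * (1 / 2) ^ n) := by
    intro n
    refine (norm_le_taylor_sum n hg hb (hB n) t ⟨ht, le_rfl⟩).trans (add_le_add ?_ ?_)
    · calc ∑ k ∈ Finset.range n, t ^ k / k ! * (K * q k)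
          ≤ ∑ k ∈ Finset.range n, Q * K * (1 / 2 : ℝ) ^ k := by
            refine Finset.sum_le_sum fun k _ => ?_
            have := mul_le_mul_of_nonneg_left (hq k) hK
            linarith
        _ = Q * K * ∑ k ∈ Finset.range n, (1 / 2 : ℝ) ^ k := by rw [Finset.mul_sum]
        _ ≤ Q * K * 2 := by
            gcongr
            exact sum_geometric_two_le n
        _ = _ := by ring
    · have := mul_le_mul_of_nonneg_left (hq n) hK'
      linarith
  have h2 : Filter.Tendsto (fun n : ℕ => 2 * Q * K + K' * (Q * (1 / 2 : ℝ) ^ n)) Filter.atTop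
      (nhds (2 * Q * K + K' * (Q * 0))) :=
    ((((tendsto_pow_atTop_nhds_zero_of_lt_one (by norm_num) (by norm_num)).const_mul Q).const_mul
      K').const_add _)
  simpa using ge_of_tendsto' h2 h1

end Taylor

/-! ### Improved growth for symbols with τ + θ ≤ 1. -/

section EntireSymbols

open SmoothFun

variable {d : ℕ} {τ θ : Fin d ⊕ Fin d → ℝ}

lemma hasDerivAt_comp_line {E : Type*} [NormedAddCommGroup E] [NormedSpace ℝ E] {f : E → ℂ}
    (hf : Differentiable ℝ f) (y v : E) (e u : ℝ) :
    HasDerivAt (fun u : ℝ => f (y + (u * e) • v)) (e * fderiv ℝ f (y + (u * e) • v) v) u := by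
  have h1 : HasDerivAt (fun u : ℝ => y + (u * e) • v) (e • v) u := by
    have h0 : HasDerivAt (fun u : ℝ => u * e) e u := hasDerivAt_mul_const e
    exact (h0.smul_const v).const_add y
  have h3 : HasDerivAt (fun u : ℝ => f (y + (u * e) • v))
      (fderiv ℝ f (y + (u * e) • v) (e • v)) u :=
    (hf _).hasFDerivAt.comp_hasDerivAt_of_eq u h1 rfl
  rwa [map_smul, Complex.real_smul] at h3

lemma wt_add_single_le {h T : ℝ} (hh : 0 ≤ h) (hτ : ∀ i, 0 ≤ τ i) (hT : ∀ i, τ i ≤ T)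
    (γ : Fin d ⊕ Fin d → ℕ) (i : Fin d ⊕ Fin d) (n : ℕ) : wt τ h (γ + Pi.single i n) ≤
      wt τ (2 ^ T * h) γ * ((2 ^ T * h) ^ n * (n ! : ℝ) ^ τ i) := by
  have h1 := wt_add_single (τ := τ) (2 ^ T * h) (γ := 0) (i := i) rfl n
  rw [zero_add, wt_zero, one_mul] at h1
  rw [← h1]
  exact wt_add_le hh hτ hT γ _

/-- With τ + θ ≤ 1 the Taylor factor 1/n! compensates n!^(τ+θ). A small κ makes the series geometric
at the price of growth ε only. -/
lemma pow_div_factorial_mul_le {t κ τ θ ε : ℝ} (ht : 0 ≤ t) (hκ : 0 ≤ κ) (hθ : 0 < θ)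
    (hτθ : τ + θ ≤ 1) (hε : 0 < ε) (hsmall : κ * (θ / ε) ^ θ ≤ 1 / 2) (n : ℕ) :
    t ^ n / n ! * (κ ^ n * (n ! : ℝ) ^ τ) ≤ Real.exp (ε * t ^ (1 / θ)) * (1 / 2) ^ n := by
  have hn : (0 : ℝ) < n ! := by positivity
  have hn1 : (1 : ℝ) ≤ n ! := by exact_mod_cast Nat.one_le_iff_ne_zero.2 (Nat.factorial_ne_zero n)
  have h1 : (n ! : ℝ) ^ θ * (n ! : ℝ) ^ τ / n ! ≤ 1 := by
    rw [← Real.rpow_add hn, div_le_one hn]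
    calc (n ! : ℝ) ^ (θ + τ) ≤ (n ! : ℝ) ^ (1 : ℝ) :=
          Real.rpow_le_rpow_of_exponent_le hn1 (by linarith)
      _ = n ! := Real.rpow_one _
  have h2 : (κ * (θ / ε) ^ θ) ^ n ≤ (1 / 2) ^ n := pow_le_pow_left₀ (by positivity) hsmall n
  calc t ^ n / n ! * (κ ^ n * (n ! : ℝ) ^ τ)
      ≤ (((θ / ε) ^ θ) ^ n * (n ! : ℝ) ^ θ * Real.exp (ε * t ^ (1 / θ))) / n ! *
        (κ ^ n * (n ! : ℝ) ^ τ) := by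
        gcongr
        exact pow_le_exp_rpow ht hε hθ n
    _ = (κ * (θ / ε) ^ θ) ^ n * Real.exp (ε * t ^ (1 / θ)) *
        ((n ! : ℝ) ^ θ * (n ! : ℝ) ^ τ / n !) := by rw [mul_pow]; ring
    _ ≤ (1 / 2) ^ n * Real.exp (ε * t ^ (1 / θ)) * 1 := by gcongr
    _ = _ := by ring

/-- Taylor expansion in z_i from the hyperplane z_i = 0, where the growth in z_i is invisible. Thus
the rate ρ_i is replaced by ε while the other rates remain untouched. -/
lemma norm_mder_le_update {h T ε M : ℝ} (hh : 0 ≤ h) (hτ : ∀ i, 0 ≤ τ i) (hT : ∀ i, τ i ≤ T)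
    (i : Fin d ⊕ Fin d) (hθ : 0 < θ i) (hτθ : τ i + θ i ≤ 1) (hε : 0 < ε) (hM : 0 ≤ M)
    (hsmall : 2 ^ T * h * (θ i / ε) ^ θ i ≤ 1 / 2) {ρ : Fin d ⊕ Fin d → ℝ} (hρ : 0 ≤ ρ i)
    {f : SmoothFun d d} (hf : ∀ γ z, ‖mder γ f z‖ ≤
      M * wt τ h γ * Real.exp (∑ j, ρ j * |coord j z| ^ (1 / θ j)))
    (γ : Fin d ⊕ Fin d → ℕ) (z : PhaseSpace d d) : ‖mder γ f z‖ ≤ 2 * M * wt τ (2 ^ T * h) γ *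
      Real.exp (∑ j, Function.update ρ i ε j * |coord j z| ^ (1 / θ j)) := by
  -- The sign of z_i, so that the segment from the hyperplane to z is run through by a parameter in
  -- [0, |z_i|].
  obtain ⟨e, he, hez⟩ : ∃ e : ℝ, |e| = 1 ∧ |coord i z| * e = coord i z := by
    rcases le_total 0 (coord i z) with h0 | h0
    · exact ⟨1, abs_one, by rw [abs_of_nonneg h0, mul_one]⟩
    · exact ⟨-1, by simp, by rw [abs_of_nonpos h0]; ring⟩
  set t := |coord i z| with ht
  set y := z - coord i z • bvec i with hy
  set S := ∑ j ∈ Finset.univ.erase i, ρ j * |coord j z| ^ (1 / θ j) with hS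
  have hw := wt_nonneg (τ := τ) (h := 2 ^ T * h) (by positivity) γ
  have hline : ∀ u, ∑ j, ρ j * |coord j (y + (u * e) • bvec i)| ^ (1 / θ j) =
      ρ i * |u| ^ (1 / θ i) + S := by
    intro u
    rw [← Finset.add_sum_erase _ _ (Finset.mem_univ i)]
    congr 1
    · have : coord i (y + (u * e) • bvec i) = u * e := by simp [hy, coord_bvec]
      rw [this, abs_mul, he, mul_one]
    · refine Finset.sum_congr rfl fun j hj => ?_
      have : coord j (y + (u * e) • bvec i) = coord j z := by
        simp [hy, coord_bvec, Finset.ne_of_mem_erase hj]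
      rw [this]
  have hg : ∀ n u, ‖(e : ℂ) ^ n * mder (γ + Pi.single i n) f (y + (u * e) • bvec i)‖ ≤
      M * wt τ (2 ^ T * h) γ * Real.exp (ρ i * |u| ^ (1 / θ i) + S) *
        ((2 ^ T * h) ^ n * (n ! : ℝ) ^ τ i) := by
    intro n u
    rw [norm_mul, norm_pow, Complex.norm_real, Real.norm_eq_abs, he, one_pow, one_mul, ← hline u]
    refine (hf _ _).trans ?_
    calc _ ≤ M * (wt τ (2 ^ T * h) γ * ((2 ^ T * h) ^ n * (n ! : ℝ) ^ τ i)) *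
          Real.exp (∑ j, ρ j * |coord j (y + (u * e) • bvec i)| ^ (1 / θ j)) := by
          gcongr
          exact wt_add_single_le hh hτ hT γ i n
      _ = _ := by ring
  have hθi : (1 / θ i) ≠ 0 := by positivity
  have key := norm_le_of_taylor (t := t) (K := M * wt τ (2 ^ T * h) γ * Real.exp S)
    (K' := M * wt τ (2 ^ T * h) γ * Real.exp (ρ i * t ^ (1 / θ i) + S))
    (q := fun n => (2 ^ T * h) ^ n * (n ! : ℝ) ^ τ i) (Q := Real.exp (ε * t ^ (1 / θ i)))
    (g := fun n u => (e : ℂ) ^ n * mder (γ + Pi.single i n) f (y + (u * e) • bvec i))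
    (abs_nonneg _) (fun n u => ?_) (fun n => ?_) (fun n u hu => ?_) (by positivity) (by positivity)
    (Real.exp_pos _).le
    (pow_div_factorial_mul_le (abs_nonneg _) (by positivity) hθ hτθ hε hsmall)
  · have h1 : y + (t * e) • bvec i = z := by rw [hez, hy]; abel
    rw [pow_zero, one_mul, Pi.single_zero, add_zero, h1] at key
    refine key.trans (le_of_eq ?_)
    have h2 : ∑ j, Function.update ρ i ε j * |coord j z| ^ (1 / θ j) = ε * t ^ (1 / θ i) + S := by
      rw [← Finset.add_sum_erase _ _ (Finset.mem_univ i), Function.update_self]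
      congr 1
      refine Finset.sum_congr rfl fun j hj => ?_
      rw [Function.update_of_ne (Finset.ne_of_mem_erase hj)]
    rw [h2, Real.exp_add]
    ring
  · have h1 := (hasDerivAt_comp_line (mder (γ + Pi.single i n) f).differentiable y (bvec i) e u).const_mul
      ((e : ℂ) ^ n)
    refine h1.congr_deriv ?_
    rw [← pderiv_apply, ← mder_add_single', add_assoc, ← Pi.single_add, pow_succ, mul_assoc]
  · have h1 := hg n 0
    rwa [abs_zero, Real.zero_rpow hθi, mul_zero, zero_add] at h1
  · refine (hg n u).trans ?_
    have hu0 := hu.1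
    have hu1 := hu.2
    rw [abs_of_nonneg hu0]
    gcongr

lemma exists_symbolBound_of_scale {T : ℝ} (hτ : ∀ i, 0 ≤ τ i) (hT : ∀ i, τ i ≤ T)
    (hθ : ∀ i, 0 < θ i) (hτθ : ∀ i, τ i + θ i ≤ 1) {r ε h₁ : ℝ} (hr : 0 ≤ r) (hε : 0 < ε)
    (hh₁ : 0 < h₁) : ∃ h : ℝ, 0 < h ∧ ∃ C : ℝ, ∀ (f : SmoothFun d d) (M : ℝ),
      SymbolBound τ θ h r M f → SymbolBound τ θ h₁ ε (C * M) f := by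
  classical
  have hev : ∀ᶠ η : ℝ in nhdsWithin 0 (Set.Ioi 0), ∀ i, η * (θ i / ε) ^ θ i ≤ 1 / 2 := by
    refine Filter.eventually_all.2 fun i => Filter.Eventually.filter_mono nhdsWithin_le_nhds ?_
    have : Filter.Tendsto (fun η : ℝ => η * (θ i / ε) ^ θ i) (nhds 0)
        (nhds (0 * (θ i / ε) ^ θ i)) := Filter.tendsto_id.mul_const _
    rw [zero_mul] at this
    exact this.eventually (ge_mem_nhds (by norm_num))
  obtain ⟨η, hη, hη0⟩ := (hev.and self_mem_nhdsWithin).exists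
  have hη0 : 0 < η := hη0
  have hT1 : (1 : ℝ) ≤ 2 ^ (max T 0) := Real.one_le_rpow one_le_two (le_max_right _ _)
  set c : ℝ := 2 ^ (max T 0) with hc
  set m := Fintype.card (Fin d ⊕ Fin d) with hm
  have hc0 : 0 < c := by positivity
  -- The coordinates are improved one after another, each multiplying the scale by c. Starting from
  -- this h, every step stays below η and the final scale is at most h₁.
  set h := min η h₁ / c ^ m with hh
  have hh0 : 0 < h := by have := lt_min hη0 hh₁; positivity
  have hcm : c ^ m * h = min η h₁ := mul_div_cancel₀ _ (by positivity)
  refine ⟨h, hh0, 2 ^ m, fun f M hf => ?_⟩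
  have key : ∀ S : Finset (Fin d ⊕ Fin d), ∀ γ z, ‖mder γ f z‖ ≤
      2 ^ S.card * M * wt τ (c ^ S.card * h) γ *
        Real.exp (∑ j, (if j ∈ S then ε else r) * |coord j z| ^ (1 / θ j)) := by
    intro S
    induction S using Finset.induction_on with
    | empty =>
      intro γ z
      refine (hf γ z).trans (le_of_eq ?_)
      simp [grow, Finset.mul_sum, -Fintype.sum_sum_type]
    | insert i S hi ih =>
      intro γ z
      have hle : (S.card + 1) ≤ m := by
        rw [← Finset.card_insert_of_notMem hi]
        exact Finset.card_le_univ _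
      have hcS : c * (c ^ S.card * h) ≤ η := by
        rw [← mul_assoc, ← pow_succ']
        calc c ^ (S.card + 1) * h ≤ c ^ m * h := by gcongr
          _ ≤ η := hcm ▸ min_le_left _ _
      have h1 := norm_mder_le_update (T := max T 0) (h := c ^ S.card * h) (by positivity) hτ
        (fun i => (hT i).trans (le_max_left _ _)) i (hθ i) (hτθ i) hε
        (by have := hf.nonneg; positivity)
        (le_trans (mul_le_mul_of_nonneg_right hcS (by have := hθ i; positivity)) (hη i))
        (by rw [if_neg hi]; exact hr) ih γ z
      rw [Finset.card_insert_of_notMem hi, pow_succ', pow_succ', mul_assoc 2, mul_assoc c]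
      refine h1.trans (le_of_eq ?_)
      congr 2
      refine Finset.sum_congr rfl fun j _ => ?_
      by_cases hj : j = i
      · subst hj; simp
      · simp [hj]
  intro γ z
  have h1 := key Finset.univ γ z
  rw [Finset.card_univ, hcm] at h1
  have hM := hf.nonneg
  refine h1.trans ?_
  have h2 := wt_mono (τ := τ) (lt_min hη0 hh₁).le (min_le_right η h₁) γ
  have h3 : ∑ j, (if j ∈ Finset.univ then ε else r) * |coord j z| ^ (1 / θ j) = ε * grow θ z := by
    simp [grow, Finset.mul_sum, -Fintype.sum_sum_type]
  rw [h3]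
  gcongr

end EntireSymbols

/-! ## The operator on entire symbols -/

section Entire

open SmoothFun LineDeriv

variable {d : ℕ} {s σ : ℝ}

lemma GammaBeurling_le_GammaBeurlingZero (hs : 0 < s) (hσ : 0 < σ) (hsσ : s + σ ≤ 1) :
    GammaBeurling d d s σ σ s ≤ GammaBeurlingZero d d s σ σ s := by
  intro f hf
  obtain ⟨r, hr, H⟩ := (mem_GammaBeurling_iff hs hσ f).1 hf
  refine (mem_GammaBeurlingZero_iff hs hσ f).2 fun h₁ ε hh₁ hε => ?_
  obtain ⟨h, hh, C, HC⟩ := exists_symbolBound_of_scale (d := d)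
    (fun i => (blockExp_pos hσ hs i).le) (blockExp_le_add hσ hs) (blockExp_pos hs hσ)
    (fun i => (blockExp_add s σ i).trans_le hsσ) hr.le hε hh₁
  obtain ⟨M, hM⟩ := H h hh
  exact ⟨_, HC f M hM⟩

lemma mder_mem_GammaRoumieuZero (hs : 0 < s) (hσ : 0 < σ) {f : SmoothFun d d}
    (hf : f ∈ GammaRoumieuZero d d s σ σ s) (γ : Fin d ⊕ Fin d → ℕ) :
    mder γ f ∈ GammaRoumieuZero d d s σ σ s := by
  obtain ⟨h, hh, H⟩ := (mem_GammaRoumieuZero_iff hs hσ f).1 hf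
  refine (mem_GammaRoumieuZero_iff hs hσ _).2 ⟨2 ^ (σ + s) * h, by positivity, fun r hr => ?_⟩
  obtain ⟨M, hM⟩ := H r hr
  exact ⟨_, hM.mder hh.le (fun i => (blockExp_pos hσ hs i).le) (blockExp_le_add hσ hs) γ⟩

lemma mder_single_one (i : Fin d ⊕ Fin d) (f : SmoothFun d d) :
    mder (Pi.single i 1) f = pderiv (bvec i) f := by
  rw [mder_single, pow_one]

lemma lineDeriv_mem_GSRoumieu (hs : 0 < s) (hσ : 0 < σ) (i : Fin d ⊕ Fin d) :
    ∀ p ∈ GSRoumieu d d s σ σ s, ∂_{bvec i} p ∈ GSRoumieu d d s σ σ s := by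
  intro p hp
  obtain ⟨h, a, M, hh, ha, hM⟩ := (mem_GSRoumieu_iff hs hσ p).1 hp
  have h1 := hM.mder hh.le (fun i => (blockExp_pos hσ hs i).le) (blockExp_le_add hσ hs)
    (Pi.single i 1)
  rw [mder_single_one, ← ofSchwartz_lineDeriv] at h1
  exact (mem_GSRoumieu_iff hs hσ _).2 ⟨2 ^ (σ + s) * h, a, _, by positivity, ha, h1⟩

lemma integral_pderiv_mul (hs : 0 < s) (hσ : 0 < σ) {f : SmoothFun d d}
    (hf : f ∈ GammaRoumieuZero d d s σ σ s) {p : 𝓢(PhaseSpace d d, ℂ)}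
    (hp : p ∈ GSRoumieu d d s σ σ s) (i : Fin d ⊕ Fin d) :
    ∫ z, pderiv (bvec i) f z * p z = -∫ z, f z * (∂_{bvec i} p : 𝓢(PhaseSpace d d, ℂ)) z := by
  obtain ⟨u, hu⟩ := exists_dual_of_mem_GammaRoumieuZero hs hσ f hf
  obtain ⟨v, hv⟩ := exists_dual_of_mem_GammaRoumieuZero hs hσ _
    (mder_mem_GammaRoumieuZero hs hσ hf (Pi.single i 1))
  rw [mder_single_one] at hv
  have h1 := integral_mul_fderiv_eq_neg_fderiv_mul_of_integrable (f := f.1) (g := p)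
    (v := bvec i) (μ := volume) (hv ⟨p, hp⟩).1 (hu ⟨_, lineDeriv_mem_GSRoumieu hs hσ i p hp⟩).1
    (hu ⟨p, hp⟩).1 (fun z _ => f.differentiable z) (fun z _ => p.differentiableAt)
  have h2 : ∫ z, f z * (∂_{bvec i} p : 𝓢(PhaseSpace d d, ℂ)) z =
      -∫ z, pderiv (bvec i) f z * p z := h1
  rw [h2, neg_neg]

/-- On Schwartz functions the operator commutes with derivatives. Integration by parts carries this
over to the pairings, and these determine the symbols. -/
lemma mder_symbolOp {A : Matrix (Fin d) (Fin d) ℝ} {w : SmoothFun d d} (hs : 0 < s) (hσ : 0 < σ)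
    (hsσ : 1 ≤ s + σ)
    (hw : ∀ f ∈ GammaRoumieuZero d d s σ σ s, symbolOp A w f ∈ GammaRoumieuZero d d s σ σ s ∧
      IsWeakTransform (GSRoumieu d d s σ σ s) A f (symbolOp A w f))
    {f : SmoothFun d d} (hf : f ∈ GammaRoumieuZero d d s σ σ s) (γ : Fin d ⊕ Fin d → ℕ) :
    mder γ (symbolOp A w f) = symbolOp A w (mder γ f) := by
  induction γ using multiindex_induction with
  | h0 => simp
  | hs γ i ih =>
    rw [mder_add_single', mder_add_single', ih]
    have hg := mder_mem_GammaRoumieuZero hs hσ hf γ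
    set g := mder γ f
    have hF := (hw g hg).1
    have hg' : pderiv (bvec i) g ∈ GammaRoumieuZero d d s σ σ s := by
      rw [← mder_single_one]
      exact mder_mem_GammaRoumieuZero hs hσ hg _
    have hF' : pderiv (bvec i) (symbolOp A w g) ∈ GammaRoumieuZero d d s σ σ s := by
      rw [← mder_single_one]
      exact mder_mem_GammaRoumieuZero hs hσ hF _
    have hF'' := (hw _ hg').1
    refine sub_eq_zero.1 (eq_zero_of_integral_GSRoumieu hs hσ hsσ (Submodule.sub_mem _ hF' hF'')
      fun p hp => ?_)
    obtain ⟨u, hu⟩ := exists_dual_of_mem_GammaRoumieuZero hs hσ _ hF'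
    obtain ⟨v, hv⟩ := exists_dual_of_mem_GammaRoumieuZero hs hσ _ hF''
    refine (integral_sub_mul (hu ⟨p, hp⟩).1 (hv ⟨p, hp⟩).1).trans (sub_eq_zero.2 ?_)
    rw [integral_pderiv_mul hs hσ hF hp,
      (hw g hg).2 _ (lineDeriv_mem_GSRoumieu hs hσ i p hp), (hw _ hg').2 p hp,
      integral_pderiv_mul hs hσ hg (expAD_mem_GSRoumieu A hs hσ hsσ p hp), lineDeriv_expAD]

/-- The Roumieu estimate alone would not give a small scale. Only its sup bound is used, applied to
∂^γ f at scale 1; the weight of γ at scale h' is then inherited from the bounds on f, since the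
operator commutes with ∂^γ. -/
lemma exists_symbolOp_entire {A : Matrix (Fin d) (Fin d) ℝ} {w : SmoothFun d d} (hs : 0 < s)
    (hσ : 0 < σ) (hsσ : 1 ≤ s + σ)
    (hw : (∀ h, 0 < h → ∃ h', 0 < h' ∧ ∀ R, 0 < R → ∃ r, 0 < r ∧ ∃ C : ℝ,
        ∀ (f : SmoothFun d d) (M : ℝ), SymbolBound (blockExp d σ s) (blockExp d s σ) h r M f →
          SymbolBound (blockExp d σ s) (blockExp d s σ) h' R (C * M) (symbolOp A w f)) ∧
      ∀ f ∈ GammaRoumieuZero d d s σ σ s, symbolOp A w f ∈ GammaRoumieuZero d d s σ σ s ∧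
        IsWeakTransform (GSRoumieu d d s σ σ s) A f (symbolOp A w f))
    {h' R : ℝ} (hh' : 0 < h') (hR : 0 < R) : ∃ h r : ℝ, 0 < h ∧ 0 < r ∧ ∃ C : ℝ,
      ∀ f ∈ GammaRoumieuZero d d s σ σ s, ∀ M : ℝ,
        SymbolBound (blockExp d σ s) (blockExp d s σ) h r M f →
        SymbolBound (blockExp d σ s) (blockExp d s σ) h' R (C * M) (symbolOp A w f) := by
  obtain ⟨h₁, hh₁, H⟩ := hw.1 1 one_pos
  obtain ⟨r, hr, C, HC⟩ := H R hR
  have h0 : 0 < min 1 h' := lt_min one_pos hh'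
  have hη : (2 : ℝ) ^ (σ + s) * (min 1 h' / 2 ^ (σ + s)) = min 1 h' :=
    mul_div_cancel₀ _ (by positivity)
  -- Differentiating f multiplies the scale by 2^(σ+s). The result `min 1 h'` is admissible both as
  -- the scale of ∂^γ f and as the weight of γ.
  refine ⟨min 1 h' / 2 ^ (σ + s), r, by positivity, hr, C, fun f hf M hM γ z => ?_⟩
  have h1 := hM.mder (by positivity) (fun i => (blockExp_pos hσ hs i).le) (blockExp_le_add hσ hs) γ
  rw [hη] at h1
  have h2 := h1.mono h0.le (min_le_left _ _) le_rfl (mul_le_mul_of_nonneg_left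
    (wt_mono h0.le (min_le_right _ _) γ) hM.nonneg)
  have h3 := (HC _ _ h2).norm_le z
  rw [← mder_symbolOp hs hσ hsσ hw.2 hf] at h3
  rwa [mul_assoc C]

lemma symbolOp_mem_GammaBeurlingZero {A : Matrix (Fin d) (Fin d) ℝ} {w : SmoothFun d d}
    (hs : 0 < s) (hσ : 0 < σ)
    (H : ∀ h' R : ℝ, 0 < h' → 0 < R → ∃ h r : ℝ, 0 < h ∧ 0 < r ∧ ∃ C : ℝ,
      ∀ f ∈ GammaRoumieuZero d d s σ σ s, ∀ M : ℝ,
        SymbolBound (blockExp d σ s) (blockExp d s σ) h r M f →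
        SymbolBound (blockExp d σ s) (blockExp d s σ) h' R (C * M) (symbolOp A w f))
    {f : SmoothFun d d} (hf : f ∈ GammaBeurlingZero d d s σ σ s) :
    symbolOp A w f ∈ GammaBeurlingZero d d s σ σ s := by
  refine (mem_GammaBeurlingZero_iff hs hσ _).2 fun h' R hh' hR => ?_
  obtain ⟨h, r, hh, hr, C, H⟩ := H h' R hh' hR
  obtain ⟨M, hM⟩ := (mem_GammaBeurlingZero_iff hs hσ f).1 hf h r hh hr
  exact ⟨_, H f (GammaBeurlingZero_le_GammaRoumieuZero hs hσ hf) M hM⟩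

theorem restrictsToHomeomorphism_GammaBeurlingZero_entire {A : Matrix (Fin d) (Fin d) ℝ}
    (hs : 0 < s) (hσ : 0 < σ) (hsσ : 1 ≤ s + σ)
    {L : GSRoumieuDual d d s σ σ s → GSRoumieuDual d d s σ σ s}
    (hL : IsDistributionalExtension A L) :
    RestrictsToHomeomorphism L (GammaBeurlingZero d d s σ σ s) := by
  obtain ⟨w, hw⟩ := exists_symbolOp_window_roumieu d hs hσ hsσ
  have hle := GammaBeurlingZero_le_GammaRoumieuZero (d := d) hs hσ
  have H := fun B (h' R : ℝ) => exists_symbolOp_entire (h' := h') (R := R) hs hσ hsσ (hw B)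
  refine hL.restrictsToHomeomorphism (expAD_mem_GSRoumieu (-A) hs hσ hsσ)
    (fun f hf => exists_dual_of_mem_GammaRoumieuZero hs hσ f (hle hf))
    (fun f hf => eq_zero_of_integral_GSRoumieu hs hσ hsσ (hle hf)) (fun B => symbolOp B w)
    (fun B f hf => ⟨symbolOp_mem_GammaBeurlingZero hs hσ (H B) hf, ((hw B).2 f (hle hf)).2⟩)
    fun B T hT => continuous_GammaBeurlingZero hs hσ T fun h' R hh' hR => ?_
  obtain ⟨h, r, hh, hr, C, H⟩ := H B h' R hh' hR
  refine ⟨h, r, hh, hr, C, fun f M hf => ?_⟩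
  rw [hT]
  exact H f (hle f.2) M hf

theorem restrictsToHomeomorphism_GammaBeurling_entire {A : Matrix (Fin d) (Fin d) ℝ}
    (hs : 0 < s) (hσ : 0 < σ) (hsσ : s + σ = 1)
    {L : GSRoumieuDual d d s σ σ s → GSRoumieuDual d d s σ σ s}
    (hL : IsDistributionalExtension A L) :
    RestrictsToHomeomorphism L (GammaBeurling d d s σ σ s) := by
  obtain ⟨w, hw⟩ := exists_symbolOp_window_roumieu d hs hσ hsσ.ge
  have hle0 := GammaBeurling_le_GammaBeurlingZero (d := d) hs hσ hsσ.le
  have hle := hle0.trans (GammaBeurlingZero_le_GammaRoumieuZero (d := d) hs hσ)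
  have H := fun B (h' R : ℝ) => exists_symbolOp_entire (h' := h') (R := R) hs hσ hsσ.ge (hw B)
  refine hL.restrictsToHomeomorphism (expAD_mem_GSRoumieu (-A) hs hσ hsσ.ge)
    (fun f hf => exists_dual_of_mem_GammaRoumieuZero hs hσ f (hle hf))
    (fun f hf => eq_zero_of_integral_GSRoumieu hs hσ hsσ.ge (hle hf)) (fun B => symbolOp B w)
    (fun B f hf => ⟨GammaBeurlingZero_le hs hσ (symbolOp_mem_GammaBeurlingZero hs hσ (H B) (hle0 hf)),
      ((hw B).2 f (hle hf)).2⟩)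
    fun B T hT => continuous_GammaBeurling hs hσ T fun r hr => ⟨1, one_pos, fun h' hh' => ?_⟩
  -- The operator needs the small growth ε, whereas f has only the growth r. For s + σ = 1 a smaller
  -- scale h provides it, and growth 1 in the target suffices for all h'.
  obtain ⟨h₁, ε, hh₁, hε, C, H⟩ := H B h' 1 hh' one_pos
  obtain ⟨h, hh, C', HC⟩ := exists_symbolBound_of_scale (d := d)
    (fun i => (blockExp_pos hσ hs i).le) (blockExp_le_add hσ hs) (blockExp_pos hs hσ)
    (fun i => (blockExp_add s σ i).trans_le hsσ.le) hr.le hε hh₁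
  refine ⟨h, hh, C * C', fun f M hf => ?_⟩
  rw [hT, mul_assoc]
  exact H f (hle f.2) _ (HC f M hf)

end Entire

end

theorem mainTheorem6 (d : ℕ) (s σ : ℝ) (hs : 0 < s) (hσ : 0 < σ) (hsσ : 1 ≤ s + σ)
    (A : Matrix (Fin d) (Fin d) ℝ) :
    (∃ L : GSRoumieuDual d d s σ σ s → GSRoumieuDual d d s σ σ s,
      IsDistributionalExtension A L ∧
      RestrictsToHomeomorphism L (GammaRoumieuZero d d s σ σ s) ∧
      ((s, σ) ≠ (1 / 2, 1 / 2) → s + σ = 1 →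
        RestrictsToHomeomorphism L (GammaBeurling d d s σ σ s) ∧
        RestrictsToHomeomorphism L (GammaBeurlingZero d d s σ σ s))) ∧
    ((s, σ) ≠ (1 / 2, 1 / 2) → 1 < s + σ →
      ∃ L : GSBeurlingDual d d s σ σ s → GSBeurlingDual d d s σ σ s,
        IsDistributionalExtension A L ∧
        RestrictsToHomeomorphism L (GammaBeurling d d s σ σ s) ∧
        RestrictsToHomeomorphism L (GammaBeurlingZero d d s σ σ s)) := by
  refine ⟨?_, fun _ hsσ' => ?_⟩
  · obtain ⟨L, hL⟩ := exists_roumieu_extension A hs hσ hsσ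
    exact ⟨L, hL, restrictsToHomeomorphism_GammaRoumieuZero hs hσ hsσ hL, fun _ h1 =>
      ⟨restrictsToHomeomorphism_GammaBeurling_entire hs hσ h1 hL,
        restrictsToHomeomorphism_GammaBeurlingZero_entire hs hσ hsσ hL⟩⟩
  · obtain ⟨L, hL⟩ := exists_beurling_extension A hs hσ hsσ
    exact ⟨L, hL, restrictsToHomeomorphism_GammaBeurling hs hσ hsσ' hL,
      restrictsToHomeomorphism_GammaBeurlingZero hs hσ hsσ' hL⟩
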